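/- Let $d\ge 0$ be an integer and let $\mathfrak R\subset\mathbb R^d$ be a root system, that is, a finite set of nonzero vectors such that for every $\alpha\in\mathfrak R$ we have $r_\alpha(\mathfrak R)=\mathfrak R$ and $\mathbb R\alpha\cap\mathfrak R=\{\alpha,-\alpha\}$, where $r_\alpha x=x-2\frac{\langle\alpha,x\rangle}{|\alpha|^2}\alpha$; it is normalized by $|\alpha|^2=2$ for all $\alpha\in\mathfrak R$. Let $\mathfrak R_+\subset\mathfrak R$ be such that $\mathfrak R$ is the disjoint union of $\mathfrak R_+$ and $-\mathfrak R_+$, let $G$ be the group generated by the reflections $r_\alpha$, $\alpha\in\mathfrak R$, and let $\kappa:\mathfrak R\to[0,\infty)$ satisfy $\kappa_{g\alpha}=\kappa_\alpha$ for all $g\in G$, $\alpha\in\mathfrak R$. Put $\lambda_\kappa=\sum_{\alpha\in\mathfrak R_+}\kappa_\alpha$. For $\xi\in\mathbb R^d$ let $$\mathrm D_\xi f(x)=\partial_\xi f(x)+\sum_{\alpha\in\mathfrak R_+}\kappa_\alpha\langle\alpha,\xi\rangle\,\frac{f(x)-f(r_\alpha x)}{\langle\alpha,x\rangle}$$ be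 the Dunkl operator, where for $\langle\alpha,x\rangle=0$ the quotient is understood as its continuous extension $\partial_\alpha f(x)$, and let $\Delta_\kappa=\sum_{i=1}^d \mathrm D_{e_i}^2$ be the Dunkl Laplacian, where $(e_i)$ is the standard basis of $\mathbb R^d$. Suppose that $G$ is isomorphic to $\mathbb Z_2^d$. Let $T\in(0,\infty]$ and let $u:[0,T)\times\mathbb R^d\to(0,\infty)$ be a solution of the Dunkl heat equation $$\partial_t u(t,x)=\Delta_\kappa\big(u(t,\cdot)\big)(x),\qquad (t,x)\in(0,T)\times\mathbb R^d,$$ which is of class $C^2$ on $(0,T)\times\mathbb R^d$. Then for all $0<s<t<T$ and all $x,y\in\mathbb R^d$, $$u(s,x)\le u(t,y)\Big(\frac ts\Big)^{\lambda_\kappa+d/2}\exp\Big(\frac{|x-y|^2}{4(t-s)}\Big).$$ -/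

import Mathlib

/-- A (reduced, normalized) root system in `ℝ^d`: a finite set of nonzero vectors that is mapped onto
itself by each reflection in the hyperplane orthogonal to one of its members, that meets
each line `ℝ α` with `α` in the set exactly in `{α, -α}`, and with `|α|² = 2`. -/
structure IsRootSystem {d : ℕ} (R : Finset (EuclideanSpace ℝ (Fin d))) : Prop where
  ne_zero : ∀ α ∈ R, α ≠ 0
  image_reflection : ∀ α ∈ R,
    (Submodule.span ℝ {α})ᗮ.reflection '' (R : Set (EuclideanSpace ℝ (Fin d))) = R
  line_inter : ∀ α ∈ R,
    {v | ∃ a : ℝ, v = a • α} ∩ (R : Set (EuclideanSpace ℝ (Fin d))) = {α, -α}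
  norm_sq : ∀ α ∈ R, ‖α‖ ^ 2 = 2

/-- `P` is a choice of positive roots: `R` is the disjoint union of `P` and `-P`. -/
structure IsPositiveSubsystem {d : ℕ} (R P : Finset (EuclideanSpace ℝ (Fin d))) : Prop where
  mem_iff : ∀ α, α ∈ R ↔ α ∈ P ∨ -α ∈ P
  neg_notMem : ∀ α ∈ P, -α ∉ P

/-- The reflection group generated by the reflections in the hyperplanes orthogonal to the
roots. -/
noncomputable def reflectionGroup {d : ℕ} (R : Finset (EuclideanSpace ℝ (Fin d))) :
    Subgroup (EuclideanSpace ℝ (Fin d) ≃ₗᵢ[ℝ] EuclideanSpace ℝ (Fin d)) :=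
  Subgroup.closure {g | ∃ α ∈ R, g = (Submodule.span ℝ {α})ᗮ.reflection}

/-- A nonnegative multiplicity function: invariant under the reflection group (only its values
on `R` matter). -/
structure IsMultiplicity {d : ℕ} (R : Finset (EuclideanSpace ℝ (Fin d)))
    (κ : EuclideanSpace ℝ (Fin d) → ℝ) : Prop where
  nonneg : ∀ α ∈ R, 0 ≤ κ α
  invariant : ∀ g ∈ reflectionGroup R, ∀ α ∈ R, κ (g α) = κ α

open Classical in
/-- The difference quotient `(f(x) - f(r_α x)) / ⟨α, x⟩`. On the hyperplane `⟨α, x⟩ = 0` it is given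
by its continuous extension: as `x - r_α x = ⟨α, x⟩ α` when `|α|² = 2`, this is `∂_α f(x)` for
`f` of class `C¹`. -/
noncomputable def dunklQuotient {d : ℕ} (α : EuclideanSpace ℝ (Fin d))
    (f : EuclideanSpace ℝ (Fin d) → ℝ) (x : EuclideanSpace ℝ (Fin d)) : ℝ :=
  if inner ℝ α x = 0 then fderiv ℝ f x α
  else (f x - f ((Submodule.span ℝ {α})ᗮ.reflection x)) / inner ℝ α x

/-- The Dunkl operator `D_ξ f = ∂_ξ f + ∑_{α ∈ P} κ_α ⟨α, ξ⟩ (f - f ∘ r_α) / ⟨α, ·⟩`. -/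
noncomputable def dunklOperator {d : ℕ} (P : Finset (EuclideanSpace ℝ (Fin d)))
    (κ : EuclideanSpace ℝ (Fin d) → ℝ) (ξ : EuclideanSpace ℝ (Fin d))
    (f : EuclideanSpace ℝ (Fin d) → ℝ) (x : EuclideanSpace ℝ (Fin d)) : ℝ :=
  fderiv ℝ f x ξ + ∑ α ∈ P, κ α * inner ℝ α ξ * dunklQuotient α f x

/-- The Dunkl Laplacian `∑ᵢ D_{eᵢ}²`. For `f` of class `C²` each `D_{eᵢ} f` is of class `C¹`, so
that this is meaningful at every point. -/
noncomputable def dunklLaplacian {d : ℕ} (P : Finset (EuclideanSpace ℝ (Fin d)))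
    (κ : EuclideanSpace ℝ (Fin d) → ℝ)
    (f : EuclideanSpace ℝ (Fin d) → ℝ) (x : EuclideanSpace ℝ (Fin d)) : ℝ :=
  ∑ i : Fin d, dunklOperator P κ (EuclideanSpace.single i 1)
    (dunklOperator P κ (EuclideanSpace.single i 1) f) x

/-- `u` is a `C²` solution of the Dunkl heat equation `∂ₜ u = Δ_κ u` on `(0, T) × ℝ^d`. -/
structure IsDunklHeatSolution {d : ℕ} (P : Finset (EuclideanSpace ℝ (Fin d)))
    (κ : EuclideanSpace ℝ (Fin d) → ℝ) (T : EReal)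
    (u : ℝ → EuclideanSpace ℝ (Fin d) → ℝ) : Prop where
  contDiffOn : ContDiffOn ℝ 2 (fun p : ℝ × EuclideanSpace ℝ (Fin d) => u p.1 p.2)
    {p | 0 < p.1 ∧ (p.1 : EReal) < T}
  heat_eq : ∀ t : ℝ, 0 < t → (t : EReal) < T → ∀ x : EuclideanSpace ℝ (Fin d),
    deriv (fun τ => u τ x) t = dunklLaplacian P κ (u t) x

open MeasureTheory ProbabilityTheory Real Filter Topology

/-! Commutativity of `G` forces distinct positive roots to be orthogonal: evaluating `r_α r_β = r_β
r_α` at `α` shows that `r_β α` is a multiple of `α`. In a suitable orthonormal basis the reflections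
are therefore sign changes of coordinates, and off the hyperplanes `Δ_κ` is a sum of one-dimensional
squared Dunkl operators (`dunklLaplacian_eq_sum_axisDunkl`, `axisDunkl_axisDunkl_ofCoord`). Its heat
kernel is a product of one-dimensional kernels.

In dimension one, the Dunkl kernel is `E(w) = ∫ exp(w r) dμ(r)` with `μ` a probability measure on
`[-1, 1]`. The heat kernel is thus `h^(-(k + 1/2))` times an average over `r` of Gaussian
exponentials, and completing a square for each fixed `r` yields the sharp Harnack inequality for the
kernel itself (`heat_harnack`). The exponents `k_j + 1/2` add up to `λ_κ + d/2`.

To pass from the kernel to a positive solution `v`, one represents `v(s, x)` and `v(t, y)` as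
integrals of the same `v(ε, ·)` against the kernels of times `s - ε` and `t - ε`, compares
integrands, and lets `ε → 0`. Since no growth of `v` is assumed, the representation needs
positivity. First, a convex truncation of the kernel centred at the origin is a compactly supported
subsolution of the backward equation; pairing it with `v` gives a quantity increasing in time,
whence the Gaussian moment bound `integral_mul_prodHeat_zero_le`. Second, with a radial cutoff of
radius `R`, the commutator error is supported far out, where it is dominated by a small multiple of
a kernel of slightly longer time centred at the origin; the moment bound makes it tend to zero
(`tendsto_integral_mul_cutoff_mul_prodHeat`). The comparison is `coord_harnack`. -/

/-! ### The one-dimensional Dunkl kernel. -/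

lemma intervalIntegrable_one_sub_sq_rpow {k : ℝ} (hk : 0 < k) :
    IntervalIntegrable (fun r : ℝ => (1 - r ^ 2) ^ (k - 1)) volume (-1) 1 := by
  have h1 : IntervalIntegrable (fun r : ℝ => (1 - r) ^ (k - 1)) volume (-1) 1 := by
    have := (intervalIntegral.intervalIntegrable_rpow' (a := 0) (b := 2)
      (r := k - 1) (by linarith)).comp_sub_left 1
    norm_num at this
    exact this.symm
  have h2 : IntervalIntegrable (fun r : ℝ => (1 + r) ^ (k - 1)) volume (-1) 1 := by
    have := (intervalIntegral.intervalIntegrable_rpow' (a := 0) (b := 2)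
      (r := k - 1) (by linarith)).comp_add_left 1
    norm_num at this
    exact this
  refine ((h1.add h2).const_mul (1 + 2 ^ (k - 1))).mono_fun' ?_ ?_
  · exact (Measurable.aestronglyMeasurable (by fun_prop))
  · rw [Set.uIoc_of_le (by norm_num)]
    refine (ae_restrict_iff' measurableSet_Ioc).2 (Filter.Eventually.of_forall ?_)
    rintro r ⟨hr1, hr2⟩
    -- On each half of the interval one of the bases `1 - r`, `1 + r` lies in `[1, 2]`. The constant
    -- covers both signs of `k - 1`.
    have hp : ∀ b : ℝ, 1 ≤ b → b ≤ 2 → b ^ (k - 1) ≤ 1 + 2 ^ (k - 1) := by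
      intro b hb1 hb2
      rcases le_total (k - 1) 0 with h | h
      · have := Real.rpow_le_one_of_one_le_of_nonpos hb1 h
        have := Real.rpow_pos_of_pos (two_pos : (0:ℝ) < 2) (k - 1)
        linarith
      · have := Real.rpow_le_rpow (by linarith) hb2 h
        linarith
    have e : (1 - r ^ 2) ^ (k - 1) = (1 - r) ^ (k - 1) * (1 + r) ^ (k - 1) := by
      rw [← Real.mul_rpow (by linarith) (by linarith)]
      ring_nf
    have a1 : 0 ≤ (1 - r) ^ (k - 1) := Real.rpow_nonneg (by linarith) _
    have a2 : 0 ≤ (1 + r) ^ (k - 1) := Real.rpow_nonneg (by linarith) _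
    have a3 : (0:ℝ) ≤ 2 ^ (k - 1) := Real.rpow_nonneg (by norm_num) _
    beta_reduce
    rw [e, Real.norm_of_nonneg (by positivity)]
    rcases le_total 0 r with h | h
    · have := hp (1 + r) (by linarith) (by linarith)
      nlinarith [mul_le_mul_of_nonneg_left this a1, mul_nonneg a3 a2]
    · have := hp (1 - r) (by linarith) (by linarith)
      nlinarith [mul_le_mul_of_nonneg_left this a2, mul_nonneg a3 a1]

/-- Integration by parts; the boundary terms vanish because `k > 0`. The derivative is taken in the
open interval only, as `(1 - r ^ 2) ^ (k - 1)` may blow up at the ends. -/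
lemma integral_exp_mul_one_sub_sq_rpow {k : ℝ} (hk : 0 < k) (w : ℝ) :
    w * ∫ r in (-1 : ℝ)..1, exp (w * r) * (1 - r ^ 2) ^ k =
      2 * k * ∫ r in (-1 : ℝ)..1, exp (w * r) * (r * (1 - r ^ 2) ^ (k - 1)) := by
  have hi := intervalIntegrable_one_sub_sq_rpow hk
  have i1 : IntervalIntegrable (fun r : ℝ => exp (w * r) * (r * (1 - r ^ 2) ^ (k - 1)))
      volume (-1) 1 := by
    have := hi.continuousOn_mul (g := fun r : ℝ => exp (w * r) * r) (by fun_prop)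
    simpa only [mul_assoc] using this
  have i2 : IntervalIntegrable (fun r : ℝ => exp (w * r) * (1 - r ^ 2) ^ k) volume (-1) 1 := by
    apply Continuous.intervalIntegrable
    have : Continuous fun r : ℝ => (1 - r ^ 2) ^ k :=
      (by fun_prop : Continuous fun r : ℝ => 1 - r ^ 2).rpow_const (fun _ => Or.inr hk.le)
    fun_prop
  have key := intervalIntegral.integral_eq_sub_of_hasDerivAt_of_le (a := (-1 : ℝ)) (b := 1)
    (f := fun r => exp (w * r) * (1 - r ^ 2) ^ k)
    (f' := fun r => w * (exp (w * r) * (1 - r ^ 2) ^ k) -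
      2 * k * (exp (w * r) * (r * (1 - r ^ 2) ^ (k - 1)))) (by norm_num)
    (by
      have : Continuous fun r : ℝ => (1 - r ^ 2) ^ k :=
        (by fun_prop : Continuous fun r : ℝ => 1 - r ^ 2).rpow_const (fun _ => Or.inr hk.le)
      fun_prop)
    (by
      rintro r ⟨h1, h2⟩
      have h3 : (1 - r ^ 2) ≠ 0 := by nlinarith
      have d1 : HasDerivAt (fun r : ℝ => exp (w * r)) (exp (w * r) * (w * 1)) r :=
        ((hasDerivAt_id r).const_mul w).exp
      have d2 : HasDerivAt (fun r : ℝ => 1 - r ^ 2) (-(2 * r)) r := by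
        simpa using (hasDerivAt_pow 2 r).const_sub 1
      have d3 := d2.rpow_const (p := k) (Or.inl h3)
      refine (d1.mul d3).congr_deriv ?_
      ring)
    ((i2.const_mul w).sub (i1.const_mul (2 * k)))
  rw [intervalIntegral.integral_sub (i2.const_mul w) (i1.const_mul _),
    intervalIntegral.integral_const_mul, intervalIntegral.integral_const_mul] at key
  norm_num [Real.zero_rpow hk.ne'] at key
  linarith

/-- The measure has density proportional to `ρ(r) = (1 + r) (1 - r²)^(k - 1)`, and is the unit mass
at `1` when `k = 0`, so that the kernel is then `exp`. The last identity is the equation `w (E - E')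
= k (E(w) - E(-w))` in integrated form. It holds because `(1 - r) ρ(r) = (1 - r²)^k` and `ρ(r) -
ρ(-r) = 2 r (1 - r²)^(k - 1)`, two functions linked by integration by parts. -/
lemma exists_dunklMeasure {k : ℝ} (hk : 0 ≤ k) : ∃ μ : Measure ℝ, IsProbabilityMeasure μ ∧
    (∀ᵐ r ∂μ, r ∈ Set.Icc (-1 : ℝ) 1) ∧
    ∀ w, w * ∫ r, (1 - r) * exp (w * r) ∂μ = k * ∫ r, (exp (w * r) - exp (-(w * r))) ∂μ := by
  rcases hk.eq_or_lt with rfl | hk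
  · refine ⟨Measure.dirac 1, inferInstance, ?_, ?_⟩
    · refine (ae_dirac_iff (p := fun r => r ∈ Set.Icc (-1 : ℝ) 1) measurableSet_Icc).2 ?_; norm_num
    · intro w; simp
  set ρ : ℝ → ℝ := fun r => (1 + r) * (1 - r ^ 2) ^ (k - 1) with hρ
  have hi := intervalIntegrable_one_sub_sq_rpow hk
  have hρi : IntervalIntegrable ρ volume (-1) 1 :=
    hi.continuousOn_mul (g := fun r : ℝ => 1 + r) (by fun_prop)
  have hρ0 : ∀ r ∈ Set.Ioo (-1 : ℝ) 1, 0 < ρ r := by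
    rintro r ⟨h1, h2⟩
    have : 0 < 1 - r ^ 2 := by nlinarith
    have := Real.rpow_pos_of_pos this (k - 1)
    have : 0 < 1 + r := by linarith
    simp only [hρ]; positivity
  set c := ∫ r in (-1 : ℝ)..1, ρ r with hc
  have hc0 : 0 < c := intervalIntegral.intervalIntegral_pos_of_pos_on hρi hρ0 (by norm_num)
  have hρm : Measurable ρ := by fun_prop
  set ν : Measure ℝ := volume.restrict (Set.Ioo (-1 : ℝ) 1) with hν
  set μ : Measure ℝ := ν.withDensity (fun r => ENNReal.ofReal (c⁻¹ * ρ r)) with hμ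
  have hin : ∀ g : ℝ → ℝ, ∫ r, g r ∂μ = c⁻¹ * ∫ r in (-1 : ℝ)..1, ρ r * g r := by
    intro g
    rw [hμ, integral_withDensity_eq_integral_toReal_smul (by fun_prop) (by simp),
      intervalIntegral.integral_of_le (by norm_num), integral_Ioc_eq_integral_Ioo,
      ← integral_const_mul]
    refine setIntegral_congr_fun measurableSet_Ioo fun r hr => ?_
    have := hρ0 r hr
    simp only [smul_eq_mul]
    rw [ENNReal.toReal_ofReal (by positivity)]
    ring
  refine ⟨μ, ⟨?_⟩, ?_, ?_⟩
  · rw [hμ, withDensity_apply _ MeasurableSet.univ, Measure.restrict_univ,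
      ← ofReal_integral_eq_lintegral_ofReal]
    · rw [integral_const_mul, hν, ← integral_Ioc_eq_integral_Ioo,
        ← intervalIntegral.integral_of_le (by norm_num), ← hc, inv_mul_cancel₀ hc0.ne',
        ENNReal.ofReal_one]
    · have := (intervalIntegrable_iff_integrableOn_Ioo_of_le (by norm_num)).1 hρi
      exact this.integrable.const_mul _
    · refine (ae_restrict_iff' measurableSet_Ioo).2 (Filter.Eventually.of_forall fun r hr => ?_)
      have := hρ0 r hr
      simp only [Pi.zero_apply]; positivity
  · refine (withDensity_absolutelyContinuous ν _).ae_le ?_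
    exact (ae_restrict_iff' measurableSet_Ioo).2
      (Filter.Eventually.of_forall fun r hr => ⟨hr.1.le, hr.2.le⟩)
  · intro w
    rw [hin, hin]
    have e1 : ∫ r in (-1 : ℝ)..1, ρ r * ((1 - r) * exp (w * r)) =
        ∫ r in (-1 : ℝ)..1, exp (w * r) * (1 - r ^ 2) ^ k := by
      rw [intervalIntegral.integral_of_le (by norm_num), integral_Ioc_eq_integral_Ioo,
        intervalIntegral.integral_of_le (by norm_num), integral_Ioc_eq_integral_Ioo]
      refine setIntegral_congr_fun measurableSet_Ioo fun r hr => ?_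
      have h : 0 < 1 - r ^ 2 := by nlinarith [hr.1, hr.2]
      have : (1 - r ^ 2) ^ k = (1 - r ^ 2) ^ (k - 1) * (1 - r ^ 2) := by
        rw [← Real.rpow_add_one h.ne']; ring_nf
      simp only [hρ, this]; ring
    have j1 : IntervalIntegrable (fun r => ρ r * exp (w * r)) volume (-1) 1 :=
      hρi.mul_continuousOn (by fun_prop)
    have j2 : IntervalIntegrable (fun r => ρ r * exp (-(w * r))) volume (-1) 1 :=
      hρi.mul_continuousOn (by fun_prop)
    have e2 : ∫ r in (-1 : ℝ)..1, ρ r * (exp (w * r) - exp (-(w * r))) =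
        2 * ∫ r in (-1 : ℝ)..1, exp (w * r) * (r * (1 - r ^ 2) ^ (k - 1)) := by
      simp only [mul_sub]
      rw [intervalIntegral.integral_sub j1 j2]
      have e3 : ∫ r in (-1 : ℝ)..1, ρ r * exp (-(w * r)) =
          ∫ r in (-1 : ℝ)..1, ρ (-r) * exp (w * r) := by
        have := intervalIntegral.integral_comp_neg (a := (-1 : ℝ)) (b := 1)
          (f := fun r => ρ r * exp (-(w * r)))
        simp only [neg_neg, mul_neg] at this
        exact this.symm
      have j3 : IntervalIntegrable (fun r => ρ (-r) * exp (w * r)) volume (-1) 1 := by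
        have : IntervalIntegrable (fun r => ρ (-r)) volume (-1) 1 := by
          have := hi.continuousOn_mul (g := fun r : ℝ => 1 - r) (by fun_prop)
          simpa [hρ, ← sub_eq_add_neg] using this
        exact this.mul_continuousOn (by fun_prop)
      rw [e3, ← intervalIntegral.integral_sub j1 j3, ← intervalIntegral.integral_const_mul]
      congr 1
      ext r
      simp only [hρ, neg_sq]; ring
    rw [e1, e2]
    linear_combination c⁻¹ * integral_exp_mul_one_sub_sq_rpow hk w

/-- The properties of the one-dimensional Dunkl kernel `w ↦ E_k(w)` of parameter `k`. -/
structure IsDunklKernel (k : ℝ) (E : ℝ → ℝ) : Prop where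
  contDiff : ContDiff ℝ 2 E
  zero : E 0 = 1
  pos : ∀ w, 0 < E w
  abs_deriv_le : ∀ w, |deriv E w| ≤ E w
  le_exp : ∀ w, E w ≤ exp |w|
  ode : ∀ w, w * (E w - deriv E w) = k * (E w - E (-w))
  gaussian_le : ∀ s t x y z : ℝ, 0 < s → s < t →
    exp (-(x ^ 2 + z ^ 2) / (4 * s)) * E (x * z / (2 * s)) ≤
      exp (-(y ^ 2 + z ^ 2) / (4 * t)) * E (y * z / (2 * t)) *
        exp ((x - y) ^ 2 / (4 * (t - s)))

/-- `E` is the moment generating function of the measure above. Bounded support gives analyticity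
and the bounds on `E` and `E'`. The Gaussian comparison holds pointwise in `r` before integration.
-/
lemma exists_isDunklKernel {k : ℝ} (hk : 0 ≤ k) : ∃ E, IsDunklKernel k E := by
  obtain ⟨μ, hμ, hsupp, hode⟩ := exists_dunklMeasure hk
  have hint : ∀ w : ℝ, Integrable (fun r => exp (w * r)) μ := fun w =>
    integrable_exp_mul_of_mem_Icc aemeasurable_id hsupp
  have hset : integrableExpSet (id : ℝ → ℝ) μ = Set.univ := by
    ext w; simpa [integrableExpSet] using hint w
  have hana : ∀ w, AnalyticAt ℝ (mgf (id : ℝ → ℝ) μ) w := fun w =>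
    analyticAt_mgf (by simp [hset])
  have hder : ∀ w, deriv (mgf (id : ℝ → ℝ) μ) w = ∫ r, r * exp (w * r) ∂μ := fun w =>
    deriv_mgf (by simp [hset])
  have hE : ∀ w, mgf (id : ℝ → ℝ) μ w = ∫ r, exp (w * r) ∂μ := fun w => rfl
  have hint' : ∀ w : ℝ, Integrable (fun r => r * exp (w * r)) μ := by
    intro w
    refine (hint w).mono' (by fun_prop) ?_
    filter_upwards [hsupp] with r hr
    rw [norm_mul, Real.norm_of_nonneg (exp_pos _).le, Real.norm_eq_abs]
    exact mul_le_of_le_one_left (exp_pos _).le (abs_le.2 hr)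
  refine ⟨mgf id μ, ?_, by simp, fun w => mgf_pos (hint w), ?_, ?_, ?_, ?_⟩
  · exact contDiff_iff_contDiffAt.2 fun w => (hana w).contDiffAt
  · intro w
    rw [hder, hE]
    refine (abs_integral_le_integral_abs).trans (integral_mono_ae (hint' w).abs (hint w) ?_)
    filter_upwards [hsupp] with r hr
    rw [abs_mul, abs_of_pos (exp_pos _)]
    exact mul_le_of_le_one_left (exp_pos _).le (abs_le.2 hr)
  · intro w
    rw [hE]
    calc ∫ r, exp (w * r) ∂μ ≤ ∫ _, exp |w| ∂μ := by
          refine integral_mono_ae (hint w) (integrable_const _) ?_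
          filter_upwards [hsupp] with r hr
          refine exp_le_exp.2 ((le_abs_self _).trans ?_)
          rw [abs_mul]
          exact mul_le_of_le_one_right (abs_nonneg _) (abs_le.2 hr)
      _ = exp |w| := by simp
  · intro w
    have h := hode w
    have h1 : ∫ r, (1 - r) * exp (w * r) ∂μ =
        (∫ r, exp (w * r) ∂μ) - ∫ r, r * exp (w * r) ∂μ := by
      rw [← integral_sub (hint w) (hint' w)]
      congr 1; ext r; ring
    have h2 : ∫ r, (exp (w * r) - exp (-(w * r))) ∂μ =
        (∫ r, exp (w * r) ∂μ) - ∫ r, exp (-w * r) ∂μ := by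
      rw [← integral_sub (hint w) (hint (-w))]
      simp only [neg_mul]
    rw [hder, hE, hE, ← h1, h, h2]
  · intro s t x y z hs hst
    have ht : 0 < t := hs.trans hst
    have hts : 0 < t - s := by linarith
    rw [hE, hE, ← integral_const_mul, mul_right_comm, ← integral_const_mul]
    refine integral_mono_ae ((hint _).const_mul _) ((hint _).const_mul _) ?_
    filter_upwards [hsupp] with r hr
    rw [← exp_add, ← exp_add, ← exp_add, exp_le_exp]
    have hr2 : r ^ 2 ≤ 1 := by nlinarith [hr.1, hr.2]
    -- For fixed `r`, `x² + z² - 2xzr = (x - zr)² + z² (1 - r²)`. The first part gives the Euclidean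
    -- inequality `(y - zr)²/t ≤ (x - zr)²/s + (x - y)²/(t - s)`, whose defect is a square; the
    -- second has a sign because `|r| ≤ 1` and `s < t`.
    have key : -(y ^ 2 + z ^ 2) / (4 * t) + (x - y) ^ 2 / (4 * (t - s)) + y * z / (2 * t) * r -
        (-(x ^ 2 + z ^ 2) / (4 * s) + x * z / (2 * s) * r) =
        (t * (x - z * r) - s * (y - z * r)) ^ 2 / (4 * s * t * (t - s))
          + z ^ 2 * (1 - r ^ 2) * (t - s) / (4 * s * t) +
          (-(y - z * r) ^ 2 / (4 * t) + (x - z * r) ^ 2 / (4 * s) + (x - y) ^ 2 / (4 * (t - s))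
            - (t * (x - z * r) - s * (y - z * r)) ^ 2 / (4 * s * t * (t - s))) := by
      field_simp
      ring
    have key2 : (-(y - z * r) ^ 2 / (4 * t) + (x - z * r) ^ 2 / (4 * s)
        + (x - y) ^ 2 / (4 * (t - s))
            - (t * (x - z * r) - s * (y - z * r)) ^ 2 / (4 * s * t * (t - s))) = 0 := by
      field_simp
      ring
    have p1 : 0 ≤ (t * (x - z * r) - s * (y - z * r)) ^ 2 / (4 * s * t * (t - s)) := by positivity
    have p2 : 0 ≤ z ^ 2 * (1 - r ^ 2) * (t - s) / (4 * s * t) := by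
      have : 0 ≤ 1 - r ^ 2 := by linarith
      positivity
    linarith

/-! ### The squared Dunkl operator on the line and its symmetry. -/

/-- The square of the one-dimensional Dunkl operator of parameter `k`, in expanded form. -/
noncomputable def dunklSq (k : ℝ) (f : ℝ → ℝ) (r : ℝ) : ℝ :=
  deriv (deriv f) r + 2 * k / r * deriv f r - k * (f r - f (-r)) / r ^ 2

/-- The singular part of `dunklSq` is `-k / r ^ 2` times this expression, so the bound `O(r ^ 2)`
expresses the cancellation of the singularity. The derivative `f'(-x) - f'(x) - 2 x f''(x)` is at
most `4 C |x|`. -/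
lemma abs_sub_comp_neg_sub_le {f : ℝ → ℝ} (hf : ContDiff ℝ 2 f) {C r : ℝ}
    (hC : ∀ x, |x| ≤ |r| → |deriv (deriv f) x| ≤ C) :
    |f r - f (-r) - 2 * r * deriv f r| ≤ 4 * C * r ^ 2 := by
  have h1 : Differentiable ℝ f := hf.differentiable (by norm_num)
  have h2 : Differentiable ℝ (deriv f) :=
    ((contDiff_succ_iff_deriv (n := 1)).1 hf).2.2.differentiable (by norm_num)
  have hmem : ∀ x ∈ Set.uIcc (-r) r, |x| ≤ |r| := by
    intro x hx
    rw [Set.mem_uIcc] at hx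
    rcases hx with hx | hx
    · rw [abs_le]; constructor <;> [linarith [le_abs_self r]; linarith [le_abs_self r]]
    · rw [abs_le]; constructor <;> [linarith [neg_abs_le r]; linarith [neg_abs_le r]]
  have hC0 : 0 ≤ C := (abs_nonneg _).trans (hC 0 (by simp))
  have hlip : ∀ x ∈ Set.uIcc (-r) r, ∀ y ∈ Set.uIcc (-r) r,
      |deriv f x - deriv f y| ≤ C * |x - y| := by
    intro x hx y hy
    have := (convex_uIcc (-r) r).norm_image_sub_le_of_norm_deriv_le (f := deriv f) (C := C)
      (fun z _ => h2 z) (fun z hz => hC z (hmem z hz)) hy hx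
    simpa [Real.norm_eq_abs] using this
  have hder : ∀ x, HasDerivAt (fun x => f x - f (-x) - 2 * x * deriv f x)
      (deriv f (-x) - deriv f x - 2 * x * deriv (deriv f) x) x := by
    intro x
    have a := (h1 x).hasDerivAt
    have b : HasDerivAt (fun x => f (-x)) (-deriv f (-x)) x := by
      have := (h1 (-x)).hasDerivAt.scomp x (hasDerivAt_neg x)
      rw [neg_one_smul] at this
      exact this
    have c := (((hasDerivAt_id x).const_mul 2)).mul (h2 x).hasDerivAt
    refine ((a.sub b).sub c).congr_deriv ?_
    simp; ring
  have := (convex_uIcc (0:ℝ) r).norm_image_sub_le_of_norm_deriv_le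
      (f := fun x => f x - f (-x) - 2 * x * deriv f x) (C := 4 * C * |r|)
      (fun z _ => (hder z).differentiableAt) (fun z hz => ?_) (Set.left_mem_uIcc)
      (Set.right_mem_uIcc)
  · simp only [Real.norm_eq_abs, neg_zero, sub_self, mul_zero, zero_mul, sub_zero] at this
    rwa [mul_assoc (4 * C), ← abs_mul, abs_mul_self, ← sq] at this
  · rw [(hder z).deriv, Real.norm_eq_abs]
    have hz' : |z| ≤ |r| := by
      rw [Set.mem_uIcc] at hz
      rcases hz with hz | hz
      · rw [abs_of_nonneg hz.1, abs_of_nonneg (hz.1.trans hz.2)]; exact hz.2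
      · rw [abs_of_nonpos hz.2, abs_of_nonpos (hz.1.trans hz.2)]; linarith [hz.1]
    have hm : ∀ x, |x| ≤ |r| → x ∈ Set.uIcc (-r) r := by
      intro x hx
      rw [Set.mem_uIcc]
      rcases le_total 0 r with h | h
      · rw [abs_of_nonneg h] at hx; exact Or.inl (abs_le.1 hx)
      · rw [abs_of_nonpos h, abs_le] at hx; exact Or.inr ⟨by linarith [hx.1], hx.2⟩
    have e1 := hlip (-z) (hm _ (by rwa [abs_neg])) z (hm _ hz')
    have e2 : |-z - z| = 2 * |z| := by
      rw [show -z - z = -(2 * z) by ring, abs_neg, abs_mul]; norm_num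
    rw [e2] at e1
    have e3 := hC z hz'
    calc |deriv f (-z) - deriv f z - 2 * z * deriv (deriv f) z|
        ≤ |deriv f (-z) - deriv f z| + |2 * z * deriv (deriv f) z| := abs_sub _ _
      _ ≤ C * (2 * |z|) + 2 * |z| * C := by
          rw [abs_mul (2 * z), abs_mul 2 z, abs_two]
          gcongr
      _ ≤ 4 * C * |r| := by nlinarith

lemma abs_dunklSq_le {k : ℝ} (hk : 0 ≤ k) {f : ℝ → ℝ} (hf : ContDiff ℝ 2 f) {C r : ℝ}
    (hC : ∀ x, |x| ≤ |r| → |deriv (deriv f) x| ≤ C) :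
    |dunklSq k f r| ≤ (1 + 4 * k) * C := by
  have hC0 : 0 ≤ C := (abs_nonneg _).trans (hC 0 (by simp))
  have h1 := hC r le_rfl
  -- At `0`, division by zero leaves the value `f''(0)` instead of the continuous extension `(1 +
  -- 2k) f''(0)`. This is harmless: the bound persists and a point is a null set.
  rcases eq_or_ne r 0 with rfl | hr
  · simp only [dunklSq, div_zero, zero_mul, add_zero, ne_eq, OfNat.ofNat_ne_zero,
      not_false_eq_true, zero_pow, sub_zero]
    nlinarith
  · have h2 := abs_sub_comp_neg_sub_le hf hC
    have e : dunklSq k f r = deriv (deriv f) r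
        - k * ((f r - f (-r) - 2 * r * deriv f r) / r ^ 2) := by
      rw [dunklSq]; field_simp; ring
    rw [e]
    refine (abs_sub _ _).trans ?_
    rw [abs_mul, abs_div, abs_of_nonneg hk, abs_of_nonneg (sq_nonneg r)]
    have : |f r - f (-r) - 2 * r * deriv f r| / r ^ 2 ≤ 4 * C := by
      rw [div_le_iff₀ (by positivity)]; exact h2
    nlinarith

lemma continuous_abs_rpow {k : ℝ} (hk : 0 ≤ k) : Continuous fun r : ℝ => |r| ^ (2 * k) :=
  continuous_abs.rpow_const fun _ => Or.inr (by linarith)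

lemma hasDerivAt_abs_rpow_two_mul (k : ℝ) {r : ℝ} (hr : r ≠ 0) :
    HasDerivAt (fun r : ℝ => |r| ^ (2 * k)) (2 * k / r * |r| ^ (2 * k)) r := by
  have h := (hasDerivAt_abs hr).rpow_const (p := 2 * k) (Or.inl (abs_ne_zero.2 hr))
  refine h.congr_deriv ?_
  rw [Real.rpow_sub_one (abs_ne_zero.2 hr)]
  rcases lt_or_gt_of_ne hr with h | h
  · simp [h, abs_of_neg h]; field_simp
  · simp [h, abs_of_pos h]; field_simp

/-- A function whose symmetrization is, off the origin, the derivative of an even function has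
integral zero on symmetric intervals. -/
lemma integral_eq_zero_of_add_comp_neg {H Φ : ℝ → ℝ} {A : ℝ} (hA : 0 ≤ A)
    (hH : IntervalIntegrable H volume (-A) A) (hΦ : Continuous Φ)
    (hd : ∀ r, r ≠ 0 → HasDerivAt Φ (H r + H (-r)) r) :
    2 * ∫ r in (-A)..A, H r = Φ A - Φ (-A) := by
  have hH' : IntervalIntegrable (fun r => H (-r)) volume (-A) A := by
    have := (IntervalIntegrable.iff_comp_neg (f := H)).1 hH
    simpa using this.symm
  have := integral_eq_of_hasDerivAt_off_countable_of_le Φ (fun r => H r + H (-r))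
    (by linarith : -A ≤ A) (Set.countable_singleton 0) hΦ.continuousOn
    (fun r hr => hd r (by simpa using hr.2)) (hH.add hH')
  rw [intervalIntegral.integral_add hH hH', intervalIntegral.integral_comp_neg, neg_neg] at this
  linarith

lemma measurable_dunklSq (k : ℝ) {f : ℝ → ℝ} (hf : Measurable f) : Measurable (dunklSq k f) := by
  unfold dunklSq
  have := measurable_deriv f
  have := measurable_deriv (deriv f)
  fun_prop

lemma intervalIntegrable_dunklSq_mul {k : ℝ} (hk : 0 ≤ k) {f g : ℝ → ℝ} (hf : ContDiff ℝ 2 f)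
    (hg : Continuous g) (A : ℝ) :
    IntervalIntegrable (fun r => dunklSq k f r * g r * |r| ^ (2 * k)) volume (-A) A := by
  have hc : Continuous (deriv (deriv f)) :=
    (((contDiff_succ_iff_deriv (n := 1)).1 hf).2.2).continuous_deriv (by norm_num)
  obtain ⟨C, hC⟩ := (isCompact_Icc (a := -|A|) (b := |A|)).exists_bound_of_continuousOn
    hc.continuousOn
  have hcont : Continuous fun r => ((1 + 4 * k) * C) * |g r| * |r| ^ (2 * k) := by
    have := continuous_abs_rpow hk
    fun_prop
  refine (hcont.intervalIntegrable (-A) A).mono_fun' ?_ ?_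
  · have := measurable_dunklSq k hf.continuous.measurable
    exact Measurable.aestronglyMeasurable (by fun_prop)
  · refine (ae_restrict_iff' measurableSet_uIoc).2 (Eventually.of_forall fun r hr => ?_)
    have hr' : |r| ≤ |A| := by
      have := Set.uIoc_subset_uIcc hr
      rw [Set.mem_uIcc] at this
      rcases this with h | h
      · exact abs_le.2 ⟨by linarith [le_abs_self A], by linarith [le_abs_self A]⟩
      · exact abs_le.2 ⟨by linarith [neg_abs_le A], by linarith [neg_abs_le A]⟩
    have hb := abs_dunklSq_le hk hf (C := C) (r := r) fun x hx => hC x (abs_le.1 (hx.trans hr'))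
    have : 0 ≤ |r| ^ (2 * k) := by positivity
    simp only [Real.norm_eq_abs, abs_mul, abs_of_nonneg this]
    gcongr

/-- The nonlocal part of the integrand is a multiple of `(f(-r) g(r) - f(r) g(-r)) / r ^ 2`, which
is odd and disappears on adding the value at `-r`. What remains is the derivative of `F(r) - F(-r)`,
with `F = (f' g - f g') |r|^(2k)` the weighted Wronskian. -/
lemma integral_dunklSq_mul_sub {k : ℝ} (hk : 0 ≤ k) {f g : ℝ → ℝ} (hf : ContDiff ℝ 2 f)
    (hg : ContDiff ℝ 2 g) {A : ℝ} (hA : 0 ≤ A) (hgA : ∀ r, A ≤ |r| → g r = 0) :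
    ∫ r, (dunklSq k f r * g r - f r * dunklSq k g r) * |r| ^ (2 * k) = 0 := by
  set H : ℝ → ℝ := fun r => (dunklSq k f r * g r - f r * dunklSq k g r) * |r| ^ (2 * k) with hH
  have hg' : ∀ r, A < |r| → g =ᶠ[𝓝 r] fun _ => 0 := by
    intro r hr
    filter_upwards [(continuous_abs.isOpen_preimage _ isOpen_Ioi).mem_nhds hr] with x hx
    exact hgA x (le_of_lt hx)
  have hdg : ∀ r, A < |r| → deriv g r = 0 := by
    intro r hr; rw [(hg' r hr).deriv_eq]; simp
  have hddg : ∀ r, A < |r| → deriv (deriv g) r = 0 := by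
    intro r hr; rw [(hg' r hr).deriv.deriv_eq]; simp
  set B := A + 1
  have hB : ∀ r, r ∉ Set.Ioc (-B) B → H r = 0 := by
    intro r hr
    have : A < |r| := by
      by_contra! h
      rw [abs_le] at h
      exact hr ⟨by linarith [h.1], by linarith [h.2]⟩
    simp [hH, dunklSq, hgA r this.le, hgA (-r) (by rw [abs_neg]; exact this.le), hdg r this,
      hddg r this]
  have hi : IntervalIntegrable H volume (-B) B := by
    have a := intervalIntegrable_dunklSq_mul hk hf hg.continuous B
    have b := intervalIntegrable_dunklSq_mul hk hg hf.continuous B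
    refine (a.sub b).congr ?_
    intro r _
    simp only [hH]; ring
  have e : ∫ r, H r = ∫ r in (-B)..B, H r := by
    rw [intervalIntegral.integral_of_le (by linarith)]
    exact (setIntegral_eq_integral_of_forall_compl_eq_zero hB).symm
  have df : Differentiable ℝ f := hf.differentiable (by norm_num)
  have dg : Differentiable ℝ g := hg.differentiable (by norm_num)
  have df' : Differentiable ℝ (deriv f) :=
    ((contDiff_succ_iff_deriv (n := 1)).1 hf).2.2.differentiable (by norm_num)
  have dg' : Differentiable ℝ (deriv g) :=
    ((contDiff_succ_iff_deriv (n := 1)).1 hg).2.2.differentiable (by norm_num)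
  set F : ℝ → ℝ := fun r => (deriv f r * g r - f r * deriv g r) * |r| ^ (2 * k) with hF
  have hFc : Continuous F := by
    have := continuous_abs_rpow hk
    have := df.continuous
    have := dg.continuous
    have := df'.continuous
    have := dg'.continuous
    fun_prop
  have hFd : ∀ r, r ≠ 0 → HasDerivAt F (((deriv (deriv f) r + 2 * k / r * deriv f r) * g r -
      f r * (deriv (deriv g) r + 2 * k / r * deriv g r)) * |r| ^ (2 * k)) r := by
    intro r hr
    refine ((((df' r).hasDerivAt.mul (dg r).hasDerivAt).sub
      ((df r).hasDerivAt.mul (dg' r).hasDerivAt)).mul (hasDerivAt_abs_rpow_two_mul k hr)).congr_deriv ?_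
    simp only [Pi.sub_apply, Pi.mul_apply]
    ring
  have key := integral_eq_zero_of_add_comp_neg (H := H) (Φ := fun r => F r - F (-r)) (A := B)
    (by linarith) hi (hFc.sub (hFc.comp continuous_neg)) (by
      intro r hr
      have b : HasDerivAt (fun x => F (-x)) _ r :=
        (hFd (-r) (neg_ne_zero.2 hr)).scomp r (hasDerivAt_neg r)
      refine ((hFd r hr).sub b).congr_deriv ?_
      simp only [hH, dunklSq, neg_neg, abs_neg, smul_eq_mul]
      field_simp
      ring)
  rw [e]
  have z1 : F B = 0 := by
    have : A < |B| := by rw [abs_of_nonneg (by linarith)]; linarith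
    simp [hF, hgA B this.le, hdg B this]
  have z2 : F (-B) = 0 := by
    have : A < |(-B)| := by rw [abs_neg, abs_of_nonneg (by linarith)]; linarith
    simp [hF, hgA (-B) this.le, hdg (-B) this]
  simp only [z1, z2, neg_neg] at key
  linarith

/-! ### Gaussian decay and integrals of Dunkl derivatives. -/

/-- `f` is dominated by a Gaussian. -/
def GaussBounded (f : ℝ → ℝ) : Prop := ∃ C b : ℝ, 0 < b ∧ ∀ z, |f z| ≤ C * exp (-b * z ^ 2)

lemma GaussBounded.mul_poly {f g : ℝ → ℝ} (hf : GaussBounded f) {D : ℝ} {N : ℕ}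
    (hg : ∀ z, |g z| ≤ D * (1 + z ^ 2) ^ N) : GaussBounded (fun z => f z * g z) := by
  obtain ⟨C, b, hb, h⟩ := hf
  have hC : 0 ≤ C := by
    have := (abs_nonneg _).trans (h 0)
    simpa using this
  have hD : 0 ≤ D := by
    have := (abs_nonneg _).trans (hg 0)
    simpa using this
  -- Half of the exponent absorbs the polynomial, through `y ^ N / N! ≤ exp y` at `y = b / 2 * (1 +
  -- z ^ 2)`.
  refine ⟨C * (D * (N.factorial * (2 / b) ^ N * exp (b / 2))), b / 2, by positivity, fun z => ?_⟩
  have h1 : (1 + z ^ 2) ^ N ≤ N.factorial * (2 / b) ^ N * exp (b / 2) * exp (b / 2 * z ^ 2) := by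
    have := Real.pow_div_factorial_le_exp (b / 2 * (1 + z ^ 2)) (by positivity) N
    rw [div_le_iff₀ (by positivity), mul_pow] at this
    have e : exp (b / 2 * (1 + z ^ 2)) = exp (b / 2) * exp (b / 2 * z ^ 2) := by
      rw [← exp_add]; ring_nf
    rw [e] at this
    have h3 : (2 / b) ^ N * (b / 2) ^ N = 1 := by
      rw [← mul_pow]; field_simp; simp
    calc (1 + z ^ 2) ^ N = (2 / b) ^ N * ((b / 2) ^ N * (1 + z ^ 2) ^ N) := by
          rw [← mul_assoc, h3, one_mul]
      _ ≤ (2 / b) ^ N * (exp (b / 2) * exp (b / 2 * z ^ 2) * N.factorial) := by gcongr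
      _ = _ := by ring
  have e2 : exp (-b * z ^ 2) * exp (b / 2 * z ^ 2) = exp (-(b / 2) * z ^ 2) := by
    rw [← exp_add]; ring_nf
  rw [abs_mul]
  calc |f z| * |g z| ≤ (C * exp (-b * z ^ 2)) *
        (D * (N.factorial * (2 / b) ^ N * exp (b / 2) * exp (b / 2 * z ^ 2))) := by
        gcongr
        · exact h z
        · exact (hg z).trans (by gcongr)
    _ = C * (D * (N.factorial * (2 / b) ^ N * exp (b / 2))) *
        (exp (-b * z ^ 2) * exp (b / 2 * z ^ 2)) := by ring
    _ = _ := by rw [e2]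

lemma GaussBounded.integrable {f : ℝ → ℝ} (hf : GaussBounded f) (hm : Measurable f) :
    Integrable f := by
  obtain ⟨C, b, hb, h⟩ := hf
  exact ((integrable_exp_neg_mul_sq hb).const_mul C).mono' hm.aestronglyMeasurable
    (Eventually.of_forall h)

lemma GaussBounded.tendsto_zero {f : ℝ → ℝ} (hf : GaussBounded f) :
    Tendsto f (cocompact ℝ) (𝓝 0) := by
  obtain ⟨C, b, hb, h⟩ := hf
  refine squeeze_zero_norm h ?_
  have h1 : Tendsto (fun z : ℝ => b * z ^ 2) (cocompact ℝ) atTop := by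
    have : Tendsto (fun z : ℝ => b * ‖z‖ ^ 2) (cocompact ℝ) atTop :=
      ((tendsto_pow_atTop two_ne_zero).comp (tendsto_norm_cocompact_atTop (E := ℝ))).const_mul_atTop hb
    simpa using this
  have h2 := (tendsto_exp_neg_atTop_nhds_zero.comp h1).const_mul C
  simpa [Function.comp_def] using h2

lemma abs_rpow_le_one_add_sq_pow {k : ℝ} (hk : 0 ≤ k) (z : ℝ) :
    |(|z| ^ (2 * k))| ≤ 1 * (1 + z ^ 2) ^ ⌈k⌉₊ := by
  rw [abs_of_nonneg (by positivity), one_mul, Real.rpow_mul (abs_nonneg z), Real.rpow_two, sq_abs]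
  calc (z ^ 2) ^ k ≤ (1 + z ^ 2) ^ k := by gcongr; linarith
    _ ≤ (1 + z ^ 2) ^ (⌈k⌉₊ : ℝ) :=
        Real.rpow_le_rpow_of_exponent_le (by nlinarith [sq_nonneg z]) (Nat.le_ceil k)
    _ = _ := Real.rpow_natCast _ _

/-- The Dunkl operator is antisymmetric for the weight `|r|^(2k)`, here tested against `1`: the
symmetrized integrand is the derivative of `(f(r) - f(-r)) |r|^(2k)`. Applied to the heat kernel and
its product with `z - x`, it yields the first two moments. -/
lemma integral_dunkl_eq_zero {k : ℝ} (hk : 0 ≤ k) {f H : ℝ → ℝ} (hf : Differentiable ℝ f)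
    (hfb : GaussBounded f) (hH : Integrable H)
    (h : ∀ r, r ≠ 0 → H r = (deriv f r + k / r * (f r - f (-r))) * |r| ^ (2 * k)) :
    ∫ r, H r = 0 := by
  set Φ : ℝ → ℝ := fun r => (f r - f (-r)) * |r| ^ (2 * k) with hΦ
  have hΦc : Continuous Φ := by
    have := continuous_abs_rpow hk
    have := hf.continuous
    fun_prop
  have key : ∀ A : ℝ, 0 ≤ A → 2 * ∫ r in (-A)..A, H r = Φ A - Φ (-A) := by
    intro A hA
    refine integral_eq_zero_of_add_comp_neg hA hH.intervalIntegrable hΦc fun r hr => ?_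
    have b : HasDerivAt (fun x => f (-x)) _ r :=
      (hf (-r)).hasDerivAt.scomp r (hasDerivAt_neg r)
    refine (((hf r).hasDerivAt.sub b).mul (hasDerivAt_abs_rpow_two_mul k hr)).congr_deriv ?_
    rw [h r hr, h (-r) (neg_ne_zero.2 hr)]
    simp only [Pi.sub_apply, neg_neg, abs_neg, smul_eq_mul]
    field_simp
    ring
  have t1 : Tendsto (fun A : ℝ => 2 * ∫ r in (-A)..A, H r) atTop (𝓝 (2 * ∫ r, H r)) :=
    (intervalIntegral_tendsto_integral hH tendsto_neg_atTop_atBot tendsto_id).const_mul 2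
  have hg : GaussBounded (fun r => f r * |r| ^ (2 * k)) :=
    hfb.mul_poly (abs_rpow_le_one_add_sq_pow hk)
  have a1 := hg.tendsto_zero.mono_left atTop_le_cocompact
  have a2 := (hg.tendsto_zero.mono_left atBot_le_cocompact).comp tendsto_neg_atTop_atBot
  have t2 : Tendsto (fun A : ℝ => Φ A - Φ (-A)) atTop (𝓝 0) := by
    have := (a1.sub a2).const_mul 2
    simp only [sub_self, mul_zero] at this
    refine this.congr fun A => ?_
    simp only [hΦ, Function.comp, neg_neg, abs_neg]
    ring
  have := tendsto_nhds_unique (t1.congr' ?_) t2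
  · linarith
  · filter_upwards [eventually_ge_atTop 0] with A hA using key A hA

/-! ### The one-dimensional Dunkl heat kernel: equation, comparison, moments and mass. -/

/-- The one-dimensional Dunkl heat kernel (not normalized), built from the Dunkl kernel `E`. -/
noncomputable def dunklHeat (k : ℝ) (E : ℝ → ℝ) (h x z : ℝ) : ℝ :=
  h ^ (-(k + 1 / 2)) * exp (-(x ^ 2 + z ^ 2) / (4 * h)) * E (x * z / (2 * h))

lemma dunklHeat_symm (k : ℝ) (E : ℝ → ℝ) (h x z : ℝ) :
    dunklHeat k E h x z = dunklHeat k E h z x := by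
  rw [dunklHeat, dunklHeat, add_comm (x ^ 2), mul_comm x]

lemma dunklHeat_neg_neg (k : ℝ) (E : ℝ → ℝ) (h x z : ℝ) :
    dunklHeat k E h (-x) (-z) = dunklHeat k E h x z := by
  rw [dunklHeat, dunklHeat, neg_sq, neg_sq, neg_mul_neg]

namespace IsDunklKernel

variable {k : ℝ} {E : ℝ → ℝ}

lemma differentiable (hE : IsDunklKernel k E) : Differentiable ℝ E :=
  hE.contDiff.differentiable (by norm_num)

lemma heat_pos (hE : IsDunklKernel k E) {h : ℝ} (hh : 0 < h) (x z : ℝ) :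
    0 < dunklHeat k E h x z := by
  have := hE.pos (x * z / (2 * h))
  have := Real.rpow_pos_of_pos hh (-(k + 1 / 2))
  unfold dunklHeat
  positivity

lemma heat_le (hE : IsDunklKernel k E) {h : ℝ} (hh : 0 < h) (x z : ℝ) :
    dunklHeat k E h x z ≤
      h ^ (-(k + 1 / 2)) * exp (-(|z| - |x|) ^ 2 / (4 * h)) := by
  have h1 := hE.le_exp (x * z / (2 * h))
  unfold dunklHeat
  rw [mul_assoc]
  refine mul_le_mul_of_nonneg_left ?_ (Real.rpow_nonneg hh.le _)
  refine (mul_le_mul_of_nonneg_left h1 (exp_pos _).le).trans ?_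
  rw [← exp_add]
  apply le_of_eq
  congr 1
  rw [abs_div, abs_mul, abs_of_pos (by positivity : 0 < 2 * h)]
  field_simp
  linear_combination 2 * sq_abs x + 2 * sq_abs z

lemma heat_le_gauss (hE : IsDunklKernel k E) {h : ℝ} (hh : 0 < h) (x z : ℝ) :
    dunklHeat k E h x z ≤
      h ^ (-(k + 1 / 2)) * exp (x ^ 2 / (4 * h)) * exp (-(1 / (8 * h)) * z ^ 2) := by
  refine (hE.heat_le hh x z).trans ?_
  rw [mul_assoc, ← exp_add]
  refine mul_le_mul_of_nonneg_left (exp_le_exp.2 ?_) (Real.rpow_nonneg hh.le _)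
  have : x ^ 2 / (4 * h) + -(1 / (8 * h)) * z ^ 2 - (-(|z| - |x|) ^ 2 / (4 * h)) =
      (|z| - 2 * |x|) ^ 2 / (8 * h) := by
    field_simp
    linear_combination 4 * sq_abs z - 8 * sq_abs x
  have : 0 ≤ (|z| - 2 * |x|) ^ 2 / (8 * h) := by positivity
  linarith

lemma gaussBounded_heat (hE : IsDunklKernel k E) {h : ℝ} (hh : 0 < h) (x : ℝ) :
    GaussBounded (dunklHeat k E h x) :=
  ⟨h ^ (-(k + 1 / 2)) * exp (x ^ 2 / (4 * h)), 1 / (8 * h), by positivity, fun z => by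
    rw [abs_of_pos (hE.heat_pos hh x z)]; exact hE.heat_le_gauss hh x z⟩

lemma hasDerivAt_heat (hE : IsDunklKernel k E) (h x z : ℝ) :
    HasDerivAt (dunklHeat k E h x) (-(z / (2 * h)) * dunklHeat k E h x z +
      x / (2 * h) * (h ^ (-(k + 1 / 2)) * exp (-(x ^ 2 + z ^ 2) / (4 * h)) *
        deriv E (x * z / (2 * h)))) z := by
  have d1 : HasDerivAt (fun z : ℝ => exp (-(x ^ 2 + z ^ 2) / (4 * h)))
      (exp (-(x ^ 2 + z ^ 2) / (4 * h)) * (-(2 * z) / (4 * h))) z := by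
    have := (((hasDerivAt_pow 2 z).const_add (x ^ 2)).neg.div_const (4 * h)).exp
    simpa using this
  have d2 : HasDerivAt (fun z : ℝ => E (x * z / (2 * h)))
      (deriv E (x * z / (2 * h)) * (x / (2 * h))) z := by
    have := (((hasDerivAt_id z).const_mul x).div_const (2 * h))
    simp only [mul_one] at this
    exact (hE.differentiable _).hasDerivAt.comp z this
  refine ((d1.const_mul (h ^ (-(k + 1 / 2)))).mul d2).congr_deriv ?_
  unfold dunklHeat
  rcases eq_or_ne h 0 with rfl | hh
  · simp
  · field_simp
    ring

lemma differentiable_heat (hE : IsDunklKernel k E) (h x : ℝ) :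
    Differentiable ℝ (dunklHeat k E h x) := fun z => (hE.hasDerivAt_heat h x z).differentiableAt

lemma abs_deriv_heat_le (hE : IsDunklKernel k E) {h : ℝ} (hh : 0 < h) (x z : ℝ) :
    |deriv (dunklHeat k E h x) z| ≤ (|x| + |z|) / (2 * h) * dunklHeat k E h x z := by
  rw [(hE.hasDerivAt_heat h x z).deriv]
  have h1 := hE.abs_deriv_le (x * z / (2 * h))
  have h0 := Real.rpow_pos_of_pos hh (-(k + 1 / 2))
  have hp := hE.heat_pos hh x z
  refine (abs_add_le _ _).trans ?_
  have h2 : |2 * h| = 2 * h := abs_of_pos (by positivity)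
  rw [abs_mul, abs_neg, abs_div, abs_of_pos hp, h2, abs_mul, abs_div, h2, abs_mul,
    abs_of_pos (by positivity : 0 < h ^ (-(k + 1 / 2)) * exp (-(x ^ 2 + z ^ 2) / (4 * h)))]
  have : |x| / (2 * h) * (h ^ (-(k + 1 / 2)) * exp (-(x ^ 2 + z ^ 2) / (4 * h)) *
      |deriv E (x * z / (2 * h))|) ≤ |x| / (2 * h) * dunklHeat k E h x z := by
    unfold dunklHeat
    gcongr
  rw [add_div, add_mul]
  linarith

/-- The Dunkl derivative in `z` multiplies the kernel by `(x - z) / (2h)`, as for a Gaussian; this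
is the differential-difference equation of `E`. It is stated multiplied by `z` so as to include `z =
0`. -/
lemma mul_deriv_heat (hE : IsDunklKernel k E) (h x z : ℝ) :
    z * deriv (dunklHeat k E h x) z + k * (dunklHeat k E h x z - dunklHeat k E h x (-z)) =
      z * ((x - z) / (2 * h)) * dunklHeat k E h x z := by
  rw [(hE.hasDerivAt_heat h x z).deriv]
  have h1 := hE.ode (x * z / (2 * h))
  have e : x * -z / (2 * h) = -(x * z / (2 * h)) := by ring
  unfold dunklHeat
  rw [neg_sq, e]
  generalize exp (-(x ^ 2 + z ^ 2) / (4 * h)) = u at *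
  generalize h ^ (-(k + 1 / 2)) = v at *
  linear_combination (-(u * v)) * h1

lemma deriv_heat (hE : IsDunklKernel k E) {h : ℝ} (hh : 0 < h) (x : ℝ) {z : ℝ} (hz : z ≠ 0) :
    deriv (dunklHeat k E h x) z = (x - z) / (2 * h) * dunklHeat k E h x z -
      k / z * (dunklHeat k E h x z - dunklHeat k E h x (-z)) := by
  have := hE.mul_deriv_heat h x z
  field_simp
  field_simp at this
  linarith

/-- The heat equation off the origin. By `deriv_heat` at `z` and `-z`, the second-order operator
reduces to the kernel and its first derivative at `z`, the values at `-z` cancelling (`f4`). The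
time derivative involves the same two quantities. -/
lemma hasDerivAt_heat_time (hE : IsDunklKernel k E) {h : ℝ} (hh : 0 < h) (x : ℝ) {z : ℝ}
    (hz : z ≠ 0) :
    HasDerivAt (fun h => dunklHeat k E h x z) (dunklSq k (dunklHeat k E h x) z) h := by
  have hd := hE.differentiable_heat h x
  have hz' : -z ≠ 0 := neg_ne_zero.2 hz
  have dn : HasDerivAt (fun y => dunklHeat k E h x (-y)) _ z :=
    (hd (-z)).hasDerivAt.scomp z (hasDerivAt_neg z)
  have d2 : deriv (deriv (dunklHeat k E h x)) z = -1 / (2 * h) * dunklHeat k E h x z +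
      (x - z) / (2 * h) * deriv (dunklHeat k E h x) z -
      (-k / z ^ 2 * (dunklHeat k E h x z - dunklHeat k E h x (-z)) +
      k / z * (deriv (dunklHeat k E h x) z + deriv (dunklHeat k E h x) (-z))) := by
    have ev : deriv (dunklHeat k E h x) =ᶠ[𝓝 z] fun z => (x - z) / (2 * h) * dunklHeat k E h x z -
      k / z * (dunklHeat k E h x z - dunklHeat k E h x (-z)) := by
      filter_upwards [isOpen_ne.mem_nhds hz] with y hy using hE.deriv_heat hh x hy
    rw [ev.deriv_eq]
    apply HasDerivAt.deriv
    have a1 : HasDerivAt (fun z : ℝ => (x - z) / (2 * h)) (-1 / (2 * h)) z :=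
      ((hasDerivAt_id z).const_sub x).div_const _
    have a2 : HasDerivAt (fun z : ℝ => k / z) (-k / z ^ 2) z := by
      have := (hasDerivAt_inv hz).const_mul k
      refine this.congr_deriv ?_
      ring
    refine ((a1.mul (hd z).hasDerivAt).sub (a2.mul ((hd z).hasDerivAt.sub dn))).congr_deriv ?_
    simp
  have b1 : HasDerivAt (fun h : ℝ => h ^ (-(k + 1 / 2)))
      (-(k + 1 / 2) / h * h ^ (-(k + 1 / 2))) h := by
    refine (Real.hasDerivAt_rpow_const (Or.inl hh.ne')).congr_deriv ?_
    rw [Real.rpow_sub_one hh.ne']; ring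
  have b2 : HasDerivAt (fun h : ℝ => exp (-(x ^ 2 + z ^ 2) / (4 * h)))
      (exp (-(x ^ 2 + z ^ 2) / (4 * h)) * ((x ^ 2 + z ^ 2) / (4 * h ^ 2))) h := by
    have : HasDerivAt (fun h : ℝ => -(x ^ 2 + z ^ 2) / (4 * h)) ((x ^ 2 + z ^ 2) / (4 * h ^ 2)) h := by
      have := (((hasDerivAt_id h).const_mul 4).inv (by simpa using hh.ne')).const_mul (-(x ^ 2 + z ^ 2))
      refine this.congr_deriv ?_
      simp only [id]
      field_simp
    exact this.exp
  have b3 : HasDerivAt (fun h : ℝ => E (x * z / (2 * h)))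
      (deriv E (x * z / (2 * h)) * (-(x * z) / (2 * h ^ 2))) h := by
    have : HasDerivAt (fun h : ℝ => x * z / (2 * h)) (-(x * z) / (2 * h ^ 2)) h := by
      have := (((hasDerivAt_id h).const_mul 2).inv (by simpa using hh.ne')).const_mul (x * z)
      refine this.congr_deriv ?_
      simp only [id]
      field_simp
    exact (hE.differentiable _).hasDerivAt.comp h this
  refine ((b1.mul b2).mul b3).congr_deriv ?_
  have f1 := (hE.hasDerivAt_heat h x z).deriv
  have f2 := hE.deriv_heat hh x hz
  have f3 := hE.deriv_heat hh x hz'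
  rw [neg_neg] at f3
  have f4 : dunklSq k (dunklHeat k E h x) z =
      dunklHeat k E h x z * (-(k + 1 / 2) / h + (x ^ 2 - z ^ 2) / (4 * h ^ 2)) -
        z / h * deriv (dunklHeat k E h x) z := by
    rw [dunklSq, d2, f3, f2]
    field_simp
    ring
  rw [f4, f1]
  simp only [Pi.mul_apply]
  unfold dunklHeat
  field_simp
  ring

lemma contDiffOn_heat (hE : IsDunklKernel k E) (x : ℝ) :
    ContDiffOn ℝ 2 (fun p : ℝ × ℝ => dunklHeat k E p.1 x p.2) {p | 0 < p.1} := by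
  have h1 : ContDiffOn ℝ 2 (fun p : ℝ × ℝ => p.1 ^ (-(k + 1 / 2))) {p | 0 < p.1} := fun p hp =>
    (ContDiffAt.rpow_const_of_ne contDiffAt_fst (ne_of_gt hp)).contDiffWithinAt
  have hne : ∀ p ∈ {p : ℝ × ℝ | 0 < p.1}, 4 * p.1 ≠ 0 := fun p hp => by
    have : 0 < p.1 := hp
    positivity
  have hne2 : ∀ p ∈ {p : ℝ × ℝ | 0 < p.1}, 2 * p.1 ≠ 0 := fun p hp => by
    have : 0 < p.1 := hp
    positivity
  have h2 : ContDiffOn ℝ 2 (fun p : ℝ × ℝ => exp (-(x ^ 2 + p.2 ^ 2) / (4 * p.1))) {p | 0 < p.1} :=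
    (ContDiffOn.div (by fun_prop) (by fun_prop) hne).exp
  have h3 : ContDiffOn ℝ 2 (fun p : ℝ × ℝ => E (x * p.2 / (2 * p.1))) {p | 0 < p.1} :=
    hE.contDiff.comp_contDiffOn (ContDiffOn.div (by fun_prop) (by fun_prop) hne2)
  exact (h1.mul h2).mul h3

/-- The power of `t / s` is the ratio of the prefactors `h ^ (-(k + 1 / 2))`; the rest is
`gaussian_le`. -/
lemma heat_harnack (hE : IsDunklKernel k E) {s t : ℝ} (hs : 0 < s) (hst : s < t) (x y z : ℝ) :
    dunklHeat k E s x z ≤ dunklHeat k E t y z * ((t / s) ^ (k + 1 / 2) *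
      exp ((x - y) ^ 2 / (4 * (t - s)))) := by
  have ht := hs.trans hst
  have h := mul_le_mul_of_nonneg_left (hE.gaussian_le s t x y z hs hst)
    (Real.rpow_nonneg hs.le (-(k + 1 / 2)))
  unfold dunklHeat
  rw [mul_assoc]
  refine h.trans (le_of_eq ?_)
  have e : s ^ (-(k + 1 / 2)) = t ^ (-(k + 1 / 2)) * (t / s) ^ (k + 1 / 2) := by
    rw [Real.div_rpow ht.le hs.le, Real.rpow_neg hs.le, Real.rpow_neg ht.le]
    have := Real.rpow_pos_of_pos ht (k + 1 / 2)
    have := Real.rpow_pos_of_pos hs (k + 1 / 2)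
    field_simp
  rw [e]
  ring

lemma measurable_heat (hE : IsDunklKernel k E) (h x : ℝ) : Measurable (dunklHeat k E h x) :=
  (hE.differentiable_heat h x).continuous.measurable

lemma integrable_heat_mul (hE : IsDunklKernel k E) (hk : 0 ≤ k) {h : ℝ} (hh : 0 < h) (x : ℝ)
    {g : ℝ → ℝ} (hg : Measurable g) {D : ℝ} {N : ℕ} (hgb : ∀ z, |g z| ≤ D * (1 + z ^ 2) ^ N) :
    Integrable (fun z => dunklHeat k E h x z * g z * |z| ^ (2 * k)) := by
  refine (((hE.gaussBounded_heat hh x).mul_poly hgb).mul_poly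
    (abs_rpow_le_one_add_sq_pow hk)).integrable ?_
  have := hE.measurable_heat h x
  fun_prop

lemma integrable_heat (hE : IsDunklKernel k E) (hk : 0 ≤ k) {h : ℝ} (hh : 0 < h) (x : ℝ) :
    Integrable (fun z => dunklHeat k E h x z * |z| ^ (2 * k)) := by
  simpa using hE.integrable_heat_mul hk hh x (g := fun _ => 1) measurable_const (D := 1) (N := 0)
    (by simp)

lemma integral_sub_mul_heat (hE : IsDunklKernel k E) (hk : 0 ≤ k) {h : ℝ} (hh : 0 < h) (x : ℝ) :
    ∫ z, dunklHeat k E h x z * (z - x) * |z| ^ (2 * k) = 0 := by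
  have hpoly : ∀ z : ℝ, |z - x| ≤ (1 + |x|) * (1 + z ^ 2) ^ 1 := by
    intro z
    have h1 : |z| ≤ 1 + z ^ 2 := by nlinarith [sq_abs z, sq_nonneg (|z| - 1)]
    have h2 := abs_sub z x
    have h3 : 0 ≤ |x| * z ^ 2 := by positivity
    nlinarith
  have hi := (hE.integrable_heat_mul hk hh x (g := fun z => z - x) (by fun_prop) hpoly)
  have := integral_dunkl_eq_zero hk (hE.differentiable_heat h x) (hE.gaussBounded_heat hh x)
    (hi.const_mul (-(1 / (2 * h)))) (fun r hr => by
      rw [hE.deriv_heat hh x hr]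
      field_simp
      ring)
  rw [integral_const_mul] at this
  have h0 : -(1 / (2 * h)) ≠ 0 := by
    have : 0 < 1 / (2 * h) := by positivity
    linarith
  exact (mul_eq_zero.1 this).resolve_left h0

lemma integral_heat_neg (h x : ℝ) :
    ∫ z, dunklHeat k E h x (-z) * |z| ^ (2 * k) = ∫ z, dunklHeat k E h x z * |z| ^ (2 * k) := by
  have := integral_neg_eq_self (fun z => dunklHeat k E h x z * |z| ^ (2 * k)) volume
  simpa using this

lemma integrable_heat_neg (hE : IsDunklKernel k E) (hk : 0 ≤ k) {h : ℝ} (hh : 0 < h) (x : ℝ) :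
    Integrable (fun z => dunklHeat k E h x (-z) * |z| ^ (2 * k)) := by
  simpa using (hE.integrable_heat hk hh x).comp_neg

lemma integrable_sub_sq_mul_heat (hE : IsDunklKernel k E) (hk : 0 ≤ k) {h : ℝ} (hh : 0 < h)
    (x : ℝ) : Integrable (fun z => dunklHeat k E h x z * (z - x) ^ 2 * |z| ^ (2 * k)) := by
  refine hE.integrable_heat_mul hk hh x (g := fun z => (z - x) ^ 2) (by fun_prop)
    (D := 2 * (1 + x ^ 2)) (N := 1) fun z => ?_
  rw [abs_of_nonneg (sq_nonneg _)]
  nlinarith [sq_nonneg (z + x), mul_nonneg (sq_nonneg x) (sq_nonneg z)]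

/-- With `p` the kernel, the Dunkl derivative of `p(z) (z - x)` is `p(z) + 2k p(-z) - (z - x)² p(z)
/ (2h)`. Its weighted integral vanishes, and `p(-z)` has the same mass as `p(z)`. -/
lemma integral_sub_sq_mul_heat (hE : IsDunklKernel k E) (hk : 0 ≤ k) {h : ℝ} (hh : 0 < h)
    (x : ℝ) : ∫ z, dunklHeat k E h x z * (z - x) ^ 2 * |z| ^ (2 * k) =
      2 * h * (1 + 2 * k) * ∫ z, dunklHeat k E h x z * |z| ^ (2 * k) := by
  have hpoly : ∀ z : ℝ, |z - x| ≤ (1 + |x|) * (1 + z ^ 2) ^ 1 := by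
    intro z
    have h1 : |z| ≤ 1 + z ^ 2 := by nlinarith [sq_abs z, sq_nonneg (|z| - 1)]
    have h2 := abs_sub z x
    have h3 : 0 ≤ |x| * z ^ 2 := by positivity
    nlinarith
  have i1 := hE.integrable_heat hk hh x
  have i2 := hE.integrable_heat_neg hk hh x
  have i3 := hE.integrable_sub_sq_mul_heat hk hh x
  have hd : ∀ z, HasDerivAt (fun z => dunklHeat k E h x z * (z - x))
      (deriv (dunklHeat k E h x) z * (z - x) + dunklHeat k E h x z) z := fun z =>
    ((hE.differentiable_heat h x z).hasDerivAt.mul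
      ((hasDerivAt_id z).sub_const x)).congr_deriv (by simp)
  have := integral_dunkl_eq_zero hk (fun z => (hd z).differentiableAt)
    ((hE.gaussBounded_heat hh x).mul_poly hpoly)
    ((i1.add (i2.const_mul (2 * k))).sub (i3.const_mul (1 / (2 * h)))) (fun r hr => by
      rw [(hd r).deriv, hE.deriv_heat hh x hr]
      simp only [Pi.add_apply, Pi.sub_apply]
      field_simp
      ring)
  rw [integral_sub' (i1.add (i2.const_mul (2 * k))) (i3.const_mul _),
    integral_add' i1 (i2.const_mul (2 * k)), integral_const_mul, integral_const_mul,
    integral_heat_neg] at this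
  field_simp at this
  linarith

end IsDunklKernel

/-- The total mass of the (not normalized) one-dimensional Dunkl heat kernel. -/
noncomputable def dunklMass (k : ℝ) : ℝ := ∫ z : ℝ, exp (-z ^ 2 / 4) * |z| ^ (2 * k)

lemma integrable_dunklMass {k : ℝ} (hk : 0 ≤ k) :
    Integrable fun z : ℝ => exp (-z ^ 2 / 4) * |z| ^ (2 * k) := by
  have : GaussBounded fun z : ℝ => exp (-z ^ 2 / 4) := ⟨1, 1 / 4, by norm_num, fun z => by
    rw [abs_of_pos (exp_pos _), one_mul]; apply le_of_eq; ring_nf⟩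
  exact (this.mul_poly (abs_rpow_le_one_add_sq_pow hk)).integrable (by fun_prop)

lemma dunklMass_pos {k : ℝ} (hk : 0 ≤ k) : 0 < dunklMass k := by
  have hc : Continuous fun z : ℝ => exp (-z ^ 2 / 4) * |z| ^ (2 * k) := by
    have := continuous_abs_rpow hk
    fun_prop
  exact integral_pos_of_integrable_nonneg_nonzero (x := 1) hc (integrable_dunklMass hk)
    (fun z => by simp only [Pi.zero_apply]; positivity) (by simp [(exp_pos _).ne'])

namespace IsDunklKernel

variable {k : ℝ} {E : ℝ → ℝ}

/-- The derivative is in the centre `x`, which the symmetry of the kernel turns into `deriv_heat`;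
the first moment and the reflection `z ↦ -z` then give zero. As `deriv_heat` divides by the
variable, `x = 0` is treated apart: there the integrand is odd in `z`. -/
lemma integral_deriv_heat_left (hE : IsDunklKernel k E) (hk : 0 ≤ k) {h : ℝ} (hh : 0 < h)
    (x : ℝ) : ∫ z, deriv (dunklHeat k E h z) x * |z| ^ (2 * k) = 0 := by
  rcases eq_or_ne x 0 with rfl | hx
  · set g : ℝ → ℝ := fun z => deriv (dunklHeat k E h z) 0 * |z| ^ (2 * k) with hg
    have hodd : ∀ z, g (-z) = -g z := by
      intro z
      simp only [hg]
      rw [(hE.hasDerivAt_heat h z 0).deriv, (hE.hasDerivAt_heat h (-z) 0).deriv]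
      simp
      ring
    have h1 := integral_neg_eq_self g volume
    simp only [hodd, integral_neg] at h1
    linarith
  · have i1 := hE.integrable_heat hk hh x
    have i2 := hE.integrable_heat_neg hk hh x
    have i3 : Integrable (fun z => dunklHeat k E h x z * (z - x) * |z| ^ (2 * k)) := by
      refine (hE.integrable_heat_mul hk hh x (g := fun z => z - x) (by fun_prop)
        (D := 1 + |x|) (N := 1) fun z => ?_)
      have h1 : |z| ≤ 1 + z ^ 2 := by nlinarith [sq_abs z, sq_nonneg (|z| - 1)]
      have h2 := abs_sub z x
      have h3 : 0 ≤ |x| * z ^ 2 := by positivity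
      nlinarith
    have e : ∀ z, deriv (dunklHeat k E h z) x * |z| ^ (2 * k) =
        1 / (2 * h) * (dunklHeat k E h x z * (z - x) * |z| ^ (2 * k)) -
        k / x * (dunklHeat k E h x z * |z| ^ (2 * k) -
          dunklHeat k E h x (-z) * |z| ^ (2 * k)) := by
      intro z
      rw [hE.deriv_heat hh z hx, dunklHeat_symm k E h z x, dunklHeat_symm k E h z (-x),
        ← dunklHeat_neg_neg k E h (-x) z, neg_neg]
      ring
    simp only [e]
    have i12 : Integrable fun z => dunklHeat k E h x z * |z| ^ (2 * k) -
        dunklHeat k E h x (-z) * |z| ^ (2 * k) := i1.sub i2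
    rw [integral_sub (i3.const_mul _) (i12.const_mul _), integral_const_mul,
      integral_const_mul, integral_sub i1 i2, hE.integral_sub_mul_heat hk hh, integral_heat_neg]
    simp

lemma hasDerivAt_integral_heat (hE : IsDunklKernel k E) (hk : 0 ≤ k) {h : ℝ} (hh : 0 < h)
    (x : ℝ) : HasDerivAt (fun x => ∫ z, dunklHeat k E h x z * |z| ^ (2 * k)) 0 x := by
  set B := |x| + 1 with hB
  have hB0 : 0 < B := by positivity
  set G : ℝ → ℝ := fun z => exp (-(1 / (8 * h)) * z ^ 2) * (B + |z|) * |z| ^ (2 * k) with hG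
  have hGi : Integrable G := by
    have g0 : GaussBounded fun z : ℝ => exp (-(1 / (8 * h)) * z ^ 2) :=
      ⟨1, 1 / (8 * h), by positivity, fun z => by rw [abs_of_pos (exp_pos _), one_mul]⟩
    refine ((g0.mul_poly (g := fun z => B + |z|) (D := B + 1) (N := 1) fun z => ?_).mul_poly
      (abs_rpow_le_one_add_sq_pow hk)).integrable (by fun_prop)
    have h1 : |z| ≤ 1 + z ^ 2 := by nlinarith [sq_abs z, sq_nonneg (|z| - 1)]
    rw [abs_of_nonneg (by positivity)]
    nlinarith [mul_nonneg hB0.le (sq_nonneg z)]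
  have key := hasDerivAt_integral_of_dominated_loc_of_deriv_le (μ := volume)
    (F := fun x z => dunklHeat k E h x z * |z| ^ (2 * k))
    (F' := fun x z => deriv (dunklHeat k E h z) x * |z| ^ (2 * k)) (x₀ := x)
    (bound := fun z => 1 / (2 * h) * (h ^ (-(k + 1 / 2)) * exp (B ^ 2 / (4 * h))) * G z)
    (s := Metric.ball x 1) (Metric.ball_mem_nhds x one_pos)
    (Eventually.of_forall fun x => (hE.integrable_heat hk hh x).aestronglyMeasurable)
    (hE.integrable_heat hk hh x) ?_ ?_ (hGi.const_mul _) ?_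
  · have := key.2
    rwa [hE.integral_deriv_heat_left hk hh x] at this
  · have : (fun z => deriv (dunklHeat k E h z) x) = fun z => (-(x / (2 * h)) * dunklHeat k E h z x +
      z / (2 * h) * (h ^ (-(k + 1 / 2)) * exp (-(z ^ 2 + x ^ 2) / (4 * h)) *
        deriv E (z * x / (2 * h)))) := by
      ext z; exact (hE.hasDerivAt_heat h z x).deriv
    simp only [congrFun this]
    have := hE.measurable_heat h x
    have := measurable_deriv E
    simp only [fun z => dunklHeat_symm k E h z x]
    exact Measurable.aestronglyMeasurable (by fun_prop)
  · refine Eventually.of_forall fun z y hy => ?_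
    have hy' : |y| ≤ B := by
      rw [Metric.mem_ball, Real.dist_eq] at hy
      have := abs_sub_abs_le_abs_sub y x
      linarith
    have h1 := hE.abs_deriv_heat_le hh z y
    have h2 := hE.heat_le_gauss hh y z
    have h3 := hE.heat_pos hh z y
    rw [dunklHeat_symm] at h2
    have h4 : exp (y ^ 2 / (4 * h)) ≤ exp (B ^ 2 / (4 * h)) := by
      refine exp_le_exp.2 ?_
      have := sq_le_sq.2 (hy'.trans (le_abs_self B))
      gcongr
    have h5 : 0 ≤ h ^ (-(k + 1 / 2)) := Real.rpow_nonneg hh.le _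
    rw [norm_mul, Real.norm_eq_abs, Real.norm_of_nonneg (by positivity : 0 ≤ |z| ^ (2 * k))]
    calc |deriv (dunklHeat k E h z) y| * |z| ^ (2 * k)
        ≤ ((|z| + |y|) / (2 * h) * (h ^ (-(k + 1 / 2)) * exp (y ^ 2 / (4 * h)) *
            exp (-(1 / (8 * h)) * z ^ 2))) * |z| ^ (2 * k) := by
          gcongr
          exact h1.trans (by gcongr)
      _ ≤ ((|z| + B) / (2 * h) * (h ^ (-(k + 1 / 2)) * exp (B ^ 2 / (4 * h)) *
            exp (-(1 / (8 * h)) * z ^ 2))) * |z| ^ (2 * k) := by gcongr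
      _ = _ := by simp only [hG]; ring
  · refine Eventually.of_forall fun z y _ => ?_
    have := (hE.differentiable_heat h z y).hasDerivAt.mul_const (|z| ^ (2 * k))
    refine this.congr_of_eventuallyEq (Eventually.of_forall fun y => ?_)
    simp only [dunklHeat_symm k E h y z]

/-- The mass does not depend on `x`, and at `x = 0` the kernel is a pure Gaussian, for which the
scaling `z = √h y` removes `h`. -/
lemma integral_heat (hE : IsDunklKernel k E) (hk : 0 ≤ k) {h : ℝ} (hh : 0 < h) (x : ℝ) :
    ∫ z, dunklHeat k E h x z * |z| ^ (2 * k) = dunklMass k := by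
  have hd := hE.hasDerivAt_integral_heat hk hh
  have h1 := is_const_of_deriv_eq_zero (fun x => (hd x).differentiableAt) (fun x => (hd x).deriv) x 0
  rw [h1]
  have hs : 0 < √h := Real.sqrt_pos.2 hh
  have h2 := Measure.integral_comp_mul_left (fun z => dunklHeat k E h 0 z * |z| ^ (2 * k)) (√h)
  have h3 : ∀ y, dunklHeat k E h 0 (√h * y) * |√h * y| ^ (2 * k) =
      (√h)⁻¹ * (exp (-y ^ 2 / 4) * |y| ^ (2 * k)) := by
    intro y
    have e1 : |√h * y| ^ (2 * k) = h ^ k * |y| ^ (2 * k) := by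
      rw [abs_mul, abs_of_pos hs, Real.mul_rpow hs.le (abs_nonneg _), Real.rpow_mul hs.le,
        Real.rpow_two, Real.sq_sqrt hh.le]
    have e2 : h ^ (-(k + 1 / 2)) * h ^ k = (√h)⁻¹ := by
      rw [← Real.rpow_add hh, Real.sqrt_eq_rpow, ← Real.rpow_neg hh.le]
      ring_nf
    have e3 : -(0 ^ 2 + (√h * y) ^ 2) / (4 * h) = -y ^ 2 / 4 := by
      rw [mul_pow, Real.sq_sqrt hh.le]; field_simp; ring
    rw [dunklHeat, e1, e3, zero_mul, zero_div, hE.zero, ← e2]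
    ring
  simp only [h3, integral_const_mul] at h2
  rw [abs_of_pos (inv_pos.2 hs), smul_eq_mul] at h2
  exact (mul_left_cancel₀ (inv_pos.2 hs).ne' h2).symm

end IsDunklKernel

/-! ### Several variables: symmetry of the operators and the weak form of the equation. -/

section Coordinates

variable {d : ℕ}

lemma integral_eq_zero_of_integral_update_eq_zero {H : (Fin d → ℝ) → ℝ} (hH : Integrable H)
    (j : Fin d) (h : ∀ z, ∫ r, H (Function.update z j r) = 0) : ∫ z, H z = 0 := by
  obtain _ | n := d
  · exact j.elim0
  have hm := (volume_preserving_piFinSuccAbove (fun _ : Fin (n + 1) => ℝ) j).symm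
  rw [← hm.integral_comp']
  have hi : Integrable (fun p => H ((MeasurableEquiv.piFinSuccAbove (fun _ => ℝ) j).symm p))
      (volume : Measure (ℝ × (Fin n → ℝ))) := hm.integrable_comp_of_integrable hH
  rw [Measure.volume_eq_prod] at hi ⊢
  rw [integral_prod_symm _ hi]
  refine integral_eq_zero_of_ae (Eventually.of_forall fun y => ?_)
  -- The entry `0` is irrelevant: the update overwrites it.
  have := h (j.insertNth 0 y)
  simpa [MeasurableEquiv.piFinSuccAbove, Fin.insertNthEquiv] using this

/-- The square of the Dunkl operator in the `j`-th coordinate direction for the reflection group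
generated by the sign changes of the coordinates. -/
noncomputable def axisDunklSq (k : Fin d → ℝ) (j : Fin d) (f : (Fin d → ℝ) → ℝ)
    (z : Fin d → ℝ) : ℝ :=
  dunklSq (k j) (fun r => f (Function.update z j r)) (z j)

/-- The Dunkl weight `∏ⱼ |zⱼ|^{2 kⱼ}`. -/
noncomputable def dunklWeight (k : Fin d → ℝ) (z : Fin d → ℝ) : ℝ := ∏ j, |z j| ^ (2 * k j)

/-- The Dunkl Laplacian in coordinates in which the reflections are sign changes. -/
noncomputable def coordDunklLap (k : Fin d → ℝ) (f : (Fin d → ℝ) → ℝ) (z : Fin d → ℝ) : ℝ :=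
  ∑ j, axisDunklSq k j f z

lemma dunklWeight_nonneg (k : Fin d → ℝ) (z : Fin d → ℝ) : 0 ≤ dunklWeight k z :=
  Finset.prod_nonneg fun _ _ => by positivity

lemma continuous_dunklWeight {k : Fin d → ℝ} (hk : ∀ j, 0 ≤ k j) : Continuous (dunklWeight k) :=
  continuous_finsetProd _ fun j _ => (continuous_abs_rpow (hk j)).comp (continuous_apply j)

lemma dunklWeight_update (k : Fin d → ℝ) (z : Fin d → ℝ) (j : Fin d) (r : ℝ) :
    dunklWeight k (Function.update z j r) =
      |r| ^ (2 * k j) * ∏ i ∈ Finset.univ.erase j, |z i| ^ (2 * k i) := by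
  rw [dunklWeight, ← Finset.mul_prod_erase _ _ (Finset.mem_univ j), Function.update_self]
  congr 1
  refine Finset.prod_congr rfl fun i hi => ?_
  rw [Function.update_of_ne (Finset.ne_of_mem_erase hi)]

lemma axisDunklSq_update (k : Fin d → ℝ) (j : Fin d) (f : (Fin d → ℝ) → ℝ) (z : Fin d → ℝ)
    (r : ℝ) : axisDunklSq k j f (Function.update z j r) =
      dunklSq (k j) (fun r => f (Function.update z j r)) r := by
  simp only [axisDunklSq, Function.update_idem, Function.update_self]

lemma contDiff_comp_update {f : (Fin d → ℝ) → ℝ} (hf : ContDiff ℝ 2 f) (z : Fin d → ℝ)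
    (j : Fin d) : ContDiff ℝ 2 fun r => f (Function.update z j r) :=
  hf.comp (contDiff_update 2 z j)

lemma deriv_comp_update {f : (Fin d → ℝ) → ℝ} (hf : Differentiable ℝ f) (z : Fin d → ℝ)
    (j : Fin d) : deriv (fun r => f (Function.update z j r)) =
      fun r => fderiv ℝ f (Function.update z j r) (Pi.single j 1) := by
  ext r
  exact ((hf _).hasFDerivAt.comp_hasDerivAt r (hasDerivAt_update z j r)).deriv

lemma contDiff_fderiv_single {f : (Fin d → ℝ) → ℝ} (hf : ContDiff ℝ 2 f) (j : Fin d) :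
    ContDiff ℝ 1 fun z => fderiv ℝ f z (Pi.single j 1) :=
  (hf.fderiv_right (m := 1) (by norm_num)).clm_apply contDiff_const

lemma deriv_deriv_comp_update {f : (Fin d → ℝ) → ℝ} (hf : ContDiff ℝ 2 f) (z : Fin d → ℝ)
    (j : Fin d) : deriv (deriv (fun r => f (Function.update z j r))) = fun r =>
      fderiv ℝ (fun z => fderiv ℝ f z (Pi.single j 1)) (Function.update z j r)
        (Pi.single j 1) := by
  rw [deriv_comp_update (hf.differentiable (by norm_num)) z j]
  exact deriv_comp_update ((contDiff_fderiv_single hf j).differentiable (by norm_num)) z j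

lemma continuous_fderiv_fderiv_single {f : (Fin d → ℝ) → ℝ} (hf : ContDiff ℝ 2 f) (j : Fin d) :
    Continuous fun z => fderiv ℝ (fun z => fderiv ℝ f z (Pi.single j 1)) z (Pi.single j 1) :=
  ((contDiff_fderiv_single hf j).continuous_fderiv (by norm_num)).clm_apply continuous_const

lemma measurable_axisDunklSq (k : Fin d → ℝ) (j : Fin d) {f : (Fin d → ℝ) → ℝ}
    (hf : ContDiff ℝ 2 f) : Measurable (axisDunklSq k j f) := by
  have e : axisDunklSq k j f = fun z =>
      fderiv ℝ (fun z => fderiv ℝ f z (Pi.single j 1)) z (Pi.single j 1) +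
      2 * k j / z j * fderiv ℝ f z (Pi.single j 1) -
      k j * (f z - f (Function.update z j (-z j))) / z j ^ 2 := by
    ext z
    rw [axisDunklSq, dunklSq, deriv_deriv_comp_update hf,
      deriv_comp_update (hf.differentiable (by norm_num))]
    simp only [Function.update_eq_self]
  have h1 := (continuous_fderiv_fderiv_single hf j).measurable
  have h2 := (contDiff_fderiv_single hf j).continuous.measurable
  have h3 : Measurable fun z : Fin d → ℝ => f (Function.update z j (-z j)) :=
    (hf.continuous.comp (continuous_id.update j (continuous_apply j).neg)).measurable
  have h4 := hf.continuous.measurable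
  rw [e]
  fun_prop

lemma norm_update_le {z : Fin d → ℝ} {j : Fin d} {r A : ℝ} (hz : ‖z‖ ≤ A) (hr : |r| ≤ A) :
    ‖Function.update z j r‖ ≤ A := by
  have hA : 0 ≤ A := (abs_nonneg r).trans hr
  refine (pi_norm_le_iff_of_nonneg hA).2 fun i => ?_
  rcases eq_or_ne i j with rfl | h
  · simpa using hr
  · rw [Function.update_of_ne h]; exact (norm_le_pi_norm z i).trans hz

lemma abs_le_norm_update (z : Fin d → ℝ) (j : Fin d) (r : ℝ) : |r| ≤ ‖Function.update z j r‖ := by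
  have := norm_le_pi_norm (Function.update z j r) j
  simpa using this

lemma exists_abs_axisDunklSq_le {k : Fin d → ℝ} (hk : ∀ j, 0 ≤ k j) (j : Fin d)
    {f : (Fin d → ℝ) → ℝ} (hf : ContDiff ℝ 2 f) (A : ℝ) :
    ∃ C, ∀ z, ‖z‖ ≤ A → |axisDunklSq k j f z| ≤ C := by
  obtain ⟨C, hC⟩ := (isCompact_closedBall (0 : Fin d → ℝ) A).exists_bound_of_continuousOn
    (continuous_fderiv_fderiv_single hf j).continuousOn
  refine ⟨(1 + 4 * k j) * C, fun z hz => ?_⟩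
  refine abs_dunklSq_le (hk j) (contDiff_comp_update hf z j) fun x hx => ?_
  rw [deriv_deriv_comp_update hf]
  refine hC _ (mem_closedBall_zero_iff.2 (norm_update_le hz (hx.trans ?_)))
  exact (norm_le_pi_norm z j).trans hz

/-- The operator is nonlocal only through a sign change of a coordinate, which preserves the sup
norm, so vanishing outside a ball is inherited. -/
lemma axisDunklSq_eq_zero {k : Fin d → ℝ} (j : Fin d) {f : (Fin d → ℝ) → ℝ} {A : ℝ}
    (hf : ∀ z, A ≤ ‖z‖ → f z = 0) {z : Fin d → ℝ} (hz : A < ‖z‖) : axisDunklSq k j f z = 0 := by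
  have hc : Continuous fun r => ‖Function.update z j r‖ :=
    (contDiff_update (𝕜 := ℝ) 1 z j).continuous.norm
  have ev : (fun r => f (Function.update z j r)) =ᶠ[𝓝 (z j)] fun _ => 0 := by
    have : A < ‖Function.update z j (z j)‖ := by rwa [Function.update_eq_self]
    filter_upwards [(hc.isOpen_preimage _ isOpen_Ioi).mem_nhds this] with r hr
    exact hf _ (le_of_lt hr)
  have hneg : ‖Function.update z j (-z j)‖ = ‖z‖ := by
    apply le_antisymm
    · exact norm_update_le le_rfl (by rw [abs_neg]; exact norm_le_pi_norm z j)
    · have := norm_update_le (z := Function.update z j (-z j)) (j := j) (r := z j) le_rfl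
        (by have := abs_le_norm_update z j (-z j); rwa [abs_neg] at this)
      simpa using this
  rw [axisDunklSq, dunklSq, ev.deriv.deriv_eq, ev.deriv_eq, ev.eq_of_nhds,
    hf (Function.update z j (-z j)) (hz.le.trans_eq hneg.symm)]
  simp

lemma integrable_of_bounded_of_support {k : Fin d → ℝ} (hk : ∀ j, 0 ≤ k j)
    {H : (Fin d → ℝ) → ℝ} (hH : AEStronglyMeasurable H volume) {A C : ℝ}
    (hC : ∀ z, ‖z‖ ≤ A → |H z| ≤ C) (h0 : ∀ z, A < ‖z‖ → H z = 0) :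
    Integrable fun z => H z * dunklWeight k z := by
  have hw := continuous_dunklWeight hk
  have hi : Integrable ((Metric.closedBall (0 : Fin d → ℝ) A).indicator
      fun z => C * dunklWeight k z) :=
    ((by fun_prop : Continuous fun z => C * dunklWeight k z).continuousOn.integrableOn_compact
      (isCompact_closedBall _ _)).integrable_indicator measurableSet_closedBall
  refine hi.mono' (hH.mul hw.aestronglyMeasurable) (Eventually.of_forall fun z => ?_)
  have := dunklWeight_nonneg k z
  by_cases hz : ‖z‖ ≤ A
  · rw [Set.indicator_of_mem (mem_closedBall_zero_iff.2 hz), norm_mul, Real.norm_eq_abs,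
      Real.norm_of_nonneg this]
    gcongr
    exact hC z hz
  · rw [Set.indicator_of_notMem (fun h => hz (mem_closedBall_zero_iff.1 h)),
      h0 z (not_le.1 hz)]
    simp

lemma integrable_axisDunklSq_mul {k : Fin d → ℝ} (hk : ∀ j, 0 ≤ k j) (j : Fin d)
    {f g : (Fin d → ℝ) → ℝ} (hf : ContDiff ℝ 2 f) (hg : Continuous g) {A : ℝ}
    (h0 : ∀ z, A < ‖z‖ → axisDunklSq k j f z * g z = 0) :
    Integrable fun z => axisDunklSq k j f z * g z * dunklWeight k z := by
  obtain ⟨C, hC⟩ := exists_abs_axisDunklSq_le hk j hf A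
  obtain ⟨D, hD⟩ := (isCompact_closedBall (0 : Fin d → ℝ) A).exists_bound_of_continuousOn
    hg.continuousOn
  refine integrable_of_bounded_of_support hk
    ((measurable_axisDunklSq k j hf).mul hg.measurable).aestronglyMeasurable (A := A) (C := C * D)
    (fun z hz => ?_) h0
  rw [abs_mul]
  have h1 := hC z hz
  have h2 := hD z (mem_closedBall_zero_iff.2 hz)
  exact mul_le_mul h1 h2 (abs_nonneg _) ((abs_nonneg _).trans h1)

lemma integral_axisDunklSq_symm {k : Fin d → ℝ} (hk : ∀ j, 0 ≤ k j) (j : Fin d)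
    {f g : (Fin d → ℝ) → ℝ} (hf : ContDiff ℝ 2 f) (hg : ContDiff ℝ 2 g) {A : ℝ}
    (hA : 0 ≤ A) (h0 : ∀ z, A ≤ ‖z‖ → g z = 0) :
    Integrable (fun z => (axisDunklSq k j f z * g z - f z * axisDunklSq k j g z) *
      dunklWeight k z) ∧
    ∫ z, (axisDunklSq k j f z * g z - f z * axisDunklSq k j g z) * dunklWeight k z = 0 := by
  have i1 := integrable_axisDunklSq_mul hk j hf hg.continuous (A := A)
    (fun z hz => by rw [h0 z hz.le, mul_zero])
  have i2 := integrable_axisDunklSq_mul hk j hg hf.continuous (A := A)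
    (fun z hz => by rw [axisDunklSq_eq_zero j h0 hz, zero_mul])
  have hi : Integrable (fun z => (axisDunklSq k j f z * g z - f z * axisDunklSq k j g z) *
      dunklWeight k z) := by
    refine (i1.sub i2).congr (Eventually.of_forall fun z => ?_)
    simp only [Pi.sub_apply]
    ring
  refine ⟨hi, integral_eq_zero_of_integral_update_eq_zero hi j fun z => ?_⟩
  have := integral_dunklSq_mul_sub (hk j) (contDiff_comp_update hf z j)
    (contDiff_comp_update hg z j) hA (fun r hr => h0 _ (hr.trans (abs_le_norm_update z j r)))
  simp only [axisDunklSq_update, dunklWeight_update, ← mul_assoc]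
  rw [integral_mul_const, this, zero_mul]

/-- Allows the equation, and the formulas dividing by coordinates, to be used only off the
reflecting hyperplanes. -/
lemma ae_forall_ne_zero : ∀ᵐ z : Fin d → ℝ, ∀ j, z j ≠ 0 := by
  rw [ae_all_iff]
  intro j
  have := Measure.pi_hyperplane (fun _ : Fin d => (volume : Measure ℝ)) j 0
  rw [← volume_pi] at this
  exact compl_mem_ae_iff.2 this

section WeakForm

variable {k : Fin d → ℝ} {a b : ℝ} {v φ : ℝ → (Fin d → ℝ) → ℝ}

lemma contDiff_section (hv : ContDiffOn ℝ 2 (fun p : ℝ × (Fin d → ℝ) => v p.1 p.2)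
    (Set.Ioo a b ×ˢ Set.univ)) {τ : ℝ} (hτ : τ ∈ Set.Ioo a b) : ContDiff ℝ 2 (v τ) := by
  rw [← contDiffOn_univ]
  exact hv.comp (f := fun z => (τ, z)) (by fun_prop) (fun z _ => ⟨hτ, Set.mem_univ _⟩)

lemma hasDerivAt_section (hv : ContDiffOn ℝ 2 (fun p : ℝ × (Fin d → ℝ) => v p.1 p.2)
    (Set.Ioo a b ×ˢ Set.univ)) {τ : ℝ} (hτ : τ ∈ Set.Ioo a b) (z : Fin d → ℝ) :
    HasDerivAt (fun τ => v τ z)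
      (fderiv ℝ (fun p : ℝ × (Fin d → ℝ) => v p.1 p.2) (τ, z) (1, 0)) τ := by
  have hmem : Set.Ioo a b ×ˢ Set.univ ∈ 𝓝 (τ, z) :=
    (isOpen_Ioo.prod isOpen_univ).mem_nhds ⟨hτ, Set.mem_univ _⟩
  have h1 := ((hv.contDiffAt hmem).differentiableAt (by norm_num)).hasFDerivAt
  exact h1.comp_hasDerivAt (f := fun τ : ℝ => (τ, z)) τ
    ((hasDerivAt_id τ).prodMk (hasDerivAt_const τ z))

lemma continuousOn_deriv_section (hv : ContDiffOn ℝ 2 (fun p : ℝ × (Fin d → ℝ) => v p.1 p.2)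
    (Set.Ioo a b ×ˢ Set.univ)) :
    ContinuousOn (fun p : ℝ × (Fin d → ℝ) => deriv (fun τ => v τ p.2) p.1)
      (Set.Ioo a b ×ˢ Set.univ) := by
  have h1 := hv.continuousOn_fderiv_of_isOpen (isOpen_Ioo.prod isOpen_univ) (by norm_num)
  refine (h1.clm_apply (continuousOn_const (c := ((1 : ℝ), (0 : Fin d → ℝ))))).congr fun p hp => ?_
  exact (hasDerivAt_section hv hp.1 p.2).deriv

/-- The weak form of the Dunkl heat equation: pairing a solution with a compactly supported test
function. -/
theorem hasDerivAt_integral_mul_test (hk : ∀ j, 0 ≤ k j)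
    (hv : ContDiffOn ℝ 2 (fun p : ℝ × (Fin d → ℝ) => v p.1 p.2) (Set.Ioo a b ×ˢ Set.univ))
    (heat : ∀ τ ∈ Set.Ioo a b, ∀ z : Fin d → ℝ, (∀ j, z j ≠ 0) →
      deriv (fun τ => v τ z) τ = coordDunklLap k (v τ) z)
    (hφ : ContDiffOn ℝ 2 (fun p : ℝ × (Fin d → ℝ) => φ p.1 p.2) (Set.Ioo a b ×ˢ Set.univ))
    {A : ℝ} (hA : 0 ≤ A) (hφ0 : ∀ τ ∈ Set.Ioo a b, ∀ z, A ≤ ‖z‖ → φ τ z = 0)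
    {τ : ℝ} (hτ : τ ∈ Set.Ioo a b) :
    HasDerivAt (fun τ => ∫ z, v τ z * φ τ z * dunklWeight k z)
      (∫ z, v τ z * (deriv (fun τ => φ τ z) τ + coordDunklLap k (φ τ) z) * dunklWeight k z) τ := by
  obtain ⟨ρ, hρ, hsub⟩ := Metric.nhds_basis_closedBall.mem_iff.1 (isOpen_Ioo.mem_nhds hτ)
  have hK : Metric.closedBall τ ρ ×ˢ Metric.closedBall (0 : Fin d → ℝ) A ⊆
      Set.Ioo a b ×ˢ Set.univ := Set.prod_mono hsub (Set.subset_univ _)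
  have hKc : IsCompact (Metric.closedBall τ ρ ×ˢ Metric.closedBall (0 : Fin d → ℝ) A) :=
    (isCompact_closedBall _ _).prod (isCompact_closedBall _ _)
  have hF'c : ContinuousOn (fun p : ℝ × (Fin d → ℝ) =>
      deriv (fun τ => v τ p.2) p.1 * φ p.1 p.2 + v p.1 p.2 * deriv (fun τ => φ τ p.2) p.1)
      (Set.Ioo a b ×ˢ Set.univ) :=
    ((continuousOn_deriv_section hv).mul hφ.continuousOn).add
      (hv.continuousOn.mul (continuousOn_deriv_section hφ))
  obtain ⟨C, hC⟩ := hKc.exists_bound_of_continuousOn (hF'c.mono hK)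
  have hdφ0 : ∀ τ ∈ Set.Ioo a b, ∀ z, A ≤ ‖z‖ → deriv (fun τ => φ τ z) τ = 0 := by
    intro τ hτ z hz
    have : (fun τ => φ τ z) =ᶠ[𝓝 τ] fun _ => 0 := by
      filter_upwards [isOpen_Ioo.mem_nhds hτ] with τ' hτ' using hφ0 τ' hτ' z hz
    rw [this.deriv_eq]; simp
  have hw := continuous_dunklWeight hk
  have hcont : ∀ τ ∈ Set.Ioo a b, Continuous fun z => v τ z * φ τ z := fun τ hτ =>
    (contDiff_section hv hτ).continuous.mul (contDiff_section hφ hτ).continuous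
  have hint : Integrable fun z => v τ z * φ τ z * dunklWeight k z := by
    obtain ⟨D, hD⟩ := (isCompact_closedBall (0 : Fin d → ℝ) A).exists_bound_of_continuousOn
      (hcont τ hτ).continuousOn
    exact integrable_of_bounded_of_support hk (hcont τ hτ).aestronglyMeasurable
      (fun z hz => hD z (mem_closedBall_zero_iff.2 hz))
      (fun z hz => by rw [hφ0 τ hτ z hz.le, mul_zero])
  have hbound : Integrable ((Metric.closedBall (0 : Fin d → ℝ) A).indicator
      fun z => C * dunklWeight k z) :=
    ((by fun_prop : Continuous fun z => C * dunklWeight k z).continuousOn.integrableOn_compact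
      (isCompact_closedBall _ _)).integrable_indicator measurableSet_closedBall
  have key := hasDerivAt_integral_of_dominated_loc_of_deriv_le (μ := volume)
    (F := fun τ z => v τ z * φ τ z * dunklWeight k z)
    (F' := fun τ z => (deriv (fun τ => v τ z) τ * φ τ z + v τ z * deriv (fun τ => φ τ z) τ) *
      dunklWeight k z) (x₀ := τ) (s := Metric.closedBall τ ρ)
    (Metric.closedBall_mem_nhds τ hρ) ?_ hint ?_ (Eventually.of_forall ?_) hbound
    (Eventually.of_forall ?_)
  · refine key.2.congr_deriv ?_
    have hs := fun j => integral_axisDunklSq_symm hk j (contDiff_section hv hτ)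
      (contDiff_section hφ hτ) hA (hφ0 τ hτ)
    -- By the heat equation, this sum is almost everywhere the difference between the derivative
    -- found under the integral and the claimed one; subtracting it moves the Laplacian from `v` to
    -- `φ`.
    have hz : ∫ z, ∑ j, (axisDunklSq k j (v τ) z * φ τ z - v τ z * axisDunklSq k j (φ τ) z) *
        dunklWeight k z = 0 := by
      rw [integral_finsetSum _ fun j _ => (hs j).1]
      exact Finset.sum_eq_zero fun j _ => (hs j).2
    rw [← sub_zero (∫ z, _), ← hz, ← integral_sub key.1 (integrable_finsetSum _ fun j _ => (hs j).1)]
    refine integral_congr_ae ?_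
    filter_upwards [ae_forall_ne_zero] with z hz
    rw [heat τ hτ z hz, ← Finset.sum_mul, Finset.sum_sub_distrib, ← Finset.sum_mul,
      ← Finset.mul_sum]
    simp only [coordDunklLap]
    ring
  · filter_upwards [isOpen_Ioo.mem_nhds hτ] with τ' hτ'
    exact ((hcont τ' hτ').mul hw).aestronglyMeasurable
  · have : Continuous fun z =>
        deriv (fun τ => v τ z) τ * φ τ z + v τ z * deriv (fun τ => φ τ z) τ :=
      hF'c.comp_continuous (f := fun z => (τ, z)) (by fun_prop) fun z => ⟨hτ, Set.mem_univ _⟩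
    exact (this.mul hw).aestronglyMeasurable
  · intro z τ' hτ'
    have hw0 := dunklWeight_nonneg k z
    by_cases hz : ‖z‖ ≤ A
    · rw [Set.indicator_of_mem (mem_closedBall_zero_iff.2 hz), norm_mul, Real.norm_of_nonneg hw0]
      gcongr
      exact hC (τ', z) ⟨hτ', mem_closedBall_zero_iff.2 hz⟩
    · have hz' := (not_le.1 hz).le
      rw [Set.indicator_of_notMem (fun h => hz (mem_closedBall_zero_iff.1 h)),
        hφ0 τ' (hsub hτ') z hz', hdφ0 τ' (hsub hτ') z hz']
      simp
  · intro z τ' hτ'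
    have h1 := hasDerivAt_section hv (hsub hτ') z
    have h2 := hasDerivAt_section hφ (hsub hτ') z
    exact (h1.differentiableAt.hasDerivAt.mul h2.differentiableAt.hasDerivAt).mul_const _

end WeakForm

end Coordinates

/-! ### The product heat kernel as an approximate identity. -/

section Coordinates

variable {d : ℕ}

lemma dunklSq_mul_const (k c : ℝ) (f : ℝ → ℝ) (r : ℝ) :
    dunklSq k (fun r => f r * c) r = dunklSq k f r * c := by
  have h : deriv (fun r => f r * c) = fun r => deriv f r * c := by
    ext x; exact deriv_mul_const_field c
  simp only [dunklSq, h, deriv_mul_const_field]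
  ring

/-- The Dunkl heat kernel (not normalized) of a product of one-dimensional root systems. -/
noncomputable def prodHeat (k : Fin d → ℝ) (E : Fin d → ℝ → ℝ) (h : ℝ) (x z : Fin d → ℝ) : ℝ :=
  ∏ j, dunklHeat (k j) (E j) h (x j) (z j)

/-- The total mass of the kernel `prodHeat`. -/
noncomputable def prodMass (k : Fin d → ℝ) : ℝ := ∏ j, dunklMass (k j)

variable {k : Fin d → ℝ} {E : Fin d → ℝ → ℝ}

lemma prodMass_pos (hk : ∀ j, 0 ≤ k j) : 0 < prodMass k :=
  Finset.prod_pos fun j _ => dunklMass_pos (hk j)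

lemma prodHeat_pos (hE : ∀ j, IsDunklKernel (k j) (E j)) {h : ℝ} (hh : 0 < h) (x z : Fin d → ℝ) :
    0 < prodHeat k E h x z :=
  Finset.prod_pos fun j _ => (hE j).heat_pos hh _ _

lemma prodHeat_update (h : ℝ) (x z : Fin d → ℝ) (j : Fin d) (r : ℝ) :
    prodHeat k E h x (Function.update z j r) = dunklHeat (k j) (E j) h (x j) r *
      ∏ i ∈ Finset.univ.erase j, dunklHeat (k i) (E i) h (x i) (z i) := by
  rw [prodHeat, ← Finset.mul_prod_erase _ _ (Finset.mem_univ j), Function.update_self]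
  congr 1
  refine Finset.prod_congr rfl fun i hi => ?_
  rw [Function.update_of_ne (Finset.ne_of_mem_erase hi)]

lemma axisDunklSq_prodHeat (h : ℝ) (x z : Fin d → ℝ) (j : Fin d) :
    axisDunklSq k j (prodHeat k E h x) z = dunklSq (k j) (dunklHeat (k j) (E j) h (x j)) (z j) *
      ∏ i ∈ Finset.univ.erase j, dunklHeat (k i) (E i) h (x i) (z i) := by
  simp only [axisDunklSq, prodHeat_update]
  exact dunklSq_mul_const _ _ (dunklHeat (k j) (E j) h (x j)) _

lemma hasDerivAt_prodHeat (hE : ∀ j, IsDunklKernel (k j) (E j)) {h : ℝ} (hh : 0 < h)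
    (x : Fin d → ℝ) {z : Fin d → ℝ} (hz : ∀ j, z j ≠ 0) :
    HasDerivAt (fun h => prodHeat k E h x z) (coordDunklLap k (prodHeat k E h x) z) h := by
  have := HasDerivAt.fun_finsetProd (u := Finset.univ)
    (f := fun j h => dunklHeat (k j) (E j) h (x j) (z j))
    fun j _ => (hE j).hasDerivAt_heat_time hh (x j) (hz j)
  refine this.congr_deriv ?_
  simp only [coordDunklLap, axisDunklSq_prodHeat, smul_eq_mul]
  exact Finset.sum_congr rfl fun j _ => mul_comm _ _

lemma contDiffOn_prodHeat (hE : ∀ j, IsDunklKernel (k j) (E j)) (x : Fin d → ℝ) :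
    ContDiffOn ℝ 2 (fun p : ℝ × (Fin d → ℝ) => prodHeat k E p.1 x p.2) {p | 0 < p.1} := by
  unfold prodHeat
  refine contDiffOn_prod fun j _ => ?_
  exact ((hE j).contDiffOn_heat (x j)).comp (f := fun p : ℝ × (Fin d → ℝ) => (p.1, p.2 j))
    (by fun_prop) (fun p hp => hp)

lemma prodHeat_harnack (hE : ∀ j, IsDunklKernel (k j) (E j)) {s t : ℝ} (hs : 0 < s)
    (hst : s < t) (x y z : Fin d → ℝ) :
    prodHeat k E s x z ≤ prodHeat k E t y z * ((t / s) ^ (∑ j, (k j + 1 / 2)) *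
      exp ((∑ j, (x j - y j) ^ 2) / (4 * (t - s)))) := by
  have ht := hs.trans hst
  have := Finset.prod_le_prod (s := Finset.univ)
    (fun j _ => ((hE j).heat_pos hs (x j) (z j)).le)
    (fun j _ => (hE j).heat_harnack hs hst (x j) (y j) (z j))
  rw [Finset.prod_mul_distrib, Finset.prod_mul_distrib, ← Real.exp_sum, ← Finset.sum_div,
    ← Real.rpow_sum_of_pos (div_pos ht hs)] at this
  exact this

lemma integrable_prodHeat (hE : ∀ j, IsDunklKernel (k j) (E j)) (hk : ∀ j, 0 ≤ k j) {h : ℝ}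
    (hh : 0 < h) (x : Fin d → ℝ) :
    Integrable fun z => prodHeat k E h x z * dunklWeight k z := by
  have := Integrable.fintype_prod (μ := fun _ : Fin d => (volume : Measure ℝ))
    fun j => (hE j).integrable_heat (hk j) hh (x j)
  rw [← volume_pi] at this
  simp only [Finset.prod_mul_distrib] at this
  exact this

lemma integral_prodHeat (hE : ∀ j, IsDunklKernel (k j) (E j)) (hk : ∀ j, 0 ≤ k j) {h : ℝ}
    (hh : 0 < h) (x : Fin d → ℝ) :
    ∫ z, prodHeat k E h x z * dunklWeight k z = prodMass k := by
  have := integral_fintype_prod_volume_eq_prod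
    fun j (r : ℝ) => dunklHeat (k j) (E j) h (x j) r * |r| ^ (2 * k j)
  simp only [Finset.prod_mul_distrib] at this
  rw [prodMass, ← Finset.prod_congr rfl fun j _ => (hE j).integral_heat (hk j) hh (x j)]
  exact this

lemma prodHeat_mul_sq_eq (h : ℝ) (x z : Fin d → ℝ) (j : Fin d) :
    prodHeat k E h x z * (z j - x j) ^ 2 * dunklWeight k z =
      ∏ i, dunklHeat (k i) (E i) h (x i) (z i) * (if i = j then (z i - x i) ^ 2 else 1) *
        |z i| ^ (2 * k i) := by
  rw [Finset.prod_mul_distrib, Finset.prod_mul_distrib, Finset.prod_ite_eq' Finset.univ j,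
    if_pos (Finset.mem_univ j)]
  rfl

lemma integral_sq_mul_prodHeat (hE : ∀ j, IsDunklKernel (k j) (E j)) (hk : ∀ j, 0 ≤ k j) {h : ℝ}
    (hh : 0 < h) (x : Fin d → ℝ) (j : Fin d) :
    Integrable (fun z => prodHeat k E h x z * (z j - x j) ^ 2 * dunklWeight k z) ∧
    ∫ z, prodHeat k E h x z * (z j - x j) ^ 2 * dunklWeight k z =
      2 * h * (1 + 2 * k j) * prodMass k := by
  simp only [prodHeat_mul_sq_eq]
  constructor
  · have := Integrable.fintype_prod (μ := fun _ : Fin d => (volume : Measure ℝ))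
      (f := fun i r => dunklHeat (k i) (E i) h (x i) r * (if i = j then (r - x i) ^ 2 else 1) *
        |r| ^ (2 * k i)) fun i => by
        by_cases hij : i = j
        · simpa only [hij, if_true] using (hE j).integrable_sub_sq_mul_heat (hk j) hh (x j)
        · simpa only [hij, if_false, mul_one] using (hE i).integrable_heat (hk i) hh (x i)
    rwa [← volume_pi] at this
  · rw [integral_fintype_prod_volume_eq_prod
      (f := fun i r => dunklHeat (k i) (E i) h (x i) r * (if i = j then (r - x i) ^ 2 else 1) *
        |r| ^ (2 * k i))]
    have : ∀ i, ∫ r, dunklHeat (k i) (E i) h (x i) r * (if i = j then (r - x i) ^ 2 else 1) *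
        |r| ^ (2 * k i) = (if i = j then 2 * h * (1 + 2 * k j) else 1) * dunklMass (k i) := by
      intro i
      by_cases hij : i = j
      · simp only [hij, if_true]
        rw [(hE j).integral_sub_sq_mul_heat (hk j) hh, (hE j).integral_heat (hk j) hh]
      · simp only [hij, if_false, mul_one, one_mul]
        exact (hE i).integral_heat (hk i) hh (x i)
    simp only [this, Finset.prod_mul_distrib, prodMass]
    simp

/-- The Dunkl heat kernel is an approximate identity as the time tends to zero. -/
theorem tendsto_integral_mul_prodHeat (hE : ∀ j, IsDunklKernel (k j) (E j)) (hk : ∀ j, 0 ≤ k j)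
    {f : ℝ → (Fin d → ℝ) → ℝ} {s c M : ℝ} {x : Fin d → ℝ}
    (hm : ∀ᶠ τ in 𝓝[<] s, AEStronglyMeasurable (f τ) volume)
    (hM : ∀ᶠ τ in 𝓝[<] s, ∀ z, |f τ z| ≤ M)
    (hc : Tendsto (fun p : ℝ × (Fin d → ℝ) => f p.1 p.2) (𝓝[<] s ×ˢ 𝓝 x) (𝓝 c)) :
    Tendsto (fun τ => ∫ z, f τ z * prodHeat k E (s - τ) x z * dunklWeight k z) (𝓝[<] s)
      (𝓝 (c * prodMass k)) := by
  have hmass := prodMass_pos hk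
  rw [Metric.tendsto_nhds]
  intro ε hε
  set m := prodMass k with hm_def
  -- The kernel has mass `m`, so an error `η` near `x` contributes `ε / 2`.
  set η := ε / (2 * m) with hη
  have hη0 : 0 < η := by positivity
  have h1 := (Metric.tendsto_nhds.1 hc) η hη0
  obtain ⟨pa, hpa, pb, hpb, hab⟩ := eventually_prod_iff.1 h1
  obtain ⟨ρ, hρ, hpb'⟩ := Metric.eventually_nhds_iff.1 hpb
  set D := (|M| + |c|) / ρ ^ 2 with hD
  have hD0 : 0 ≤ D := by positivity
  set S := ∑ j, 2 * (1 + 2 * k j) * m with hS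
  have hlim : Tendsto (fun τ => D * ((s - τ) * S)) (𝓝[<] s) (𝓝 0) := by
    have : Tendsto (fun τ => D * ((s - τ) * S)) (𝓝 s) (𝓝 (D * ((s - s) * S))) := by
      apply Continuous.tendsto; fun_prop
    simp only [sub_self, zero_mul, mul_zero] at this
    exact this.mono_left nhdsWithin_le_nhds
  filter_upwards [hm, hM, hpa, self_mem_nhdsWithin,
    (tendsto_order.1 hlim).2 (ε / 2) (by positivity)] with τ hmτ hMτ hpaτ hτ hDτ
  have hh : 0 < s - τ := sub_pos.2 hτ
  have i0 := integrable_prodHeat hE hk hh x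
  have hp0 : ∀ z, 0 ≤ prodHeat k E (s - τ) x z * dunklWeight k z := fun z =>
    mul_nonneg (prodHeat_pos hE hh x z).le (dunklWeight_nonneg k z)
  have i1 : Integrable fun z => f τ z * prodHeat k E (s - τ) x z * dunklWeight k z := by
    simp only [mul_assoc]
    exact i0.bdd_mul (c := M) hmτ (Eventually.of_forall hMτ)
  have e1 : (∫ z, f τ z * prodHeat k E (s - τ) x z * dunklWeight k z) - c * m =
      ∫ z, (f τ z - c) * (prodHeat k E (s - τ) x z * dunklWeight k z) := by
    rw [hm_def, ← integral_prodHeat hE hk hh x, ← integral_const_mul,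
      ← integral_sub i1 (i0.const_mul c)]
    congr 1; ext z; ring
  -- Chebyshev's argument: away from `x` the crude bound `|M| + |c|` is paid for by the squared
  -- distance, whose integral against the kernel is `(s - τ) * S`.
  have hb : ∀ z, |f τ z - c| ≤ η + D * ∑ j, (z j - x j) ^ 2 := by
    intro z
    have hs0 : 0 ≤ ∑ j, (z j - x j) ^ 2 := Finset.sum_nonneg fun _ _ => sq_nonneg _
    by_cases hz : dist z x < ρ
    · have := hab hpaτ (hpb' hz)
      rw [Real.dist_eq] at this
      nlinarith [mul_nonneg hD0 hs0]
    · have h2 : ρ ^ 2 ≤ ∑ j, (z j - x j) ^ 2 := by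
        by_contra! hlt
        refine hz ((dist_pi_lt_iff hρ).2 fun j => ?_)
        rw [Real.dist_eq]
        refine lt_of_pow_lt_pow_left₀ 2 hρ.le ?_
        rw [sq_abs]
        exact (Finset.single_le_sum (f := fun j => (z j - x j) ^ 2)
          (fun _ _ => sq_nonneg _) (Finset.mem_univ j)).trans_lt hlt
      have h3 : |M| + |c| ≤ D * ∑ j, (z j - x j) ^ 2 := by
        calc |M| + |c| = D * ρ ^ 2 := by rw [hD]; field_simp
          _ ≤ _ := by gcongr
      have h4 := abs_sub (f τ z) c
      have h5 := (hMτ z).trans (le_abs_self M)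
      linarith
  have i2 : ∀ j, Integrable (fun z =>
      prodHeat k E (s - τ) x z * (z j - x j) ^ 2 * dunklWeight k z) :=
    fun j => (integral_sq_mul_prodHeat hE hk hh x j).1
  have i3 : Integrable fun z => ∑ j, prodHeat k E (s - τ) x z * (z j - x j) ^ 2 *
      dunklWeight k z := integrable_finsetSum _ fun j _ => i2 j
  have e2 : ∫ z, ∑ j, prodHeat k E (s - τ) x z * (z j - x j) ^ 2 * dunklWeight k z =
      (s - τ) * S := by
    rw [integral_finsetSum _ fun j _ => i2 j, hS, Finset.mul_sum]
    refine Finset.sum_congr rfl fun j _ => ?_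
    rw [(integral_sq_mul_prodHeat hE hk hh x j).2]
    ring
  rw [Real.dist_eq, e1]
  calc |∫ z, (f τ z - c) * (prodHeat k E (s - τ) x z * dunklWeight k z)|
      ≤ ∫ z, (η * (prodHeat k E (s - τ) x z * dunklWeight k z) +
        D * ∑ j, prodHeat k E (s - τ) x z * (z j - x j) ^ 2 * dunklWeight k z) := by
        rw [← Real.norm_eq_abs]
        refine norm_integral_le_of_norm_le ((i0.const_mul η).add (i3.const_mul D))
          (Eventually.of_forall fun z => ?_)
        rw [norm_mul, Real.norm_eq_abs, Real.norm_of_nonneg (hp0 z)]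
        refine (mul_le_mul_of_nonneg_right (hb z) (hp0 z)).trans (le_of_eq ?_)
        rw [add_mul, ← Finset.sum_mul, ← Finset.mul_sum]
        ring
    _ = η * m + D * ((s - τ) * S) := by
        rw [integral_add (i0.const_mul η) (i3.const_mul D), integral_const_mul,
          integral_const_mul, e2, integral_prodHeat hE hk hh x]
    _ < ε := by
        have : η * m = ε / 2 := by rw [hη]; field_simp
        linarith

end Coordinates

/-! ### Truncation, calculus rules for even functions, and limiting tools. -/

/-- A convex `C²` function that vanishes on `(-∞, 1]` and stays close to the identity. -/
lemma exists_convex_truncation : ∃ θ : ℝ → ℝ, ContDiff ℝ 2 θ ∧ (∀ v ≤ 1, θ v = 0) ∧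
    (∀ v, 0 ≤ θ v) ∧ (∀ v, 0 ≤ v → θ v ≤ v) ∧ (∀ v, v - 2 ≤ θ v) ∧
    ∀ v, 0 ≤ deriv (deriv θ) v := by
  -- `S` is to be `θ'`: increasing, `0` up to `1` and `1` from `2` on. Hence `θ` is convex and loses
  -- at most `2` against the identity on the positive axis.
  set S : ℝ → ℝ := fun r => smoothTransition (r - 1) with hS
  have hSs : ContDiff ℝ 1 S := (smoothTransition.contDiff (n := 1)).comp (by fun_prop)
  have hSc : Continuous S := hSs.continuous
  set θ : ℝ → ℝ := fun v => ∫ r in (1 : ℝ)..v, S r with hθ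
  have hd : ∀ v, HasDerivAt θ (S v) v := fun v => hSc.integral_hasStrictDerivAt 1 v |>.hasDerivAt
  have hdiff : Differentiable ℝ θ := fun v => (hd v).differentiableAt
  have hderiv : deriv θ = S := funext fun v => (hd v).deriv
  have hmono : Monotone θ := monotone_of_deriv_nonneg hdiff fun v => by
    rw [hderiv]; exact smoothTransition.nonneg _
  have h1 : θ 1 = 0 := intervalIntegral.integral_same
  have h0 : ∀ v ≤ 1, θ v = 0 := by
    intro v hv
    rw [hθ]
    refine intervalIntegral.integral_zero_ae (Eventually.of_forall fun r hr => ?_)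
    rw [Set.uIoc_of_ge hv] at hr
    exact smoothTransition.zero_of_nonpos (by linarith [hr.2])
  have hpos : ∀ v, 0 ≤ θ v := by
    intro v
    rcases le_total v 1 with h | h
    · exact (h0 v h).ge
    · exact h1 ▸ hmono h
  have hmono2 : Monotone fun v => v - θ v := by
    refine monotone_of_deriv_nonneg (differentiable_id.sub hdiff) fun v => ?_
    rw [show deriv (fun v => v - θ v) v = _ from ((hasDerivAt_id v).sub (hd v)).deriv]
    exact sub_nonneg.2 (smoothTransition.le_one _)
  refine ⟨θ, ?_, h0, hpos, fun v hv => ?_, fun v => ?_, fun v => ?_⟩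
  · refine (contDiff_succ_iff_deriv (n := 1)).2 ⟨hdiff, by simp, ?_⟩
    rw [hderiv]; exact hSs
  · have := hmono2 hv
    simp only [h0 0 zero_le_one] at this
    linarith
  · rcases le_total v 2 with h | h
    · linarith [hpos v]
    · have e : θ v = θ 2 + (v - 2) := by
        have e1 : ∫ r in (2 : ℝ)..v, S r = ∫ r in (2 : ℝ)..v, (1 : ℝ) := by
          refine intervalIntegral.integral_congr fun r hr => ?_
          rw [Set.uIcc_of_le h] at hr
          exact smoothTransition.one_of_one_le (by linarith [hr.1])
        rw [intervalIntegral.integral_const, smul_eq_mul, mul_one] at e1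
        rw [← e1]
        exact (intervalIntegral.integral_add_adjacent_intervals (hSc.intervalIntegrable _ _)
          (hSc.intervalIntegrable _ _)).symm
      linarith [hpos 2]
  · rw [hderiv]
    refine Monotone.deriv_nonneg fun x y hxy => ?_
    exact smoothTransition.monotone (by linarith)

/-- The local chain rule survives because `f(-r) = f(r)` kills the difference terms on both sides.
The extra term is nonnegative for convex `θ`, so truncation produces subsolutions. -/
lemma dunklSq_comp_of_even (k : ℝ) {θ f : ℝ → ℝ} (hθ : ContDiff ℝ 2 θ) (hf : ContDiff ℝ 2 f)
    {r : ℝ} (hr : f (-r) = f r) :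
    dunklSq k (fun r => θ (f r)) r =
      deriv θ (f r) * dunklSq k f r + deriv (deriv θ) (f r) * deriv f r ^ 2 := by
  have df : Differentiable ℝ f := hf.differentiable (by norm_num)
  have dθ : Differentiable ℝ θ := hθ.differentiable (by norm_num)
  have df' : Differentiable ℝ (deriv f) :=
    ((contDiff_succ_iff_deriv (n := 1)).1 hf).2.2.differentiable (by norm_num)
  have dθ' : Differentiable ℝ (deriv θ) :=
    ((contDiff_succ_iff_deriv (n := 1)).1 hθ).2.2.differentiable (by norm_num)
  have e1 : deriv (fun r => θ (f r)) = fun r => deriv θ (f r) * deriv f r := by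
    ext x
    exact ((dθ (f x)).hasDerivAt.comp x (df x).hasDerivAt).deriv
  have e2 : deriv (fun r => deriv θ (f r) * deriv f r) r =
      deriv (deriv θ) (f r) * deriv f r * deriv f r + deriv θ (f r) * deriv (deriv f) r :=
    ((((dθ' (f r)).hasDerivAt.comp r (df r).hasDerivAt)).mul (df' r).hasDerivAt).deriv
  rw [dunklSq, dunklSq, e1, e2, hr]
  ring

/-- Evenness of `f` at `r` lets it factor out of the difference term, leaving the classical product
rule. It is meant for radial cutoffs `f`. -/
lemma dunklSq_mul_of_even (k : ℝ) {f g : ℝ → ℝ} (hf : ContDiff ℝ 2 f) (hg : ContDiff ℝ 2 g)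
    {r : ℝ} (hr : f (-r) = f r) :
    dunklSq k (fun r => f r * g r) r =
      f r * dunklSq k g r + 2 * deriv f r * deriv g r + dunklSq k f r * g r := by
  have df : Differentiable ℝ f := hf.differentiable (by norm_num)
  have dg : Differentiable ℝ g := hg.differentiable (by norm_num)
  have df' : Differentiable ℝ (deriv f) :=
    ((contDiff_succ_iff_deriv (n := 1)).1 hf).2.2.differentiable (by norm_num)
  have dg' : Differentiable ℝ (deriv g) :=
    ((contDiff_succ_iff_deriv (n := 1)).1 hg).2.2.differentiable (by norm_num)
  have e1 : deriv (fun r => f r * g r) = fun r => deriv f r * g r + f r * deriv g r := by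
    ext x
    exact ((df x).hasDerivAt.mul (dg x).hasDerivAt).deriv
  have e2 : deriv (fun r => deriv f r * g r + f r * deriv g r) r =
      deriv (deriv f) r * g r + deriv f r * deriv g r +
        (deriv f r * deriv g r + f r * deriv (deriv g) r) :=
    (((df' r).hasDerivAt.mul (dg r).hasDerivAt).add
      ((df r).hasDerivAt.mul (dg' r).hasDerivAt)).deriv
  rw [dunklSq, dunklSq, dunklSq, e1, e2, hr]
  ring

lemma exists_rpow_le_mul_exp {a c : ℝ} (ha : 0 ≤ a) (hc : 0 < c) : ∃ K, 0 < K ∧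
    ∀ y : ℝ, 0 ≤ y → y ^ a ≤ K * exp (c * y) := by
  set n := ⌈a⌉₊
  refine ⟨n.factorial / c ^ n * exp c, by positivity, fun y hy => ?_⟩
  have h1 : y ^ a ≤ (1 + y) ^ n := by
    calc y ^ a ≤ (1 + y) ^ a := by gcongr; linarith
      _ ≤ (1 + y) ^ (n : ℝ) := Real.rpow_le_rpow_of_exponent_le (by linarith) (Nat.le_ceil a)
      _ = _ := Real.rpow_natCast _ _
  have h2 := Real.pow_div_factorial_le_exp (c * (1 + y)) (by positivity) n
  rw [div_le_iff₀ (by positivity), mul_pow] at h2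
  have h3 : exp (c * (1 + y)) = exp c * exp (c * y) := by rw [← exp_add]; ring_nf
  rw [h3] at h2
  calc y ^ a ≤ (1 + y) ^ n := h1
    _ = (c ^ n * (1 + y) ^ n) / c ^ n := by field_simp
    _ ≤ (exp c * exp (c * y) * n.factorial) / c ^ n := by gcongr
    _ = _ := by ring

/-- Gaussians of variance `h ≤ t` are small far out, uniformly in `h`. -/
lemma exists_forall_rpow_mul_exp_le {a c t δ : ℝ} (ha : 0 ≤ a) (hc : 0 < c) (ht : 0 < t)
    (hδ : 0 < δ) : ∃ R, 1 ≤ R ∧ ∀ h, 0 < h → h ≤ t → ∀ N, R ≤ N →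
      h ^ (-a) * exp (-(c * N / h)) ≤ δ := by
  obtain ⟨K, hK, hKb⟩ := exists_rpow_le_mul_exp ha hc
  have hlim : Tendsto (fun N : ℝ => K * exp (-(c * (N - 1) / t))) atTop (𝓝 0) := by
    have h1 : Tendsto (fun N : ℝ => c * (N - 1) / t) atTop atTop :=
      ((tendsto_atTop_add_const_right _ (-1) tendsto_id).const_mul_atTop hc).atTop_div_const ht
    simpa using (tendsto_exp_neg_atTop_nhds_zero.comp h1).const_mul K
  obtain ⟨R, hR⟩ := eventually_atTop.1 ((tendsto_order.1 hlim).2 δ hδ)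
  refine ⟨max R 1, le_max_right _ _, fun h hh hht N hN => ?_⟩
  have hN1 : 1 ≤ N := (le_max_right _ _).trans hN
  have h1 := hKb h⁻¹ (by positivity)
  rw [Real.inv_rpow hh.le, ← Real.rpow_neg hh.le] at h1
  -- Splitting `N = 1 + (N - 1)`: the first part absorbs `h ^ (-a)`, the second is small uniformly
  -- in `h ≤ t`.
  have h2 : exp (-(c * N / h)) = exp (-(c * h⁻¹)) * exp (-(c * (N - 1) / h)) := by
    rw [← exp_add]; congr 1; field_simp; ring
  have h3 : exp (-(c * (N - 1) / h)) ≤ exp (-(c * (N - 1) / t)) := by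
    refine exp_le_exp.2 (neg_le_neg ?_)
    have : 0 ≤ c * (N - 1) := mul_nonneg hc.le (by linarith)
    gcongr
  calc h ^ (-a) * exp (-(c * N / h))
      ≤ (K * exp (c * h⁻¹)) * (exp (-(c * h⁻¹)) * exp (-(c * (N - 1) / t))) := by
        rw [h2]; gcongr
    _ = K * exp (-(c * (N - 1) / t)) * (exp (c * h⁻¹) * exp (-(c * h⁻¹))) := by ring
    _ = K * exp (-(c * (N - 1) / t)) := by rw [← exp_add]; simp
    _ ≤ δ := (hR N ((le_max_left _ _).trans hN)).le

/-- Fatou's lemma; it removes the truncation from the moment bound. -/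
lemma integrable_and_integral_le_of_tendsto {α : Type*} [MeasurableSpace α] {μ : Measure α}
    {F : ℕ → α → ℝ} {f : α → ℝ} {K : ℝ} (hF : ∀ n, Integrable (F n) μ) (hF0 : ∀ n z, 0 ≤ F n z)
    (hK : ∀ n, ∫ z, F n z ∂μ ≤ K) (hlim : ∀ z, Tendsto (fun n => F n z) atTop (𝓝 (f z))) :
    Integrable f μ ∧ ∫ z, f z ∂μ ≤ K := by
  have hf0 : ∀ z, 0 ≤ f z := fun z => ge_of_tendsto' (hlim z) fun n => hF0 n z
  have hK0 : 0 ≤ K := (integral_nonneg (hF0 0)).trans (hK 0)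
  have hfm : AEStronglyMeasurable f μ :=
    aestronglyMeasurable_of_tendsto_ae atTop (fun n => (hF n).aestronglyMeasurable)
      (Eventually.of_forall hlim)
  have h1 : ∫⁻ z, ENNReal.ofReal (f z) ∂μ ≤ ENNReal.ofReal K := by
    calc ∫⁻ z, ENNReal.ofReal (f z) ∂μ
        = ∫⁻ z, liminf (fun n => ENNReal.ofReal (F n z)) atTop ∂μ := by
          refine lintegral_congr fun z => ?_
          exact ((ENNReal.continuous_ofReal.tendsto _).comp (hlim z)).liminf_eq.symm
      _ ≤ liminf (fun n => ∫⁻ z, ENNReal.ofReal (F n z) ∂μ) atTop :=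
          lintegral_liminf_le' fun n => (hF n).aestronglyMeasurable.aemeasurable.ennreal_ofReal
      _ ≤ liminf (fun _ : ℕ => ENNReal.ofReal K) atTop := by
          refine liminf_le_liminf (Eventually.of_forall fun n => ?_)
          rw [← ofReal_integral_eq_lintegral_ofReal (hF n) (Eventually.of_forall (hF0 n))]
          exact ENNReal.ofReal_le_ofReal (hK n)
      _ = ENNReal.ofReal K := liminf_const _
  have hi : Integrable f μ :=
    (lintegral_ofReal_ne_top_iff_integrable hfm (Eventually.of_forall hf0)).1
      (ne_top_of_le_ne_top ENNReal.ofReal_ne_top h1)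
  refine ⟨hi, ?_⟩
  rw [← ofReal_integral_eq_lintegral_ofReal hi (Eventually.of_forall hf0)] at h1
  exact (ENNReal.ofReal_le_ofReal_iff hK0).1 h1

/-! ### Gaussian moments of positive solutions. -/

section Coordinates

variable {d : ℕ} {k : Fin d → ℝ} {E : Fin d → ℝ → ℝ}

lemma sq_norm_le_sum_sq (z : Fin d → ℝ) : ‖z‖ ^ 2 ≤ ∑ j, z j ^ 2 := by
  have h0 : 0 ≤ ∑ j, z j ^ 2 := Finset.sum_nonneg fun _ _ => sq_nonneg _
  have : ‖z‖ ≤ √(∑ j, z j ^ 2) := (pi_norm_le_iff_of_nonneg (Real.sqrt_nonneg _)).2 fun j => by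
    rw [Real.norm_eq_abs]
    refine Real.abs_le_sqrt ?_
    exact Finset.single_le_sum (f := fun j => z j ^ 2) (fun _ _ => sq_nonneg _) (Finset.mem_univ j)
  calc ‖z‖ ^ 2 ≤ √(∑ j, z j ^ 2) ^ 2 := by gcongr
    _ = _ := Real.sq_sqrt h0

lemma prodHeat_le (hE : ∀ j, IsDunklKernel (k j) (E j)) {h : ℝ} (hh : 0 < h) (x z : Fin d → ℝ) :
    prodHeat k E h x z ≤ h ^ (-∑ j, (k j + 1 / 2)) *
      exp (-(∑ j, (|z j| - |x j|) ^ 2) / (4 * h)) := by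
  have := Finset.prod_le_prod (s := Finset.univ)
    (fun j _ => ((hE j).heat_pos hh (x j) (z j)).le)
    (fun j _ => (hE j).heat_le hh (x j) (z j))
  rw [Finset.prod_mul_distrib, ← Real.exp_sum, ← Finset.sum_div,
    ← Real.rpow_sum_of_pos hh, Finset.sum_neg_distrib, Finset.sum_neg_distrib] at this
  exact this

lemma prodHeat_zero (hE : ∀ j, IsDunklKernel (k j) (E j)) {h : ℝ} (hh : 0 < h) (z : Fin d → ℝ) :
    prodHeat k E h 0 z = h ^ (-∑ j, (k j + 1 / 2)) * exp (-(∑ j, z j ^ 2) / (4 * h)) := by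
  have : prodHeat k E h 0 z =
      ∏ j, h ^ (-(k j + 1 / 2)) * exp (-(z j ^ 2) / (4 * h)) := by
    refine Finset.prod_congr rfl fun j _ => ?_
    simp [dunklHeat, (hE j).zero]
  rw [this, Finset.prod_mul_distrib, ← Real.exp_sum, ← Finset.sum_div,
    ← Real.rpow_sum_of_pos hh, Finset.sum_neg_distrib, Finset.sum_neg_distrib]

lemma contDiffOn_prodHeat_sub (hE : ∀ j, IsDunklKernel (k j) (E j)) (x : Fin d → ℝ) (a t : ℝ) :
    ContDiffOn ℝ 2 (fun p : ℝ × (Fin d → ℝ) => prodHeat k E (t - p.1) x p.2)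
      (Set.Ioo a t ×ˢ Set.univ) :=
  (contDiffOn_prodHeat hE x).comp (f := fun p : ℝ × (Fin d → ℝ) => (t - p.1, p.2)) (by fun_prop)
    (fun p hp => sub_pos.2 hp.1.2)

lemma hasDerivAt_prodHeat_sub (hE : ∀ j, IsDunklKernel (k j) (E j)) {τ t : ℝ} (hτ : τ < t)
    (x : Fin d → ℝ) {z : Fin d → ℝ} (hz : ∀ j, z j ≠ 0) :
    HasDerivAt (fun τ => prodHeat k E (t - τ) x z)
      (-coordDunklLap k (prodHeat k E (t - τ) x) z) τ := by
  have h1 := hasDerivAt_prodHeat hE (sub_pos.2 hτ) x hz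
  have := h1.scomp τ ((hasDerivAt_id τ).const_sub t)
  rw [neg_one_smul] at this
  exact this

lemma axisDunklSq_comp_of_even {θ : ℝ → ℝ} {f : (Fin d → ℝ) → ℝ} (hθ : ContDiff ℝ 2 θ)
    (hf : ContDiff ℝ 2 f) {z : Fin d → ℝ} {j : Fin d}
    (hz : f (Function.update z j (-z j)) = f z) (h0 : ∀ v, 0 ≤ deriv (deriv θ) v) :
    deriv θ (f z) * axisDunklSq k j f z ≤ axisDunklSq k j (fun z => θ (f z)) z := by
  have := dunklSq_comp_of_even (k j) hθ (contDiff_comp_update hf z j) (r := z j)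
    (by simpa using hz)
  simp only [Function.update_eq_self] at this
  rw [axisDunklSq, axisDunklSq, this]
  nlinarith [mul_nonneg (h0 (f z)) (sq_nonneg (deriv (fun r => f (Function.update z j r)) (z j)))]

/-- Centred at the origin the kernel is a pure Gaussian, hence even in every coordinate. This is why
the moment bound is proved there, where the chain rule for even functions applies. -/
lemma prodHeat_zero_update_neg (h : ℝ) (z : Fin d → ℝ) (j : Fin d) :
    prodHeat k E h 0 (Function.update z j (-z j)) = prodHeat k E h 0 z := by
  conv_rhs => rw [← Function.update_eq_self j z]
  rw [prodHeat_update, prodHeat_update]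
  simp [dunklHeat]

variable {v : ℝ → (Fin d → ℝ) → ℝ} {T : ℝ}

/-- A positive solution, restricted to a ball, pairs with the heat kernel to a function that
converges to the value of the solution. -/
lemma tendsto_integral_mul_mul_prodHeat (hE : ∀ j, IsDunklKernel (k j) (E j))
    (hk : ∀ j, 0 ≤ k j)
    (hv : ContDiffOn ℝ 2 (fun p : ℝ × (Fin d → ℝ) => v p.1 p.2) (Set.Ioo 0 T ×ˢ Set.univ))
    {s : ℝ} (hs : s ∈ Set.Ioo 0 T) (x : Fin d → ℝ) {χ : (Fin d → ℝ) → ℝ} (hχm : Measurable χ)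
    (hχ : ContinuousAt χ x) {A : ℝ} (hχ0 : ∀ z, A < ‖z‖ → χ z = 0) (hχ1 : ∀ z, |χ z| ≤ 1) :
    Tendsto (fun τ => ∫ z, v τ z * χ z * prodHeat k E (s - τ) x z * dunklWeight k z) (𝓝[<] s)
      (𝓝 (v s x * χ x * prodMass k)) := by
  have hmem : Set.Ioo 0 T ×ˢ Set.univ ∈ 𝓝 (s, x) :=
    (isOpen_Ioo.prod isOpen_univ).mem_nhds ⟨hs, Set.mem_univ _⟩
  have hle : 𝓝[<] s ≤ 𝓝 s := nhdsWithin_le_nhds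
  obtain ⟨ρ, hρ, hsub⟩ := Metric.nhds_basis_closedBall.mem_iff.1 (isOpen_Ioo.mem_nhds hs)
  obtain ⟨C, hC⟩ := ((isCompact_closedBall s ρ).prod
    (isCompact_closedBall (0 : Fin d → ℝ) A)).exists_bound_of_continuousOn
    (hv.continuousOn.mono (Set.prod_mono hsub (Set.subset_univ _)))
  refine tendsto_integral_mul_prodHeat hE hk (M := max C 0) (f := fun τ z => v τ z * χ z) ?_ ?_ ?_
  · filter_upwards [hle (isOpen_Ioo.mem_nhds hs)] with τ hτ
    exact ((contDiff_section hv hτ).continuous.measurable.mul hχm).aestronglyMeasurable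
  · filter_upwards [hle (Metric.closedBall_mem_nhds s hρ)] with τ hτ z
    by_cases hz : ‖z‖ ≤ A
    · have h1 := hC (τ, z) ⟨hτ, mem_closedBall_zero_iff.2 hz⟩
      rw [abs_mul]
      calc |v τ z| * |χ z| ≤ |v τ z| * 1 := by gcongr; exact hχ1 z
        _ ≤ max C 0 := by rw [mul_one]; exact h1.trans (le_max_left _ _)
    · rw [hχ0 z (not_le.1 hz)]; simp
  · have h1 : ContinuousAt (fun p : ℝ × (Fin d → ℝ) => v p.1 p.2) (s, x) :=
      hv.continuousOn.continuousAt hmem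
    have h2 : ContinuousAt (fun p : ℝ × (Fin d → ℝ) => χ p.2) (s, x) :=
      ContinuousAt.comp (f := fun p : ℝ × (Fin d → ℝ) => p.2) hχ continuousAt_snd
    have h3 : Tendsto (fun p : ℝ × (Fin d → ℝ) => v p.1 p.2 * χ p.2) (𝓝 s ×ˢ 𝓝 x)
        (𝓝 (v s x * χ x)) := by
      rw [← nhds_prod_eq]; exact (h1.mul h2).tendsto
    exact h3.mono_left (prod_mono_left _ hle)

/-- A positive solution of the Dunkl heat equation has Gaussian moments. -/
theorem integral_mul_prodHeat_zero_le (hE : ∀ j, IsDunklKernel (k j) (E j)) (hk : ∀ j, 0 ≤ k j)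
    (hv : ContDiffOn ℝ 2 (fun p : ℝ × (Fin d → ℝ) => v p.1 p.2) (Set.Ioo 0 T ×ˢ Set.univ))
    (hpos : ∀ τ ∈ Set.Ioo 0 T, ∀ z, 0 < v τ z)
    (heat : ∀ τ ∈ Set.Ioo 0 T, ∀ z : Fin d → ℝ, (∀ j, z j ≠ 0) →
      deriv (fun τ => v τ z) τ = coordDunklLap k (v τ) z)
    {t : ℝ} (ht : t < T) {τ : ℝ} (hτ : τ ∈ Set.Ioo 0 t) :
    Integrable (fun z => v τ z * prodHeat k E (t - τ) 0 z * dunklWeight k z) ∧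
    ∫ z, v τ z * prodHeat k E (t - τ) 0 z * dunklWeight k z ≤ v t 0 * prodMass k := by
  have ht0 : 0 < t := hτ.1.trans hτ.2
  have hsubT : Set.Ioo 0 t ⊆ Set.Ioo 0 T := Set.Ioo_subset_Ioo_right ht.le
  obtain ⟨θ, hθ, hθ1, hθ0, hθle, hθge, hθ2⟩ := exists_convex_truncation
  have hvt := hv.mono (Set.prod_mono hsubT (subset_refl Set.univ))
  have hheat_mono : ∀ σ ∈ Set.Ioo 0 t, ∀ z : Fin d → ℝ, (∀ j, z j ≠ 0) →
      deriv (fun τ => v τ z) σ = coordDunklLap k (v σ) z := fun σ hσ => heat σ (hsubT hσ)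
  have a0 : 0 ≤ ∑ j, (k j + 1 / 2) := Finset.sum_nonneg fun j _ => by linarith [hk j]
  -- The test function is `δ θ(p / δ)`, with `p` the kernel: it vanishes where `p ≤ δ`, hence
  -- outside a ball independent of time.
  have main : ∀ δ : ℝ, 0 < δ →
      Integrable (fun z => v τ z * (δ * θ (prodHeat k E (t - τ) 0 z / δ)) * dunklWeight k z) ∧
      ∫ z, v τ z * (δ * θ (prodHeat k E (t - τ) 0 z / δ)) * dunklWeight k z ≤
        v t 0 * prodMass k := by
    intro δ hδ
    obtain ⟨A, hA1, hA⟩ := exists_forall_rpow_mul_exp_le a0 (by norm_num : (0 : ℝ) < 1 / 4) ht0 hδ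
    have hsupp : ∀ σ ∈ Set.Ioo 0 t, ∀ z, A ≤ ‖z‖ →
        δ * θ (prodHeat k E (t - σ) 0 z / δ) = 0 := by
      intro σ hσ z hz
      -- As `A ≥ 1`, the threshold for the sum of squares also serves as a radius.
      have hN : A ≤ ∑ j, z j ^ 2 := by nlinarith [sq_norm_le_sum_sq z]
      have h1 := hA (t - σ) (sub_pos.2 hσ.2) (by linarith [hσ.1]) _ hN
      rw [hθ1, mul_zero]
      rw [div_le_one hδ, prodHeat_zero hE (sub_pos.2 hσ.2)]
      refine le_trans (le_of_eq ?_) h1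
      congr 2
      have : t - σ ≠ 0 := (sub_pos.2 hσ.2).ne'
      field_simp
    have hφ : ContDiffOn ℝ 2 (fun p : ℝ × (Fin d → ℝ) =>
        δ * θ (prodHeat k E (t - p.1) 0 p.2 / δ)) (Set.Ioo 0 t ×ˢ Set.univ) :=
      contDiffOn_const.mul (hθ.comp_contDiffOn
        ((contDiffOn_prodHeat_sub hE 0 0 t).div_const δ))
    have hder := fun σ (hσ : σ ∈ Set.Ioo 0 t) =>
      hasDerivAt_integral_mul_test (φ := fun σ z => δ * θ (prodHeat k E (t - σ) 0 z / δ))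
        hk hvt hheat_mono hφ (by linarith) hsupp hσ
    -- By the weak form the derivative is the integral of `v` against `∂_σ φ + L φ`, with `φ` the
    -- test function and `L` the Laplacian. This is nonnegative since `p` solves the backward
    -- equation and the truncation is convex.
    have hmono : MonotoneOn (fun σ => ∫ z, v σ z * (δ * θ (prodHeat k E (t - σ) 0 z / δ)) *
        dunklWeight k z) (Set.Ioo 0 t) := by
      refine monotoneOn_of_deriv_nonneg (convex_Ioo 0 t)
        (fun σ hσ => (hder σ hσ).continuousAt.continuousWithinAt)
        (fun σ hσ => (hder σ (interior_subset hσ)).differentiableAt.differentiableWithinAt)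
        fun σ hσ => ?_
      have hσ' := interior_subset hσ
      rw [(hder σ hσ').deriv]
      refine integral_nonneg_of_ae ?_
      filter_upwards [ae_forall_ne_zero] with z hz
      refine mul_nonneg (mul_nonneg (hpos σ (hsubT hσ') z).le ?_) (dunklWeight_nonneg k z)
      set θ' : ℝ → ℝ := fun y => δ * θ (y / δ) with hθ'
      have hθ's : ContDiff ℝ 2 θ' := contDiff_const.mul (hθ.comp (by fun_prop))
      have hdθ' : deriv θ' = fun y => deriv θ (y / δ) := by
        ext y
        have h1 := ((hθ.differentiable (by norm_num)) (y / δ)).hasDerivAt.comp y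
          ((hasDerivAt_id y).div_const δ)
        refine ((h1.const_mul δ).congr_deriv ?_).deriv
        field_simp
      have hdd : ∀ y, 0 ≤ deriv (deriv θ') y := by
        intro y
        have dθ' : Differentiable ℝ (deriv θ) :=
          ((contDiff_succ_iff_deriv (n := 1)).1 hθ).2.2.differentiable (by norm_num)
        rw [hdθ']
        have h1 := (dθ' (y / δ)).hasDerivAt.comp y ((hasDerivAt_id y).div_const δ)
        rw [show deriv (fun y => deriv θ (y / δ)) y = _ from h1.deriv]
        have := hθ2 (y / δ)
        positivity
      have hGs : ContDiff ℝ 2 (prodHeat k E (t - σ) 0) :=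
        contDiff_section (v := fun σ z => prodHeat k E (t - σ) 0 z)
          (contDiffOn_prodHeat_sub hE 0 0 t) hσ'
      have h1 : deriv (fun σ => δ * θ (prodHeat k E (t - σ) 0 z / δ)) σ =
          deriv θ' (prodHeat k E (t - σ) 0 z) *
            -coordDunklLap k (prodHeat k E (t - σ) 0) z :=
        ((hθ's.differentiable (by norm_num) _).hasDerivAt.comp σ
          (hasDerivAt_prodHeat_sub hE hσ'.2 0 hz)).deriv
      have h2 : deriv θ' (prodHeat k E (t - σ) 0 z) * coordDunklLap k (prodHeat k E (t - σ) 0) z ≤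
          coordDunklLap k (fun z => θ' (prodHeat k E (t - σ) 0 z)) z := by
        rw [coordDunklLap, coordDunklLap, Finset.mul_sum]
        exact Finset.sum_le_sum fun j _ =>
          axisDunklSq_comp_of_even hθ's hGs (prodHeat_zero_update_neg _ z j) hdd
      rw [h1]
      simp only [hθ'] at h2 ⊢
      linarith
    have hwc := continuous_dunklWeight hk
    have hint : ∀ σ ∈ Set.Ioo 0 t, Integrable (fun z =>
        v σ z * (δ * θ (prodHeat k E (t - σ) 0 z / δ)) * dunklWeight k z) := by
      intro σ hσ
      have hc : Continuous fun z => v σ z * (δ * θ (prodHeat k E (t - σ) 0 z / δ)) :=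
        (contDiff_section hvt hσ).continuous.mul (contDiff_section
          (v := fun σ z => δ * θ (prodHeat k E (t - σ) 0 z / δ)) hφ hσ).continuous
      obtain ⟨D, hD⟩ := (isCompact_closedBall (0 : Fin d → ℝ) A).exists_bound_of_continuousOn
        hc.continuousOn
      exact integrable_of_bounded_of_support hk hc.aestronglyMeasurable
        (fun z hz => hD z (mem_closedBall_zero_iff.2 hz))
        (fun z hz => by rw [hsupp σ hσ z hz.le, mul_zero])
    refine ⟨hint τ hτ, ?_⟩
    -- The test function is at most `χ p`, and the pairing of `v` with `χ p` tends to `v t 0 *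
    -- prodMass k` as time increases to `t`. Monotonicity carries the bound back to `τ`.
    set χ : (Fin d → ℝ) → ℝ := (Metric.closedBall 0 A).indicator 1 with hχ
    have hχx : χ 0 = 1 := by
      rw [hχ, Set.indicator_of_mem (Metric.mem_closedBall_self (by linarith))]; rfl
    have hlim := tendsto_integral_mul_mul_prodHeat hE hk hv ⟨ht0, ht⟩ 0 (χ := χ)
      (measurable_one.indicator measurableSet_closedBall)
      (by
        have : χ =ᶠ[𝓝 0] fun _ => 1 := by
          filter_upwards [Metric.closedBall_mem_nhds (0 : Fin d → ℝ) (by linarith : 0 < A)]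
            with z hz
          rw [hχ, Set.indicator_of_mem hz]; rfl
        exact this.continuousAt) (A := A)
      (fun z hz => Set.indicator_of_notMem (fun h => by
        rw [mem_closedBall_zero_iff] at h; linarith) _)
      (fun z => by
        by_cases hz : z ∈ Metric.closedBall (0 : Fin d → ℝ) A
        · simp [hχ, Set.indicator_of_mem hz]
        · simp [hχ, Set.indicator_of_notMem hz])
    rw [hχx, mul_one] at hlim
    refine ge_of_tendsto hlim ?_
    filter_upwards [Ioo_mem_nhdsLT hτ.2] with σ hσ
    have hσ' : σ ∈ Set.Ioo 0 t := ⟨hτ.1.trans hσ.1, hσ.2⟩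
    refine (hmono hτ hσ' hσ.1.le).trans ?_
    have hp : ∀ z, 0 < prodHeat k E (t - σ) 0 z := prodHeat_pos hE (sub_pos.2 hσ.2) 0
    have hle : ∀ z, δ * θ (prodHeat k E (t - σ) 0 z / δ) ≤ χ z * prodHeat k E (t - σ) 0 z := by
      intro z
      by_cases hz : ‖z‖ ≤ A
      · rw [hχ, Set.indicator_of_mem (mem_closedBall_zero_iff.2 hz), Pi.one_apply, one_mul]
        have := hθle (prodHeat k E (t - σ) 0 z / δ) (div_nonneg (hp z).le hδ.le)
        calc _ ≤ δ * (prodHeat k E (t - σ) 0 z / δ) := by gcongr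
          _ = _ := by field_simp
      · rw [hsupp σ hσ' z (not_le.1 hz).le, hχ, Set.indicator_of_notMem
          (fun h => hz (mem_closedBall_zero_iff.1 h)), zero_mul]
    refine integral_mono (hint σ hσ') ?_ fun z => ?_
    · have hc : Continuous fun z => v σ z * prodHeat k E (t - σ) 0 z :=
        (contDiff_section hvt hσ').continuous.mul (contDiff_section
          (v := fun σ z => prodHeat k E (t - σ) 0 z) (contDiffOn_prodHeat_sub hE 0 0 t)
          hσ').continuous
      have := ((hc.mul hwc).continuousOn.integrableOn_compact (μ := volume)
        (isCompact_closedBall (0 : Fin d → ℝ) A)).integrable_indicator measurableSet_closedBall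
      refine this.congr (Eventually.of_forall fun z => ?_)
      by_cases hz : z ∈ Metric.closedBall (0 : Fin d → ℝ) A
      · simp only [hχ, Set.indicator_of_mem hz, Pi.one_apply, mul_one, Pi.mul_apply]
      · simp only [hχ, Set.indicator_of_notMem hz, mul_zero, zero_mul]
    · have := hle z
      have h3 := (hpos σ (hsubT hσ') z).le
      have h4 := dunklWeight_nonneg k z
      simp only [mul_assoc (v σ z) (χ z)]
      gcongr
  have hp : ∀ z, 0 < prodHeat k E (t - τ) 0 z := prodHeat_pos hE (sub_pos.2 hτ.2) 0
  -- Take `δ = 1 / (n + 1)`. Since `p - 2δ ≤ δ θ(p / δ) ≤ p`, the truncations converge to `p`.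
  refine integrable_and_integral_le_of_tendsto
    (F := fun (n : ℕ) z => v τ z * (1 / ((n : ℝ) + 1) *
      θ (prodHeat k E (t - τ) 0 z / (1 / ((n : ℝ) + 1)))) * dunklWeight k z)
    (fun n => (main _ (by positivity)).1) (fun n z => ?_) (fun n => (main _ (by positivity)).2)
    fun z => ?_
  · have h3 := (hpos τ (hsubT hτ) z).le
    have h4 := dunklWeight_nonneg k z
    have := hθ0 (prodHeat k E (t - τ) 0 z / (1 / ((n : ℝ) + 1)))
    positivity
  · refine Tendsto.mul_const _ (Tendsto.const_mul _ ?_)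
    set g := prodHeat k E (t - τ) 0 z
    have hl : Tendsto (fun n : ℕ => g - 2 * (1 / ((n : ℝ) + 1))) atTop (𝓝 (g - 2 * 0)) :=
      tendsto_const_nhds.sub (tendsto_one_div_add_atTop_nhds_zero_nat.const_mul 2)
    rw [mul_zero, sub_zero] at hl
    refine tendsto_of_tendsto_of_tendsto_of_le_of_le hl tendsto_const_nhds (fun n => ?_) fun n => ?_
    · have hδ : 0 < 1 / ((n : ℝ) + 1) := by positivity
      have := mul_le_mul_of_nonneg_left (hθge (g / (1 / ((n : ℝ) + 1)))) hδ.le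
      refine le_trans (le_of_eq ?_) this
      field_simp
    · have hδ : 0 < 1 / ((n : ℝ) + 1) := by positivity
      have := mul_le_mul_of_nonneg_left
        (hθle (g / (1 / ((n : ℝ) + 1))) (div_nonneg (hp z).le hδ.le)) hδ.le
      refine le_trans this (le_of_eq ?_)
      field_simp

end Coordinates

/-! ### Radial cutoffs, their commutators, and domination of the kernel far out. -/

lemma exists_cutoff : ∃ ψ : ℝ → ℝ, ContDiff ℝ 2 ψ ∧ (∀ v ≤ 1, ψ v = 1) ∧ (∀ v, 2 ≤ v → ψ v = 0) ∧
    (∀ v, 0 ≤ ψ v) ∧ (∀ v, ψ v ≤ 1) ∧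
    (∀ v, v < 1 ∨ 2 < v → deriv ψ v = 0 ∧ deriv (deriv ψ) v = 0) ∧
    ∃ C, 0 ≤ C ∧ ∀ v, |deriv ψ v| ≤ C ∧ |deriv (deriv ψ) v| ≤ C := by
  set ψ : ℝ → ℝ := fun v => 1 - smoothTransition (v - 1) with hψ
  have hs : ContDiff ℝ 2 ψ :=
    contDiff_const.sub ((smoothTransition.contDiff (n := 2)).comp (by fun_prop))
  have h1 : ∀ v ≤ 1, ψ v = 1 := fun v hv => by
    rw [hψ]; simp only; rw [smoothTransition.zero_of_nonpos (by linarith), sub_zero]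
  have h2 : ∀ v, 2 ≤ v → ψ v = 0 := fun v hv => by
    rw [hψ]; simp only; rw [smoothTransition.one_of_one_le (by linarith), sub_self]
  have h3 : ∀ v, v < 1 ∨ 2 < v → deriv ψ v = 0 ∧ deriv (deriv ψ) v = 0 := by
    rintro v (hv | hv)
    · have : ψ =ᶠ[𝓝 v] fun _ => 1 := by
        filter_upwards [isOpen_Iio.mem_nhds hv] with y hy using h1 y (le_of_lt hy)
      rw [this.deriv_eq, this.deriv.deriv_eq]; simp
    · have : ψ =ᶠ[𝓝 v] fun _ => 0 := by
        filter_upwards [isOpen_Ioi.mem_nhds hv] with y hy using h2 y (le_of_lt hy)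
      rw [this.deriv_eq, this.deriv.deriv_eq]; simp
  have hs' : ContDiff ℝ 1 (deriv ψ) := ((contDiff_succ_iff_deriv (n := 1)).1 hs).2.2
  obtain ⟨C1, hC1⟩ := (isCompact_Icc (a := (1 : ℝ)) (b := 2)).exists_bound_of_continuousOn
    hs'.continuous.continuousOn
  obtain ⟨C2, hC2⟩ := (isCompact_Icc (a := (1 : ℝ)) (b := 2)).exists_bound_of_continuousOn
    (hs'.continuous_deriv (by norm_num)).continuousOn
  refine ⟨ψ, hs, h1, h2, fun v => sub_nonneg.2 (smoothTransition.le_one _),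
    fun v => sub_le_self _ (smoothTransition.nonneg _), h3, max (max C1 C2) 0,
    le_max_right _ _, fun v => ?_⟩
  by_cases hv : v < 1 ∨ 2 < v
  · rw [(h3 v hv).1, (h3 v hv).2]; simp
  · push Not at hv
    exact ⟨(hC1 v hv).trans ((le_max_left _ _).trans (le_max_left _ _)),
      (hC2 v hv).trans ((le_max_right _ _).trans (le_max_left _ _))⟩

lemma hasDerivAt_comp_add_sq {ψ : ℝ → ℝ} (hψ : Differentiable ℝ ψ) (c D r : ℝ) :
    HasDerivAt (fun r => ψ ((c + r ^ 2) / D)) (deriv ψ ((c + r ^ 2) / D) * (2 * r / D)) r := by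
  have h1 : HasDerivAt (fun r : ℝ => (c + r ^ 2) / D) (2 * r / D) r := by
    simpa using ((hasDerivAt_pow 2 r).const_add c).div_const D
  exact (hψ _).hasDerivAt.comp r h1

lemma deriv_deriv_comp_add_sq {ψ : ℝ → ℝ} (hψ : ContDiff ℝ 2 ψ) (c D r : ℝ) :
    deriv (deriv fun r => ψ ((c + r ^ 2) / D)) r =
      deriv (deriv ψ) ((c + r ^ 2) / D) * (2 * r / D) ^ 2 +
        deriv ψ ((c + r ^ 2) / D) * (2 / D) := by
  have d1 : Differentiable ℝ ψ := hψ.differentiable (by norm_num)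
  have d2 : Differentiable ℝ (deriv ψ) :=
    ((contDiff_succ_iff_deriv (n := 1)).1 hψ).2.2.differentiable (by norm_num)
  have e : (deriv fun r => ψ ((c + r ^ 2) / D)) =
      fun r => deriv ψ ((c + r ^ 2) / D) * (2 * r / D) :=
    funext fun r => (hasDerivAt_comp_add_sq d1 c D r).deriv
  have h2 : HasDerivAt (fun r : ℝ => 2 * r / D) (2 / D) r := by
    simpa using ((hasDerivAt_id r).const_mul 2).div_const D
  rw [e]
  refine (((hasDerivAt_comp_add_sq d2 c D r).mul h2).congr_deriv ?_).deriv
  ring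

lemma dunklSq_comp_add_sq (k : ℝ) (ψ : ℝ → ℝ) (c D r : ℝ) :
    dunklSq k (fun r => ψ ((c + r ^ 2) / D)) r =
      deriv (deriv fun r => ψ ((c + r ^ 2) / D)) r +
        2 * k / r * deriv (fun r => ψ ((c + r ^ 2) / D)) r := by
  simp [dunklSq]

/-- The cutoff is even in `r`, so no difference term occurs. The factor `8` bounds `(2r / R²)²`, `2`
bounds `2 / R²`, and `4k` bounds `(2k / r) (2r / R²)`, all by `R ≥ 1` and `r² ≤ 2R²`. -/
lemma abs_dunklSq_comp_add_sq_le {k C R c r : ℝ} (hk : 0 ≤ k) {ψ : ℝ → ℝ} (hψ : ContDiff ℝ 2 ψ)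
    (hC0 : 0 ≤ C) (hC : ∀ v, |deriv ψ v| ≤ C ∧ |deriv (deriv ψ) v| ≤ C) (hR : 1 ≤ R)
    (hr : r ^ 2 ≤ 2 * R ^ 2) :
    |dunklSq k (fun r => ψ ((c + r ^ 2) / R ^ 2)) r| ≤ C * (10 + 4 * k) := by
  rw [dunklSq_comp_add_sq, deriv_deriv_comp_add_sq hψ,
    (hasDerivAt_comp_add_sq (hψ.differentiable (by norm_num)) c (R ^ 2) r).deriv]
  obtain ⟨b1, b2⟩ := hC ((c + r ^ 2) / R ^ 2)
  generalize deriv ψ ((c + r ^ 2) / R ^ 2) = P1 at *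
  generalize deriv (deriv ψ) ((c + r ^ 2) / R ^ 2) = P2 at *
  have hR0 : 0 < R ^ 2 := by positivity
  have hR1 : 1 ≤ R ^ 2 := one_le_pow₀ hR
  have u0 : r ^ 2 / R ^ 2 ≤ 2 := by rw [div_le_iff₀ hR0]; exact hr
  have u1 : |P2 * (2 * r / R ^ 2) ^ 2| ≤ C * 8 := by
    rw [abs_mul, abs_sq]
    have : (2 * r / R ^ 2) ^ 2 ≤ 8 := by
      rw [show (2 * r / R ^ 2) ^ 2 = 4 * (r ^ 2 / R ^ 2) / R ^ 2 by field_simp; ring,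
        div_le_iff₀ hR0]
      linarith
    gcongr
  have u2 : |P1 * (2 / R ^ 2)| ≤ C * 2 := by
    rw [abs_mul, abs_of_nonneg (by positivity : 0 ≤ 2 / R ^ 2)]
    have : 2 / R ^ 2 ≤ 2 := by rw [div_le_iff₀ hR0]; linarith
    gcongr
  have u3 : |2 * k / r * (P1 * (2 * r / R ^ 2))| ≤ C * (4 * k) := by
    rcases eq_or_ne r 0 with h0 | h0
    · rw [h0]; simp; positivity
    · rw [show 2 * k / r * (P1 * (2 * r / R ^ 2)) = P1 * (4 * k / R ^ 2) by
        field_simp; ring, abs_mul, abs_of_nonneg (by positivity : 0 ≤ 4 * k / R ^ 2)]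
      have : 4 * k / R ^ 2 ≤ 4 * k := by rw [div_le_iff₀ hR0]; nlinarith
      gcongr
  refine (abs_add_le _ _).trans ?_
  have := abs_add_le (P2 * (2 * r / R ^ 2) ^ 2) (P1 * (2 / R ^ 2))
  linarith

section Coordinates

variable {d : ℕ} {k : Fin d → ℝ} {E : Fin d → ℝ → ℝ}

lemma sum_sq_update (z : Fin d → ℝ) (j : Fin d) (r : ℝ) :
    ∑ i, Function.update z j r i ^ 2 = (∑ i ∈ Finset.univ.erase j, z i ^ 2) + r ^ 2 := by
  rw [← Finset.add_sum_erase _ _ (Finset.mem_univ j), Function.update_self, add_comm]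
  congr 1
  refine Finset.sum_congr rfl fun i hi => ?_
  rw [Function.update_of_ne (Finset.ne_of_mem_erase hi)]

lemma contDiff_radial {ψ : ℝ → ℝ} (hψ : ContDiff ℝ 2 ψ) (D : ℝ) :
    ContDiff ℝ 2 fun z : Fin d → ℝ => ψ ((∑ j, z j ^ 2) / D) :=
  hψ.comp ((ContDiff.sum fun j _ => (contDiff_apply ℝ ℝ j).pow 2).div_const D)

/-- The commutator of the squared Dunkl operator with a radial cutoff, applied to the kernel. -/
lemma abs_commutator_cutoff_le (hE : ∀ j, IsDunklKernel (k j) (E j)) (hk : ∀ j, 0 ≤ k j)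
    {ψ : ℝ → ℝ} (hψ : ContDiff ℝ 2 ψ)
    (hψ0 : ∀ v, v < 1 ∨ 2 < v → deriv ψ v = 0 ∧ deriv (deriv ψ) v = 0) {C : ℝ} (hC0 : 0 ≤ C)
    (hC : ∀ v, |deriv ψ v| ≤ C ∧ |deriv (deriv ψ) v| ≤ C) {R h : ℝ} (hR : 1 ≤ R) (hh : 0 < h)
    (x z : Fin d → ℝ) (j : Fin d)
    (hp : ContDiff ℝ 2 (prodHeat k E h x)) :
    |axisDunklSq k j (fun z => ψ ((∑ i, z i ^ 2) / R ^ 2) * prodHeat k E h x z) z -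
      ψ ((∑ i, z i ^ 2) / R ^ 2) * axisDunklSq k j (prodHeat k E h x) z| ≤
      if ∑ i, z i ^ 2 < R ^ 2 then 0 else
        C * ((10 + 4 * k j) + (8 + 2 * x j ^ 2) / h) * prodHeat k E h x z := by
  set c := ∑ i ∈ Finset.univ.erase j, z i ^ 2 with hc
  have hc0 : 0 ≤ c := Finset.sum_nonneg fun _ _ => sq_nonneg _
  set r := z j with hr
  have hN : ∑ i, z i ^ 2 = c + r ^ 2 := by
    conv_lhs => rw [← Function.update_eq_self j z]
    exact sum_sq_update z j (z j)
  set N := ∑ i, z i ^ 2 with hNdef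
  set f : ℝ → ℝ := fun r => ψ ((c + r ^ 2) / R ^ 2) with hf
  set g : ℝ → ℝ := fun r => prodHeat k E h x (Function.update z j r) with hg
  have hfs : ContDiff ℝ 2 f := hψ.comp (by fun_prop)
  have hgs : ContDiff ℝ 2 g := contDiff_comp_update hp z j
  have e1 : axisDunklSq k j (fun z => ψ ((∑ i, z i ^ 2) / R ^ 2) * prodHeat k E h x z) z =
      dunklSq (k j) (fun r => f r * g r) r := by
    simp only [axisDunklSq, sum_sq_update, hf, hg, ← hc, ← hr]
  have e2 : axisDunklSq k j (prodHeat k E h x) z = dunklSq (k j) g r := rfl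
  have e3 : g r = prodHeat k E h x z := by simp only [hg, hr, Function.update_eq_self]
  have hp0 : 0 < prodHeat k E h x z := prodHeat_pos hE hh x z
  -- The product rule for the even cutoff `f` leaves only `2 f' g'` and `g` times the operator
  -- applied to `f`.
  rw [e1, e2, dunklSq_mul_of_even (k j) hfs hgs (by simp [hf]), hN, e3]
  have hfr : ψ ((c + r ^ 2) / R ^ 2) = f r := rfl
  rw [hfr]
  have e4 : f r * dunklSq (k j) g r + 2 * deriv f r * deriv g r +
      dunklSq (k j) f r * prodHeat k E h x z - f r * dunklSq (k j) g r =
      2 * deriv f r * deriv g r + dunklSq (k j) f r * prodHeat k E h x z := by ring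
  rw [e4]
  have f1 : deriv f r = deriv ψ ((c + r ^ 2) / R ^ 2) * (2 * r / R ^ 2) :=
    (hasDerivAt_comp_add_sq (hψ.differentiable (by norm_num)) c (R ^ 2) r).deriv
  have f2 := deriv_deriv_comp_add_sq hψ c (R ^ 2) r
  have f3 := dunklSq_comp_add_sq (k j) ψ c (R ^ 2) r
  have g1 : |deriv g r| ≤ (|x j| + |r|) / (2 * h) * prodHeat k E h x z := by
    have : g = fun r => dunklHeat (k j) (E j) h (x j) r *
        ∏ i ∈ Finset.univ.erase j, dunklHeat (k i) (E i) h (x i) (z i) := by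
      ext r; exact prodHeat_update h x z j r
    rw [← e3, this, deriv_mul_const_field, abs_mul]
    have hP : 0 < ∏ i ∈ Finset.univ.erase j, dunklHeat (k i) (E i) h (x i) (z i) :=
      Finset.prod_pos fun i _ => (hE i).heat_pos hh _ _
    rw [abs_of_pos hP, ← mul_assoc]
    gcongr
    exact (hE j).abs_deriv_heat_le hh (x j) r
  have hR0 : 0 < R ^ 2 := by positivity
  by_cases hcase : (c + r ^ 2) / R ^ 2 < 1 ∨ 2 < (c + r ^ 2) / R ^ 2
  · rw [f3, f2, hf, f1, (hψ0 _ hcase).1, (hψ0 _ hcase).2]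
    have : 0 ≤ C * ((10 + 4 * k j) + (8 + 2 * x j ^ 2) / h) * prodHeat k E h x z := by
      have := hk j
      positivity
    split_ifs <;> simp [this]
  · push Not at hcase
    obtain ⟨hc1, hc2⟩ := hcase
    rw [if_neg (by rw [le_div_iff₀ hR0] at hc1; linarith)]
    have hr2 : r ^ 2 ≤ 2 * R ^ 2 := by
      rw [div_le_iff₀ hR0] at hc2; linarith
    have b1 := (hC ((c + r ^ 2) / R ^ 2)).1
    set P1 := deriv ψ ((c + r ^ 2) / R ^ 2)
    have hR1 : 1 ≤ R ^ 2 := one_le_pow₀ hR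
    have t1 : |2 * deriv f r * deriv g r| ≤ C * ((8 + 2 * x j ^ 2) / h) * prodHeat k E h x z := by
      have : |deriv f r| = |P1| * (2 * |r| / R ^ 2) := by
        rw [f1, abs_mul, abs_div, abs_mul, abs_two, abs_of_pos hR0]
      rw [abs_mul, abs_mul, abs_two, this]
      have q1 : |r| * (|x j| + |r|) / R ^ 2 ≤ 4 + x j ^ 2 := by
        rw [div_le_iff₀ hR0]
        have a1 : |r| * |x j| ≤ r ^ 2 + x j ^ 2 := by
          nlinarith [sq_nonneg (|r| - |x j|), sq_abs r, sq_abs (x j), sq_nonneg r,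
            sq_nonneg (x j)]
        have a2 : |r| * |r| = r ^ 2 := by rw [← sq, sq_abs]
        nlinarith [mul_nonneg (sq_nonneg (x j)) (sub_nonneg.2 hR1)]
      calc 2 * (|P1| * (2 * |r| / R ^ 2)) * |deriv g r|
          ≤ 2 * (C * (2 * |r| / R ^ 2)) * ((|x j| + |r|) / (2 * h) * prodHeat k E h x z) := by
            gcongr
        _ = C * (2 * (|r| * (|x j| + |r|) / R ^ 2) / h) * prodHeat k E h x z := by
            field_simp
        _ ≤ C * (2 * (4 + x j ^ 2) / h) * prodHeat k E h x z := by gcongr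
        _ = _ := by ring
    have t2 : |dunklSq (k j) f r| ≤ C * (10 + 4 * k j) :=
      abs_dunklSq_comp_add_sq_le (hk j) hψ hC0 hC hR hr2
    refine (abs_add_le _ _).trans ?_
    rw [abs_mul (dunklSq (k j) f r), abs_of_pos hp0]
    have := mul_le_mul_of_nonneg_right t2 hp0.le
    linarith

/-- Far out, the heat kernel is negligible compared with a heat kernel of a longer time. -/
lemma exists_forall_prodHeat_le (hE : ∀ j, IsDunklKernel (k j) (E j)) (hk : ∀ j, 0 ≤ k j)
    (x : Fin d → ℝ) {s η D c : ℝ} (hs : 0 < s) (hη : 0 < η) (hD : 0 ≤ D) (hc : 0 < c) :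
    ∃ R, 1 ≤ R ∧ ∀ h, 0 < h → h ≤ s → ∀ z : Fin d → ℝ, R ≤ ∑ j, z j ^ 2 →
      D / h * prodHeat k E h x z ≤ c * prodHeat k E (h + η) 0 z := by
  set a := ∑ j, (k j + 1 / 2) with ha_def
  have a0 : 0 ≤ a := Finset.sum_nonneg fun j _ => by linarith [hk j]
  -- Here `3κ ≤ η / (h + η)`, the share of the decay `N / (4h)` that the longer time `h + η` does
  -- not need. One `κ` pays for Young's inequality, one for the resulting term `X / κ`, and one
  -- remains to give smallness.
  set κ := η / (3 * (s + η)) with hκ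
  have hκ0 : 0 < κ := by positivity
  set X := ∑ j, x j ^ 2 with hX
  have hX0 : 0 ≤ X := Finset.sum_nonneg fun _ _ => sq_nonneg _
  have hTa : 0 < (s + η) ^ (-a) := Real.rpow_pos_of_pos (by positivity) _
  -- The exponent `a + 1` accounts for the factor `1 / h`; the `δ` contains `(s + η) ^ (-a)`, the
  -- least value of the other kernel's prefactor for `h ≤ s`.
  obtain ⟨R, hR1, hR⟩ := exists_forall_rpow_mul_exp_le (a := a + 1) (c := κ / 4) (t := s)
    (δ := c * (s + η) ^ (-a) / (D + 1)) (by linarith) (by positivity) hs (by positivity)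
  refine ⟨max R (X / κ ^ 2), le_max_of_le_left hR1, fun h hh hhs z hz => ?_⟩
  set N := ∑ j, z j ^ 2 with hN
  have hN1 : R ≤ N := (le_max_left _ _).trans hz
  have hN2 : X ≤ κ ^ 2 * N := by
    have := (le_max_right _ _).trans hz
    rw [div_le_iff₀ (by positivity)] at this
    linarith
  have hN0 : 0 ≤ N := by linarith
  have h1 := hR h hh hhs N hN1
  have h2 := prodHeat_le hE hh x z
  -- Young's inequality `2 |z j| |x j| ≤ κ |z j|² + |x j|² / κ`, summed.
  have h3 : (1 - κ) * N - X / κ + X ≤ ∑ j, (|z j| - |x j|) ^ 2 := by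
    have : (1 - κ) * N - X / κ + X = ∑ j, ((1 - κ) * z j ^ 2 - x j ^ 2 / κ + x j ^ 2) := by
      rw [Finset.sum_add_distrib, Finset.sum_sub_distrib, ← Finset.mul_sum, ← Finset.sum_div]
    rw [this]
    refine Finset.sum_le_sum fun j _ => ?_
    have e : (|z j| - |x j|) ^ 2 - ((1 - κ) * z j ^ 2 - x j ^ 2 / κ + x j ^ 2) =
        (κ * |z j| - |x j|) ^ 2 / κ := by
      field_simp
      linear_combination (κ - κ ^ 2) * sq_abs (z j) + (κ - 1) * sq_abs (x j)
    have : 0 ≤ (κ * |z j| - |x j|) ^ 2 / κ := by positivity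
    linarith
  have hXκ : X / κ ≤ κ * N := by
    rw [div_le_iff₀ hκ0]; linarith
  have h4 : (1 - 2 * κ) * N ≤ ∑ j, (|z j| - |x j|) ^ 2 := by linarith
  have h5 : N / (4 * (h + η)) + κ / 4 * N / h ≤ (1 - 2 * κ) * N / (4 * h) := by
    have : (1 - 2 * κ) * N / (4 * h) - (N / (4 * (h + η)) + κ / 4 * N / h) =
        N / (4 * h) * (η / (h + η) - 3 * κ) := by
      field_simp
      ring
    have h6 : 3 * κ ≤ η / (h + η) := by
      rw [hκ, show 3 * (η / (3 * (s + η))) = η / (s + η) by field_simp]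
      gcongr
    have : 0 ≤ N / (4 * h) * (η / (h + η) - 3 * κ) :=
      mul_nonneg (by positivity) (by linarith)
    linarith
  have h7 : exp (-(∑ j, (|z j| - |x j|) ^ 2) / (4 * h)) ≤
      exp (-N / (4 * (h + η))) * exp (-(κ / 4 * N / h)) := by
    rw [← exp_add]
    refine exp_le_exp.2 ?_
    have : (1 - 2 * κ) * N / (4 * h) ≤ (∑ j, (|z j| - |x j|) ^ 2) / (4 * h) := by gcongr
    rw [neg_div, neg_div]
    linarith
  have h8 : h ^ (-(a + 1)) = h ^ (-a) / h := by
    rw [neg_add, Real.rpow_add hh, Real.rpow_neg_one]; rfl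
  have h9 : (s + η) ^ (-a) ≤ (h + η) ^ (-a) :=
    Real.rpow_le_rpow_of_nonpos (by positivity) (by linarith) (by linarith)
  rw [prodHeat_zero hE (by positivity : 0 < h + η)]
  calc D / h * prodHeat k E h x z
      ≤ D / h * (h ^ (-a) * (exp (-N / (4 * (h + η))) * exp (-(κ / 4 * N / h)))) := by
        gcongr
        exact h2.trans (by gcongr)
    _ = D * (h ^ (-(a + 1)) * exp (-(κ / 4 * N / h))) * exp (-N / (4 * (h + η))) := by
        rw [h8]; ring
    _ ≤ (D + 1) * (c * (s + η) ^ (-a) / (D + 1)) * exp (-N / (4 * (h + η))) := by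
        gcongr
        linarith
    _ = c * ((s + η) ^ (-a) * exp (-N / (4 * (h + η)))) := by field_simp
    _ ≤ c * ((h + η) ^ (-a) * exp (-N / (4 * (h + η)))) := by gcongr

end Coordinates

/-! ### Representation of positive solutions and the Harnack inequality in coordinates. -/

section Coordinates

variable {d : ℕ} {k : Fin d → ℝ} {E : Fin d → ℝ → ℝ} {v : ℝ → (Fin d → ℝ) → ℝ} {T : ℝ}

lemma cutoff_eq_zero {ψ : ℝ → ℝ} (hψ2 : ∀ v, 2 ≤ v → ψ v = 0) {R : ℝ} (hR : 0 < R)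
    {z : Fin d → ℝ} (hz : 2 * R ≤ ‖z‖) : ψ ((∑ j, z j ^ 2) / R ^ 2) = 0 := by
  refine hψ2 _ ?_
  rw [le_div_iff₀ (by positivity)]
  nlinarith [sq_norm_le_sum_sq z]

/-- A positive solution of the Dunkl heat equation is represented by its values at an earlier
time. -/
theorem tendsto_integral_mul_cutoff_mul_prodHeat (hE : ∀ j, IsDunklKernel (k j) (E j))
    (hk : ∀ j, 0 ≤ k j)
    (hv : ContDiffOn ℝ 2 (fun p : ℝ × (Fin d → ℝ) => v p.1 p.2) (Set.Ioo 0 T ×ˢ Set.univ))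
    (hpos : ∀ τ ∈ Set.Ioo 0 T, ∀ z, 0 < v τ z)
    (heat : ∀ τ ∈ Set.Ioo 0 T, ∀ z : Fin d → ℝ, (∀ j, z j ≠ 0) →
      deriv (fun τ => v τ z) τ = coordDunklLap k (v τ) z)
    {ψ : ℝ → ℝ} (hψ : ContDiff ℝ 2 ψ) (hψ1 : ∀ v ≤ 1, ψ v = 1) (hψ2 : ∀ v, 2 ≤ v → ψ v = 0)
    (hψ0 : ∀ v, 0 ≤ ψ v) (hψle : ∀ v, ψ v ≤ 1)
    (hψd : ∀ v, v < 1 ∨ 2 < v → deriv ψ v = 0 ∧ deriv (deriv ψ) v = 0) {C : ℝ} (hC0 : 0 ≤ C)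
    (hC : ∀ v, |deriv ψ v| ≤ C ∧ |deriv (deriv ψ) v| ≤ C)
    {ε s : ℝ} (hε : 0 < ε) (hεs : ε < s) (hsT : s < T) (x : Fin d → ℝ) :
    Tendsto (fun R : ℝ => ∫ z, v ε z * (ψ ((∑ j, z j ^ 2) / R ^ 2) * prodHeat k E (s - ε) x z) *
      dunklWeight k z) atTop (𝓝 (v s x * prodMass k)) := by
  have hs : 0 < s := hε.trans hεs
  -- A time beyond `s` but before `T`: the moment bound at `t` controls integrals against the kernel
  -- of time `t - τ`, longer than `s - τ`.
  set t := (s + T) / 2 with ht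
  have hst : s < t := by rw [ht]; linarith
  have htT : t < T := by rw [ht]; linarith
  have hη : 0 < t - s := sub_pos.2 hst
  have hsub : Set.Ioo 0 s ⊆ Set.Ioo 0 T := Set.Ioo_subset_Ioo_right hsT.le
  have hvs := hv.mono (Set.prod_mono hsub (subset_refl Set.univ))
  set K := v t 0 * prodMass k with hK
  have hK0 : 0 < K := mul_pos (hpos t ⟨hs.trans hst, htT⟩ 0) (prodMass_pos hk)
  -- The sum of the commutator constants, put in the form `D / (s - τ)` by means of `s - τ ≤ s`.
  set D := ∑ j, C * ((10 + 4 * k j) * s + (8 + 2 * x j ^ 2)) with hD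
  have hD0 : 0 ≤ D := Finset.sum_nonneg fun j _ => by
    have := hk j
    positivity
  rw [Metric.tendsto_atTop]
  intro e he
  set c := e / (2 * (K * s)) with hc
  have hc0 : 0 < c := by positivity
  obtain ⟨R0, hR01, hR0⟩ := exists_forall_prodHeat_le hE hk x hs hη hD0 hc0
  refine ⟨max R0 (∑ j, x j ^ 2), fun R hR => ?_⟩
  have hRR0 : R0 ≤ R := (le_max_left _ _).trans hR
  have hR1 : 1 ≤ R := hR01.trans hRR0
  have hRsq : R ≤ R ^ 2 := by nlinarith
  set φ : ℝ → (Fin d → ℝ) → ℝ :=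
    fun τ z => ψ ((∑ j, z j ^ 2) / R ^ 2) * prodHeat k E (s - τ) x z with hφ
  have hφs : ContDiffOn ℝ 2 (fun p : ℝ × (Fin d → ℝ) => φ p.1 p.2) (Set.Ioo 0 s ×ˢ Set.univ) :=
    ((contDiff_radial hψ (R ^ 2)).comp contDiff_snd).contDiffOn.mul
      (contDiffOn_prodHeat_sub hE x 0 s)
  have hφ0 : ∀ τ ∈ Set.Ioo 0 s, ∀ z, 2 * R ≤ ‖z‖ → φ τ z = 0 := fun τ _ z hz => by
    simp only [hφ]
    rw [cutoff_eq_zero hψ2 (by linarith) hz, zero_mul]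
  have hder := fun τ (hτ : τ ∈ Set.Ioo 0 s) =>
    hasDerivAt_integral_mul_test hk hvs (fun σ hσ => heat σ (hsub hσ)) hφs (by linarith) hφ0 hτ
  -- The kernel solves the backward equation, so only the commutator with the cutoff survives. It
  -- vanishes inside radius `R`, is at most `c` times the longer kernel outside, and the moment
  -- bound integrates the latter to at most `K`.
  have hbound : ∀ τ ∈ Set.Ioo 0 s, ‖∫ z, v τ z * (deriv (fun τ => φ τ z) τ +
      coordDunklLap k (φ τ) z) * dunklWeight k z‖ ≤ c * K := by
    intro τ hτ
    have hh : 0 < s - τ := sub_pos.2 hτ.2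
    obtain ⟨hi, hle⟩ := integral_mul_prodHeat_zero_le hE hk hv hpos heat htT
      (τ := τ) ⟨hτ.1, hτ.2.trans hst⟩
    refine le_trans (norm_integral_le_of_norm_le (hi.const_mul c) ?_) ?_
    · filter_upwards [ae_forall_ne_zero] with z hz
      have hw0 := dunklWeight_nonneg k z
      have hv0 := hpos τ (hsub hτ) z
      have hp0 := prodHeat_pos hE hh x z
      have hps : ContDiff ℝ 2 (prodHeat k E (s - τ) x) :=
        contDiff_section (v := fun σ z => prodHeat k E (s - σ) x z)
          (contDiffOn_prodHeat_sub hE x 0 s) hτ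
      have h1 : deriv (fun τ => φ τ z) τ = ψ ((∑ j, z j ^ 2) / R ^ 2) *
          -coordDunklLap k (prodHeat k E (s - τ) x) z :=
        ((hasDerivAt_prodHeat_sub hE hτ.2 x hz).const_mul _).deriv
      have h2 : deriv (fun τ => φ τ z) τ + coordDunklLap k (φ τ) z =
          ∑ j, (axisDunklSq k j (φ τ) z -
            ψ ((∑ j, z j ^ 2) / R ^ 2) * axisDunklSq k j (prodHeat k E (s - τ) x) z) := by
        rw [h1, Finset.sum_sub_distrib, ← Finset.mul_sum]
        simp only [coordDunklLap]
        ring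
      have h3 : |deriv (fun τ => φ τ z) τ + coordDunklLap k (φ τ) z| ≤
          c * prodHeat k E (t - τ) 0 z := by
        rw [h2]
        refine (Finset.abs_sum_le_sum_abs _ _).trans ((Finset.sum_le_sum fun j _ =>
          abs_commutator_cutoff_le hE hk hψ hψd hC0 hC hR1 hh x z j hps).trans ?_)
        by_cases hN : ∑ i, z i ^ 2 < R ^ 2
        · simp only [if_pos hN, Finset.sum_const_zero]
          exact mul_nonneg hc0.le (prodHeat_pos hE (by linarith) 0 z).le
        · simp only [if_neg hN]
          have h4 := hR0 (s - τ) hh (by linarith [hτ.1]) z (by linarith)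
          rw [show s - τ + (t - s) = t - τ by ring] at h4
          refine le_trans ?_ h4
          rw [← Finset.sum_mul, hD, Finset.sum_div]
          refine mul_le_mul_of_nonneg_right (Finset.sum_le_sum fun j _ => ?_) hp0.le
          have hkj := hk j
          have h5 : 10 + 4 * k j ≤ (10 + 4 * k j) * s / (s - τ) := by
            rw [le_div_iff₀ hh]
            nlinarith [hτ.1]
          calc C * ((10 + 4 * k j) + (8 + 2 * x j ^ 2) / (s - τ))
              ≤ C * ((10 + 4 * k j) * s / (s - τ) + (8 + 2 * x j ^ 2) / (s - τ)) := by gcongr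
            _ = _ := by ring
      rw [norm_mul, norm_mul, Real.norm_of_nonneg hw0, Real.norm_of_nonneg hv0.le,
        Real.norm_eq_abs]
      calc v τ z * |deriv (fun τ => φ τ z) τ + coordDunklLap k (φ τ) z| * dunklWeight k z
          ≤ v τ z * (c * prodHeat k E (t - τ) 0 z) * dunklWeight k z := by gcongr
        _ = _ := by ring
    · rw [integral_const_mul]
      gcongr
  have hlip : ∀ τ ∈ Set.Ioo 0 s, |(∫ z, v τ z * φ τ z * dunklWeight k z) -
      ∫ z, v ε z * φ ε z * dunklWeight k z| ≤ c * K * s := by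
    intro τ hτ
    have h1 := (convex_Ioo 0 s).norm_image_sub_le_of_norm_hasDerivWithin_le
      (fun τ hτ => (hder τ hτ).hasDerivWithinAt) hbound ⟨hε, hεs⟩ hτ
    rw [Real.norm_eq_abs, Real.norm_eq_abs] at h1
    refine h1.trans ?_
    have : |τ - ε| ≤ s := abs_le.2 ⟨by linarith [hτ.1], by linarith [hτ.2]⟩
    gcongr
  have hlim := tendsto_integral_mul_mul_prodHeat hE hk hv ⟨hs, hsT⟩ x
    (χ := fun z => ψ ((∑ j, z j ^ 2) / R ^ 2))
    (contDiff_radial hψ (R ^ 2)).continuous.measurable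
    (contDiff_radial hψ (R ^ 2)).continuous.continuousAt (A := 2 * R)
    (fun z hz => cutoff_eq_zero hψ2 (by linarith) hz.le)
    (fun z => abs_le.2 ⟨by linarith [hψ0 ((∑ j, z j ^ 2) / R ^ 2)], hψle _⟩)
  rw [hψ1 ((∑ j, x j ^ 2) / R ^ 2) (by
    rw [div_le_one (by positivity)]
    exact ((le_max_right _ _).trans hR).trans hRsq), mul_one] at hlim
  -- Let `τ` increase to `s`: the pairing tends to `v s x * prodMass k`, since the cutoff equals `1`
  -- at `x` for this `R`.
  have hfin : |v s x * prodMass k - ∫ z, v ε z * φ ε z * dunklWeight k z| ≤ c * K * s := by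
    refine le_of_tendsto ((hlim.sub_const _).abs) ?_
    filter_upwards [Ioo_mem_nhdsLT hs] with τ hτ
    have := hlip τ hτ
    simp only [hφ, ← mul_assoc] at this ⊢
    exact this
  rw [dist_comm, Real.dist_eq]
  refine hfin.trans_lt ?_
  have : c * K * s = e / 2 := by rw [hc]; field_simp
  linarith

/-- The Harnack inequality for positive solutions of the Dunkl heat equation, in coordinates in
which the reflections are sign changes. -/
theorem coord_harnack (hk : ∀ j, 0 ≤ k j)
    (hv : ContDiffOn ℝ 2 (fun p : ℝ × (Fin d → ℝ) => v p.1 p.2) (Set.Ioo 0 T ×ˢ Set.univ))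
    (hpos : ∀ τ ∈ Set.Ioo 0 T, ∀ z, 0 < v τ z)
    (heat : ∀ τ ∈ Set.Ioo 0 T, ∀ z : Fin d → ℝ, (∀ j, z j ≠ 0) →
      deriv (fun τ => v τ z) τ = coordDunklLap k (v τ) z)
    {s t : ℝ} (hs : 0 < s) (hst : s < t) (htT : t < T) (x y : Fin d → ℝ) :
    v s x ≤ v t y * ((t / s) ^ (∑ j, (k j + 1 / 2)) *
      exp ((∑ j, (x j - y j) ^ 2) / (4 * (t - s)))) := by
  choose E hE using fun j => exists_isDunklKernel (hk j)
  obtain ⟨ψ, hψ, hψ1, hψ2, hψ0, hψle, hψd, C, hC0, hC⟩ := exists_cutoff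
  have hm := prodMass_pos hk
  have hint : ∀ ε, 0 < ε → ε < T → ∀ r, ε < r → ∀ R, 0 < R → ∀ x, Integrable fun z =>
      v ε z * (ψ ((∑ j, z j ^ 2) / R ^ 2) * prodHeat k E (r - ε) x z) * dunklWeight k z := by
    intro ε hε hεT r hr R hR x
    have hc : Continuous fun z =>
        v ε z * (ψ ((∑ j, z j ^ 2) / R ^ 2) * prodHeat k E (r - ε) x z) :=
      (contDiff_section hv ⟨hε, hεT⟩).continuous.mul
        ((contDiff_radial hψ (R ^ 2)).continuous.mul
          (contDiff_section (v := fun σ z => prodHeat k E (r - σ) x z)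
            (contDiffOn_prodHeat_sub hE x 0 r) ⟨hε, hr⟩).continuous)
    obtain ⟨M, hM⟩ := (isCompact_closedBall (0 : Fin d → ℝ) (2 * R)).exists_bound_of_continuousOn
      hc.continuousOn
    exact integrable_of_bounded_of_support hk hc.aestronglyMeasurable
      (fun z hz => hM z (mem_closedBall_zero_iff.2 hz))
      (fun z hz => by rw [cutoff_eq_zero hψ2 hR hz.le, zero_mul, mul_zero])
  -- Both values are represented by the same data `v ε` with the same cutoff, so the kernel
  -- inequality passes to the integrals. The time difference `t - s` does not involve `ε`.
  have key : ∀ ε ∈ Set.Ioo 0 s, v s x ≤ v t y * (((t - ε) / (s - ε)) ^ (∑ j, (k j + 1 / 2)) *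
      exp ((∑ j, (x j - y j) ^ 2) / (4 * (t - s)))) := by
    intro ε hε
    have hεT : ε < T := hε.2.trans (hst.trans htT)
    set B := ((t - ε) / (s - ε)) ^ (∑ j, (k j + 1 / 2)) *
      exp ((∑ j, (x j - y j) ^ 2) / (4 * (t - s))) with hB
    have l1 := tendsto_integral_mul_cutoff_mul_prodHeat hE hk hv hpos heat hψ hψ1 hψ2 hψ0 hψle hψd
      hC0 hC hε.1 hε.2 (hst.trans htT) x
    have l2 := (tendsto_integral_mul_cutoff_mul_prodHeat hE hk hv hpos heat hψ hψ1 hψ2 hψ0 hψle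
      hψd hC0 hC hε.1 (hε.2.trans hst) htT y).mul_const B
    have hle : v s x * prodMass k ≤ v t y * prodMass k * B := by
      refine le_of_tendsto_of_tendsto l1 l2 ?_
      filter_upwards [eventually_gt_atTop 0] with R hR
      rw [← integral_mul_const]
      refine integral_mono (hint ε hε.1 hεT s hε.2 R hR x)
        ((hint ε hε.1 hεT t (hε.2.trans hst) R hR y).mul_const B) fun z => ?_
      have h1 := prodHeat_harnack hE (sub_pos.2 hε.2) (by linarith : s - ε < t - ε) x y z
      rw [show t - ε - (s - ε) = t - s by ring, ← hB] at h1
      have h2 := hψ0 ((∑ j, z j ^ 2) / R ^ 2)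
      have h3 := (hpos ε ⟨hε.1, hεT⟩ z).le
      have h4 := dunklWeight_nonneg k z
      calc v ε z * (ψ ((∑ j, z j ^ 2) / R ^ 2) * prodHeat k E (s - ε) x z) * dunklWeight k z
          ≤ v ε z * (ψ ((∑ j, z j ^ 2) / R ^ 2) * (prodHeat k E (t - ε) y z * B)) *
            dunklWeight k z := by gcongr
        _ = _ := by ring
    refine le_of_mul_le_mul_right (hle.trans (le_of_eq ?_)) hm
    ring
  have hlim : Tendsto (fun ε => v t y * (((t - ε) / (s - ε)) ^ (∑ j, (k j + 1 / 2)) *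
      exp ((∑ j, (x j - y j) ^ 2) / (4 * (t - s))))) (𝓝[>] 0)
      (𝓝 (v t y * (((t - 0) / (s - 0)) ^ (∑ j, (k j + 1 / 2)) *
      exp ((∑ j, (x j - y j) ^ 2) / (4 * (t - s)))))) := by
    have hc : ContinuousAt (fun ε => (t - ε) / (s - ε)) 0 :=
      ContinuousAt.div (by fun_prop) (by fun_prop) (by simpa using hs.ne')
    have h0 : (t - 0) / (s - 0) ≠ 0 := by
      rw [sub_zero, sub_zero]; exact (div_pos (hs.trans hst) hs).ne'
    have := (continuousAt_const (y := v t y)).mul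
      ((hc.rpow_const (p := ∑ j, (k j + 1 / 2)) (Or.inl h0)).mul
        (continuousAt_const (y := exp ((∑ j, (x j - y j) ^ 2) / (4 * (t - s))))))
    exact this.tendsto.mono_left nhdsWithin_le_nhds
  rw [sub_zero, sub_zero] at hlim
  refine ge_of_tendsto hlim ?_
  filter_upwards [Ioo_mem_nhdsGT hs] with ε hε using key ε hε

end Coordinates

/-! ### Reduction of the root system to sign changes of coordinates. -/

section RootSystem

variable {d : ℕ}

lemma reflection_orthogonal_singleton (u x : EuclideanSpace ℝ (Fin d)) :
    (Submodule.span ℝ {u})ᗮ.reflection x = x - (2 * (inner ℝ u x / ‖u‖ ^ 2)) • u := by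
  rw [Submodule.reflection_orthogonal_apply, Submodule.reflection_singleton_apply]
  simp [two_smul, two_mul, add_smul]

/-- If the reflection group is commutative, distinct positive roots are orthogonal. -/
lemma inner_eq_zero_of_commute {R P : Finset (EuclideanSpace ℝ (Fin d))} (hR : IsRootSystem R)
    (hP : IsPositiveSubsystem R P)
    (hG : ∀ g ∈ reflectionGroup R, ∀ h ∈ reflectionGroup R, g * h = h * g)
    {α β : EuclideanSpace ℝ (Fin d)} (hα : α ∈ P) (hβ : β ∈ P) (hne : α ≠ β) :
    inner ℝ α β = 0 := by
  have hαR : α ∈ R := (hP.mem_iff α).2 (Or.inl hα)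
  have hβR : β ∈ R := (hP.mem_iff β).2 (Or.inl hβ)
  have hmem : ∀ γ ∈ R, (Submodule.span ℝ {γ})ᗮ.reflection ∈ reflectionGroup R := fun γ hγ =>
    Subgroup.subset_closure ⟨γ, hγ, rfl⟩
  -- This says `r_α (r_β α) = -r_β α`, so `r_β α = α - q β` is a multiple of `α`, where `q` is the
  -- inner product. If `q ≠ 0`, then `β` lies on the line of `α`, hence `β = ±α`, which is excluded.
  have hc := DFunLike.congr_fun (hG _ (hmem α hαR) _ (hmem β hβR)) α
  rw [LinearIsometryEquiv.coe_mul, LinearIsometryEquiv.coe_mul, Function.comp_apply,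
    Function.comp_apply, Submodule.reflection_orthogonalComplement_singleton_eq_neg, map_neg] at hc
  simp only [reflection_orthogonal_singleton, hR.norm_sq α hαR, hR.norm_sq β hβR] at hc
  by_contra h0
  have h0' : inner ℝ β α ≠ 0 := by rwa [real_inner_comm]
  have h1 : (2 * (inner ℝ β α / 2)) • β = (2 - inner ℝ α (α - (2 * (inner ℝ β α / 2)) • β)) • α
      + (2 * (inner ℝ β α / 2)) • β - (2 - inner ℝ α (α - (2 * (inner ℝ β α / 2)) • β)) • α := by
    abel
  set a := inner ℝ α (α - (2 * (inner ℝ β α / 2)) • β) with ha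
  set q := inner ℝ β α with hq
  have h2 : q • β = (1 - a / 2) • α := by
    have h3 : (2 : ℝ) • (q • β) = (2 : ℝ) • ((1 - a / 2) • α) := by
      have e1 : (2 * (q / 2)) = q := by ring
      have e2 : (2 * (a / 2)) = a := by ring
      rw [e1, e2] at hc
      have : (2 : ℝ) • (q • β) = (2 : ℝ) • α - a • α + ((2 : ℝ) • (q • β) - ((2 : ℝ) • α - a • α)) := by
        abel
      rw [this]
      have hz : (2 : ℝ) • (q • β) - ((2 : ℝ) • α - a • α) = 0 := by
        have : (2 : ℝ) • (q • β) - ((2 : ℝ) • α - a • α) =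
            -(α - q • β) - (α - q • β - a • α) := by
          rw [two_smul, two_smul]; abel
        rw [this, hc, sub_self]
      rw [hz, add_zero, smul_smul, ← sub_smul]
      congr 1; ring
    exact smul_right_injective _ (two_ne_zero : (2 : ℝ) ≠ 0) h3
  have h3 : β = (q⁻¹ * (1 - a / 2)) • α := by
    rw [mul_smul, ← h2, smul_smul, inv_mul_cancel₀ h0', one_smul]
  have h4 : β ∈ ({α, -α} : Set (EuclideanSpace ℝ (Fin d))) := by
    rw [← hR.line_inter α hαR]
    exact ⟨⟨_, h3⟩, hβR⟩
  rcases h4 with h4 | h4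
  · exact hne h4.symm
  · exact hP.neg_notMem α hα ((Set.mem_singleton_iff.1 h4) ▸ hβ)

/-- Pairwise orthogonal roots of length `√2` are the multiples of members of an orthonormal
basis. -/
lemma exists_orthonormalBasis_of_orthogonal {P : Finset (EuclideanSpace ℝ (Fin d))}
    (hn : ∀ α ∈ P, ‖α‖ ^ 2 = 2) (ho : ∀ α ∈ P, ∀ β ∈ P, α ≠ β → inner ℝ α β = 0) :
    ∃ b : OrthonormalBasis (Fin d) ℝ (EuclideanSpace ℝ (Fin d)), ∀ α ∈ P, ∃ j, α = √2 • b j := by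
  classical
  have hs : (√2 : ℝ) ≠ 0 := by positivity
  have hs2 : (√2)⁻¹ * (√2)⁻¹ = (2 : ℝ)⁻¹ := by
    rw [← mul_inv, Real.mul_self_sqrt (by norm_num)]
  set V : Set (EuclideanSpace ℝ (Fin d)) := (fun α => (√2)⁻¹ • α) '' (P : Set _) with hV
  have hon : Orthonormal ℝ (Subtype.val : V → EuclideanSpace ℝ (Fin d)) := by
    rw [orthonormal_subtype_iff_ite]
    rintro _ ⟨α, hα, rfl⟩ _ ⟨β, hβ, rfl⟩
    simp only [real_inner_smul_left, real_inner_smul_right, ← mul_assoc, hs2]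
    by_cases h : α = β
    · subst h
      rw [if_pos rfl, real_inner_self_eq_norm_sq, hn α hα]; norm_num
    · rw [if_neg (fun h' => h (smul_right_injective _ (inv_ne_zero hs) h')), ho α hα β hβ h,
        mul_zero]
  obtain ⟨U, b₀, hVU, hb₀⟩ := hon.exists_orthonormalBasis_extension
  have hcard : Fintype.card U = d := by
    rw [← Module.finrank_eq_card_basis b₀.toBasis, finrank_euclideanSpace_fin]
  refine ⟨b₀.reindex (Fintype.equivFinOfCardEq hcard), fun α hα => ?_⟩
  have hmem : (√2)⁻¹ • α ∈ U := hVU ⟨α, hα, rfl⟩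
  refine ⟨Fintype.equivFinOfCardEq hcard ⟨_, hmem⟩, ?_⟩
  rw [OrthonormalBasis.reindex_apply, Equiv.symm_apply_apply, hb₀, smul_smul,
    mul_inv_cancel₀ hs, one_smul]

/-- Basis directions that carry no positive root receive multiplicity zero, so sums over roots
become sums over all coordinates. -/
lemma exists_coord_multiplicity {P : Finset (EuclideanSpace ℝ (Fin d))}
    {κ : EuclideanSpace ℝ (Fin d) → ℝ} (hκ : ∀ α ∈ P, 0 ≤ κ α)
    (b : OrthonormalBasis (Fin d) ℝ (EuclideanSpace ℝ (Fin d)))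
    (hb : ∀ α ∈ P, ∃ j, α = √2 • b j) :
    ∃ k : Fin d → ℝ, (∀ j, 0 ≤ k j) ∧
      ∀ F : EuclideanSpace ℝ (Fin d) → ℝ, ∑ α ∈ P, κ α * F α = ∑ j, k j * F (√2 • b j) := by
  classical
  have hs : (√2 : ℝ) ≠ 0 := by positivity
  have hinj : Function.Injective fun j => √2 • b j :=
    (smul_right_injective _ hs).comp b.orthonormal.linearIndependent.injective
  refine ⟨fun j => if √2 • b j ∈ P then κ (√2 • b j) else 0, fun j => ?_, fun F => ?_⟩
  · dsimp only
    split_ifs with h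
    · exact hκ _ h
    · exact le_rfl
  · have himg : P = (Finset.univ.filter fun j => √2 • b j ∈ P).image fun j => √2 • b j := by
      ext α
      simp only [Finset.mem_image, Finset.mem_filter, Finset.mem_univ, true_and]
      constructor
      · intro hα
        obtain ⟨j, rfl⟩ := hb α hα
        exact ⟨j, hα, rfl⟩
      · rintro ⟨j, hj, rfl⟩
        exact hj
    conv_lhs => rw [himg]
    rw [Finset.sum_image hinj.injOn, Finset.sum_filter]
    refine Finset.sum_congr rfl fun j _ => ?_
    rw [ite_mul, zero_mul]

/-- The Dunkl operator in the direction of the basis vector `b j`, off the reflecting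
hyperplanes. -/
noncomputable def axisDunkl (b : OrthonormalBasis (Fin d) ℝ (EuclideanSpace ℝ (Fin d)))
    (k : Fin d → ℝ) (j : Fin d) (f : EuclideanSpace ℝ (Fin d) → ℝ)
    (x : EuclideanSpace ℝ (Fin d)) : ℝ :=
  fderiv ℝ f x (b j) +
    k j / inner ℝ (b j) x * (f x - f ((Submodule.span ℝ {b j})ᗮ.reflection x))

variable (b : OrthonormalBasis (Fin d) ℝ (EuclideanSpace ℝ (Fin d))) (k : Fin d → ℝ)

lemma reflection_basis (j : Fin d) (x : EuclideanSpace ℝ (Fin d)) :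
    (Submodule.span ℝ {b j})ᗮ.reflection x = x - (2 * inner ℝ (b j) x) • b j := by
  rw [reflection_orthogonal_singleton, b.norm_eq_one]; simp

lemma inner_basis_reflection_ne_zero {x : EuclideanSpace ℝ (Fin d)}
    (hx : ∀ i, inner ℝ (b i) x ≠ 0) (j i : Fin d) :
    inner ℝ (b i) ((Submodule.span ℝ {b j})ᗮ.reflection x) ≠ 0 := by
  rw [reflection_basis, inner_sub_right, real_inner_smul_right, b.inner_eq_ite]
  rcases eq_or_ne i j with rfl | h
  · rw [if_pos rfl]
    have := hx i
    intro h
    apply this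
    linarith
  · rw [if_neg h, mul_zero, sub_zero]
    exact hx i

lemma isOpen_regular : IsOpen {x : EuclideanSpace ℝ (Fin d) | ∀ i, inner ℝ (b i) x ≠ 0} := by
  rw [Set.ofPred_forall]
  exact isOpen_iInter_of_finite fun i =>
    isOpen_ne_fun (continuous_const.inner continuous_id) continuous_const

variable {b k} {P : Finset (EuclideanSpace ℝ (Fin d))} {κ : EuclideanSpace ℝ (Fin d) → ℝ}

/-- The operator is linear in `ξ`. The factor `√2` cancels in `⟨α, ξ⟩ / ⟨α, x⟩`, and a reflection
depends only on the line of its root. -/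
lemma dunklOperator_eq_sum_axisDunkl
    (hk : ∀ F : EuclideanSpace ℝ (Fin d) → ℝ, ∑ α ∈ P, κ α * F α = ∑ j, k j * F (√2 • b j))
    (ξ : EuclideanSpace ℝ (Fin d)) (f : EuclideanSpace ℝ (Fin d) → ℝ)
    {x : EuclideanSpace ℝ (Fin d)} (hx : ∀ i, inner ℝ (b i) x ≠ 0) :
    dunklOperator P κ ξ f x = ∑ j, inner ℝ (b j) ξ * axisDunkl b k j f x := by
  have hs : (√2 : ℝ) ≠ 0 := by positivity
  have h1 : fderiv ℝ f x ξ = ∑ j, inner ℝ (b j) ξ * fderiv ℝ f x (b j) := by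
    conv_lhs => rw [← b.sum_repr' ξ]
    simp [map_sum]
  rw [dunklOperator, h1]
  simp only [mul_assoc]
  rw [hk, ← Finset.sum_add_distrib]
  refine Finset.sum_congr rfl fun j _ => ?_
  have hrefl : (Submodule.span ℝ {√2 • b j})ᗮ.reflection x =
      (Submodule.span ℝ {b j})ᗮ.reflection x := by
    simp only [Submodule.span_singleton_smul_eq (IsUnit.mk0 _ hs)]
  have hne : inner ℝ (√2 • b j) x ≠ 0 := by
    rw [real_inner_smul_left]; exact mul_ne_zero hs (hx j)
  rw [dunklQuotient, if_neg hne, hrefl, axisDunkl, real_inner_smul_left, real_inner_smul_left]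
  have := hx j
  field_simp

/-- The regular set is open and stable under the reflections, so an identity valid only there may be
substituted inside a further Dunkl operator. -/
lemma axisDunkl_congr {f g : EuclideanSpace ℝ (Fin d) → ℝ}
    (h : ∀ x, (∀ i, inner ℝ (b i) x ≠ 0) → f x = g x) (j : Fin d)
    {x : EuclideanSpace ℝ (Fin d)} (hx : ∀ i, inner ℝ (b i) x ≠ 0) :
    axisDunkl b k j f x = axisDunkl b k j g x := by
  have ev : f =ᶠ[𝓝 x] g := by
    filter_upwards [(isOpen_regular b).mem_nhds hx] with y hy using h y hy
  rw [axisDunkl, axisDunkl, ev.fderiv_eq, h x hx, h _ (inner_basis_reflection_ne_zero b hx j)]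

lemma axisDunkl_sum {f : Fin d → EuclideanSpace ℝ (Fin d) → ℝ} (c : Fin d → ℝ) (j : Fin d)
    {x : EuclideanSpace ℝ (Fin d)} (hf : ∀ i, DifferentiableAt ℝ (f i) x) :
    axisDunkl b k j (fun y => ∑ i, c i * f i y) x = ∑ i, c i * axisDunkl b k j (f i) x := by
  have h1 : fderiv ℝ (fun y => ∑ i, c i * f i y) x = ∑ i, c i • fderiv ℝ (f i) x := by
    rw [fderiv_fun_sum fun i _ => (hf i).const_mul (c i)]
    exact Finset.sum_congr rfl fun i _ => fderiv_const_mul (hf i) (c i)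
  rw [axisDunkl, h1]
  simp only [axisDunkl, sum_apply, smul_apply,
    smul_eq_mul, ← Finset.sum_sub_distrib, Finset.mul_sum, ← Finset.sum_add_distrib]
  exact Finset.sum_congr rfl fun i _ => by ring

lemma differentiableAt_axisDunkl {f : EuclideanSpace ℝ (Fin d) → ℝ} (hf : ContDiff ℝ 2 f)
    (j : Fin d) {x : EuclideanSpace ℝ (Fin d)} (hx : ∀ i, inner ℝ (b i) x ≠ 0) :
    DifferentiableAt ℝ (axisDunkl b k j f) x := by
  have h1 : Differentiable ℝ fun x => fderiv ℝ f x (b j) :=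
    ((hf.fderiv_right (m := 1) (by norm_num)).clm_apply contDiff_const).differentiable
      (by norm_num)
  have h2 : Differentiable ℝ f := hf.differentiable (by norm_num)
  have h3 : Differentiable ℝ fun x => f ((Submodule.span ℝ {b j})ᗮ.reflection x) :=
    h2.comp (Submodule.span ℝ {b j})ᗮ.reflection.differentiable
  have h4 : DifferentiableAt ℝ (fun x => inner ℝ (b j) x) x :=
    (differentiableAt_const _).inner ℝ differentiableAt_id
  have h5 : DifferentiableAt ℝ (fun x : EuclideanSpace ℝ (Fin d) => k j / inner ℝ (b j) x) x := by
    simp only [div_eq_mul_inv]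
    exact (h4.inv (hx j)).const_mul (k j)
  exact (h1 x).add (h5.mul ((h2 x).sub (h3 x)))

/-- The Laplacian does not depend on the orthonormal basis: by Parseval the coefficients of the
mixed terms `(l, j)` sum over `i` to `⟨b l, b j⟩`, so no commutation of the operators is needed. -/
lemma dunklLaplacian_eq_sum_axisDunkl
    (hk : ∀ F : EuclideanSpace ℝ (Fin d) → ℝ, ∑ α ∈ P, κ α * F α = ∑ j, k j * F (√2 • b j))
    {f : EuclideanSpace ℝ (Fin d) → ℝ} (hf : ContDiff ℝ 2 f)
    {x : EuclideanSpace ℝ (Fin d)} (hx : ∀ i, inner ℝ (b i) x ≠ 0) :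
    dunklLaplacian P κ f x = ∑ j, axisDunkl b k j (axisDunkl b k j f) x := by
  set e := EuclideanSpace.basisFun (Fin d) ℝ with he
  have h1 : ∀ i, dunklOperator P κ (EuclideanSpace.single i 1)
      (dunklOperator P κ (EuclideanSpace.single i 1) f) x =
      ∑ l, ∑ j, inner ℝ (b l) (e i) * inner ℝ (e i) (b j) *
        axisDunkl b k l (axisDunkl b k j f) x := by
    intro i
    rw [dunklOperator_eq_sum_axisDunkl hk _ _ hx]
    refine Finset.sum_congr rfl fun l _ => ?_
    rw [axisDunkl_congr (fun y hy => dunklOperator_eq_sum_axisDunkl hk _ _ hy) l hx,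
      axisDunkl_sum _ l fun j => differentiableAt_axisDunkl hf j hx, Finset.mul_sum]
    refine Finset.sum_congr rfl fun j _ => ?_
    rw [he, EuclideanSpace.basisFun_apply, real_inner_comm (b j), mul_assoc]
  rw [dunklLaplacian, Finset.sum_congr rfl fun i _ => h1 i, Finset.sum_comm]
  refine Finset.sum_congr rfl fun l _ => ?_
  rw [Finset.sum_comm]
  simp only [← Finset.sum_mul, e.sum_inner_mul_inner, b.inner_eq_ite, ite_mul, one_mul, zero_mul,
    Finset.sum_ite_eq, Finset.mem_univ, if_true]

/-- The vector with coordinates `z` in the basis `b`. -/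
noncomputable def ofCoord (b : OrthonormalBasis (Fin d) ℝ (EuclideanSpace ℝ (Fin d)))
    (z : Fin d → ℝ) : EuclideanSpace ℝ (Fin d) := ∑ i, z i • b i

lemma inner_ofCoord (z : Fin d → ℝ) (j : Fin d) : inner ℝ (b j) (ofCoord b z) = z j :=
  b.orthonormal.inner_right_fintype z j

lemma ofCoord_inner (x : EuclideanSpace ℝ (Fin d)) : ofCoord b (fun i => inner ℝ (b i) x) = x :=
  b.sum_repr' x

lemma contDiff_ofCoord : ContDiff ℝ 2 (ofCoord b) :=
  ContDiff.sum fun i _ => (contDiff_apply ℝ ℝ i).smul contDiff_const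

lemma ofCoord_update (z : Fin d → ℝ) (j : Fin d) (r : ℝ) :
    ofCoord b (Function.update z j r) = ofCoord b z + (r - z j) • b j := by
  refine b.repr.injective (PiLp.ext fun i => ?_)
  rw [b.repr_apply_apply, b.repr_apply_apply, inner_add_right, real_inner_smul_right, inner_ofCoord,
    inner_ofCoord, b.inner_eq_ite]
  rcases eq_or_ne i j with rfl | h
  · simp
  · rw [Function.update_of_ne h, if_neg h]; simp

lemma reflection_ofCoord_update (z : Fin d → ℝ) (j : Fin d) (r : ℝ) :
    (Submodule.span ℝ {b j})ᗮ.reflection (ofCoord b (Function.update z j r)) =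
      ofCoord b (Function.update z j (-r)) := by
  rw [reflection_basis, inner_ofCoord, Function.update_self, ofCoord_update, ofCoord_update,
    add_sub_assoc, ← sub_smul]
  congr 2
  ring

lemma hasDerivAt_ofCoord_update (z : Fin d → ℝ) (j : Fin d) (r : ℝ) :
    HasDerivAt (fun r => ofCoord b (Function.update z j r)) (b j) r := by
  have : (fun r => ofCoord b (Function.update z j r)) =
      fun r => ofCoord b z + (r - z j) • b j := funext fun r => ofCoord_update z j r
  rw [this]
  simpa using (((hasDerivAt_id r).sub_const (z j)).smul_const (b j)).const_add (ofCoord b z)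

lemma axisDunkl_ofCoord_update {f : EuclideanSpace ℝ (Fin d) → ℝ} (z : Fin d → ℝ) (j : Fin d)
    (r : ℝ) (hf : DifferentiableAt ℝ f (ofCoord b (Function.update z j r))) :
    axisDunkl b k j f (ofCoord b (Function.update z j r)) =
      deriv (fun r => f (ofCoord b (Function.update z j r))) r +
        k j / r * (f (ofCoord b (Function.update z j r)) -
          f (ofCoord b (Function.update z j (-r)))) := by
  have h1 : HasDerivAt (fun r => f (ofCoord b (Function.update z j r))) _ r :=
    hf.hasFDerivAt.comp_hasDerivAt r (hasDerivAt_ofCoord_update z j r)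
  rw [axisDunkl, h1.deriv, inner_ofCoord, Function.update_self, reflection_ofCoord_update]

/-- Restricted to a coordinate line, the operator is `g' + (k / r) (g(r) - g(-r))`. The second
summand is even in `r`, so the second application produces no `k²` term and the square is `dunklSq`.
-/
lemma axisDunkl_axisDunkl_ofCoord {f : EuclideanSpace ℝ (Fin d) → ℝ} (hf : ContDiff ℝ 2 f)
    {z : Fin d → ℝ} (hz : ∀ i, z i ≠ 0) (j : Fin d) :
    axisDunkl b k j (axisDunkl b k j f) (ofCoord b z) =
      axisDunklSq k j (fun z => f (ofCoord b z)) z := by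
  have df : Differentiable ℝ f := hf.differentiable (by norm_num)
  set g : ℝ → ℝ := fun r => f (ofCoord b (Function.update z j r)) with hg
  have hgs : ContDiff ℝ 2 g := hf.comp (contDiff_ofCoord.comp (contDiff_update 2 z j))
  have dg : Differentiable ℝ g := hgs.differentiable (by norm_num)
  have dg' : Differentiable ℝ (deriv g) :=
    ((contDiff_succ_iff_deriv (n := 1)).1 hgs).2.2.differentiable (by norm_num)
  have hx : ∀ i, inner ℝ (b i) (ofCoord b z) ≠ 0 := fun i => by rw [inner_ofCoord]; exact hz i
  have h1 : ∀ r, axisDunkl b k j f (ofCoord b (Function.update z j r)) =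
      deriv g r + k j / r * (g r - g (-r)) := fun r => axisDunkl_ofCoord_update z j r (df _)
  have h2 := axisDunkl_ofCoord_update (b := b) (k := k) (f := axisDunkl b k j f) z j (z j) (by
    rw [Function.update_eq_self]; exact differentiableAt_axisDunkl hf j hx)
  simp only [h1] at h2
  rw [Function.update_eq_self] at h2
  rw [h2]
  have hr := hz j
  have dn : HasDerivAt (fun y => g (-y)) (-deriv g (-z j)) (z j) := by
    have := (dg (-z j)).hasDerivAt.scomp (z j) (hasDerivAt_neg (z j))
    rw [neg_one_smul] at this
    exact this
  have a2 : HasDerivAt (fun r : ℝ => k j / r) (-k j / z j ^ 2) (z j) := by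
    refine ((hasDerivAt_inv hr).const_mul (k j)).congr_deriv ?_
    ring
  have h3 : HasDerivAt (fun r => deriv g r + k j / r * (g r - g (-r))) _ (z j) :=
    (dg' (z j)).hasDerivAt.add (a2.mul ((dg (z j)).hasDerivAt.sub dn))
  rw [h3.deriv, axisDunklSq, dunklSq, neg_neg]
  change _ = deriv (deriv g) (z j) + 2 * k j / z j * deriv g (z j) -
    k j * (g (z j) - g (-z j)) / z j ^ 2
  field_simp
  ring

end RootSystem

theorem mainTheorem3 {d : ℕ}
    (R P : Finset (EuclideanSpace ℝ (Fin d))) (κ : EuclideanSpace ℝ (Fin d) → ℝ)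
    (hR : IsRootSystem R) (hP : IsPositiveSubsystem R P) (hκ : IsMultiplicity R κ)
    (hG : Nonempty (reflectionGroup R ≃* Multiplicative (Fin d → ZMod 2)))
    (T : EReal) (hT : 0 < T)
    (u : ℝ → EuclideanSpace ℝ (Fin d) → ℝ)
    (hpos : ∀ t : ℝ, 0 ≤ t → (t : EReal) < T → ∀ x, 0 < u t x)
    (hu : IsDunklHeatSolution P κ T u)
    (s t : ℝ) (hs : 0 < s) (hst : s < t) (htT : (t : EReal) < T)
    (x y : EuclideanSpace ℝ (Fin d)) :
    u s x ≤ u t y * (t / s) ^ ((∑ α ∈ P, κ α) + (d : ℝ) / 2)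
      * Real.exp (‖x - y‖ ^ 2 / (4 * (t - s))) := by
  obtain ⟨e⟩ := hG
  have hcomm : ∀ g ∈ reflectionGroup R, ∀ h ∈ reflectionGroup R, g * h = h * g := by
    intro g hg h hh
    have : (⟨g, hg⟩ * ⟨h, hh⟩ : reflectionGroup R) = ⟨h, hh⟩ * ⟨g, hg⟩ :=
      e.injective (by rw [map_mul, map_mul, mul_comm])
    exact congrArg Subtype.val this
  have hPR : ∀ α ∈ P, α ∈ R := fun α hα => (hP.mem_iff α).2 (Or.inl hα)
  obtain ⟨b, hb⟩ := exists_orthonormalBasis_of_orthogonal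
    (fun α hα => hR.norm_sq α (hPR α hα))
    (fun α hα β hβ hne => inner_eq_zero_of_commute hR hP hcomm hα hβ hne)
  obtain ⟨k, hk0, hk⟩ := exists_coord_multiplicity (fun α hα => hκ.nonneg α (hPR α hα)) b hb
  -- As `T` may be infinite, the argument runs up to a real time `T'` beyond `t`.
  obtain ⟨T', htT', hT'T⟩ := EReal.lt_iff_exists_real_btwn.1 htT
  have htT'' : t < T' := EReal.coe_lt_coe_iff.1 htT'
  have hlt : ∀ τ ∈ Set.Ioo 0 T', (τ : EReal) < T := fun τ hτ =>
    (EReal.coe_lt_coe_iff.2 hτ.2).trans hT'T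
  have hv : ContDiffOn ℝ 2 (fun p : ℝ × (Fin d → ℝ) => u p.1 (ofCoord b p.2))
      (Set.Ioo 0 T' ×ˢ Set.univ) :=
    hu.contDiffOn.comp (f := fun p : ℝ × (Fin d → ℝ) => (p.1, ofCoord b p.2))
      (contDiff_fst.prodMk (contDiff_ofCoord.comp contDiff_snd)).contDiffOn
      (fun p hp => ⟨hp.1.1, hlt _ hp.1⟩)
  have hsec : ∀ τ ∈ Set.Ioo 0 T', ContDiff ℝ 2 (u τ) := by
    intro τ hτ
    rw [← contDiffOn_univ]
    exact hu.contDiffOn.comp (f := fun x : EuclideanSpace ℝ (Fin d) => (τ, x)) (by fun_prop)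
      (fun x _ => ⟨hτ.1, hlt τ hτ⟩)
  have heat : ∀ τ ∈ Set.Ioo 0 T', ∀ z : Fin d → ℝ, (∀ j, z j ≠ 0) →
      deriv (fun τ => u τ (ofCoord b z)) τ = coordDunklLap k (fun z => u τ (ofCoord b z)) z := by
    intro τ hτ z hz
    rw [hu.heat_eq τ hτ.1 (hlt τ hτ), dunklLaplacian_eq_sum_axisDunkl hk (hsec τ hτ)
      (fun i => by rw [inner_ofCoord]; exact hz i)]
    exact Finset.sum_congr rfl fun j _ => axisDunkl_axisDunkl_ofCoord (hsec τ hτ) hz j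
  have main := coord_harnack hk0 hv (fun τ hτ z => hpos τ hτ.1.le (hlt τ hτ) _) heat hs hst htT''
    (fun i => inner ℝ (b i) x) (fun i => inner ℝ (b i) y)
  have e1 : ∑ j, (k j + 1 / 2) = (∑ α ∈ P, κ α) + (d : ℝ) / 2 := by
    -- The constant function turns the coordinate multiplicities into `λ_κ`.
    have := hk fun _ => 1
    simp only [mul_one] at this
    rw [this, Finset.sum_add_distrib]
    simp [div_eq_mul_inv]
  have e2 : ∑ j, (inner ℝ (b j) x - inner ℝ (b j) y) ^ 2 = ‖x - y‖ ^ 2 := by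
    rw [← b.sum_sq_inner_right]
    simp only [inner_sub_right]
  simp only [ofCoord_inner] at main
  rw [e1, e2, ← mul_assoc] at main
  exact main
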